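/- Let $N\ge 1$ and let $S$ be either $(N^{-1}\mathbb Z/\mathbb Z)^2$ (full level $N$; put $c=N$) or its subgroup $\{y=0\}$ (the case of $\Gamma_1(N)$; put $c=1$). An element $\alpha\in S$ has coordinates $(x_\alpha,y_\alpha)$ and is the torsion section $\tilde\alpha=x_\alpha+y_\alpha\tau$ of the curves $E_\tau=\mathbb C/(\mathbb Z\oplus\mathbb Z\tau)$. Let $\mathfrak p_S=\mathbb L(X,Y,t_\alpha\mid\alpha\in S)^\wedge/(\sum_\alpha t_\alpha=[X,Y])$. For a power series $p$ write $p(X)\cdot v=\sum_m p_m\,\mathrm{ad}_X^m(v)$. Let $\theta(v|\tau)=\sum_{n\in\mathbb Z}(-1)^ne^{i\pi\tau(n+1/2)^2}e^{v(n+1/2)}$, with derivative $\theta'$ in $v$, and $$F(x,z,\tau)=2\pi i\,\frac{\theta'(0|\tau)\,\theta(x+2\pi iz|\tau)}{\theta(x|\tau)\,\theta(2\pi iz|\tau)},\qquad h_\alpha(x,z|\tau)=e^{-y_\alpha x}F(x,z-\tilde\alpha,\tau)-\frac{2\pi i}{x},\qquad g_\alpha(x,z|\tau)=\frac{\partial h_\alpha}{\partial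 x}(x,z|\tau),$$ and let $A_{m,\alpha}(\tau)$ be the coefficient of $x^m$ in $g_\alpha(x,0|\tau)$. Let $Y\partial/\partial X$ be the derivation $X\mapsto Y$, $Y\mapsto 0$, $t_\alpha\mapsto 0$, and $\delta_{m,\alpha}$ the derivation $$X\mapsto 0,\quad Y\mapsto\sum_{j+k=m-1}\sum_\beta(-1)^j[\mathrm{ad}_X^jt_\beta,\mathrm{ad}_X^kt_{\alpha+\beta}],\quad t_\beta\mapsto[t_\beta,\mathrm{ad}_X^mt_{\beta+\alpha}+(-1)^m\mathrm{ad}_X^mt_{\beta-\alpha}].$$ The KZB connection is $\nabla=d+\Omega$ with $$\Omega=\Big(2\pi i\,Y\frac{\partial}{\partial X}+\frac12\sum_{m\ge0,\,\alpha}A_{m,\alpha}(\tau)\,\delta_{m,\alpha}+\sum_\alpha g_\alpha(X,z|\tau)\cdot t_\alpha\Big)d\tau+\nu_2,\qquad \nu_2=\Big(2\pi i\,Y+\sum_\alpha h_\alpha(X,z|\tau)\cdot t_\alpha\Big)dz,$$ where elements of $\mathfrak p_S$ act by $\mathrm{ad}$. The cyclotomic KZ connection on $U=\mathbb P^1-\{0,\boldsymbol\mu_N,\infty\}$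 is $$\nabla_{\mathrm{KZ}}=d+\omega_{\mathrm{KZ}},\qquad\omega_{\mathrm{KZ}}=e_0\frac{dw}{w}+\sum_{\zeta\in\boldsymbol\mu_N}e_\zeta\frac{dw}{w-\zeta},$$ the letters acting by $\mathrm{ad}$ on $\mathbb L(e_0,e_\zeta\mid\zeta\in\boldsymbol\mu_N)^\wedge$. Put $q=e^{2\pi i\tau/c}$, $w=e^{2\pi iz}$ and $q_N=e^{2\pi i\tau/N}$. **(1) Identity component over $q=0$.** There is a continuous homomorphism $\varphi$ from the completed enveloping algebra of $\mathbb L(e_0,e_\zeta)^\wedge$ to that of $\mathfrak p_S$, mapping the first Lie algebra into the second, with $$\varphi(e_0)=\sum_{\alpha}\frac{e^{-y_\alpha X}}{e^X-1}\cdot t_\alpha+\sum_{y_\alpha\ne0}e^{-y_\alpha X}\cdot t_\alpha,\qquad \varphi(e_\zeta)=t_\alpha\ \text{ for }\zeta=e^{2\pi ik/N},\ x_\alpha=k/N,\ y_\alpha=0.$$ Here $y_\alpha\in[0,1)$, and the polar part $\frac1X\cdot\sum_\alpha t_\alpha=\frac1X\cdot[X,Y]$ of the first sum is read as $Y$. It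 has the following properties. (a) On $\{|q|<|w|<1/|q|,\ w^N\neq1\}$ one has $\Omega=G\,\frac{dq}{q}+H\,dw$, with $G,H$ extending holomorphically across $q=0$, and the pullback $H(0,w)\,dw$ of $\Omega$ to the component $q=0$ is $\mathrm{ad}\,\varphi(\omega_{\mathrm{KZ}})$, i.e. it is the cyclotomic KZ connection after the change of variables $\varphi$. (b) Let $E'_\tau$ be $E_\tau$ without the points of $S$. For a path-connected space $M$ let $\mathfrak p(M,x)$ be the complex Lie algebra of the unipotent completion of $\pi_1(M,x)$. Let $\psi_\tau$, defined on $\mathfrak p(E'_\tau,x)$, be the map with $\psi_\tau(\log\beta)=\log\big(T(\tilde\beta)^{-1}e^{-mX}\big)$, where $\tilde\beta$ is a lift to $\mathbb C$ of the loop $\beta$, ending at its starting point plus $m\tau+n$, and $T(\tilde\beta)^{-1}=1+\int_{\tilde\beta}\nu_2+\int_{\tilde\beta}\nu_2\nu_2+\cdots$. Let $\psi_{\mathrm{KZ}}$, defined on $\mathfrak p(U,w_0)$, be induced in the same way by $\omega_{\mathrm{KZ}}$. For $0<r<1$ let $K_r=\{r<|w|<1/r\}-\boldsymbol\mu_N$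 and $w_0\in K_r$; it is included in $U$ and, when $|q_N|<r$, maps to $E'_\tau$ by $w=e^{2\pi iz}\mapsto z$. Then for every $u\in\mathfrak p(K_r,w_0)$, with images in $\mathfrak p(E'_\tau,\cdot)$ and $\mathfrak p(U,w_0)$ again denoted by $u$, one has $\lim_{\operatorname{Im}\tau\to\infty}\psi_\tau(u)=\varphi(\psi_{\mathrm{KZ}}(u))$. **(2) The case of $\Gamma_1(N)$.** Here $\varphi(e_0)=\frac{X}{e^X-1}\cdot Y$. **(3) All components of the singular fibers, full level $N$.** Let $\gamma=\begin{pmatrix}a&b\\c'&d\end{pmatrix}\in\mathrm{SL}_2(\mathbb Z)$, $j\in\mathbb Z$ and $w=e^{2\pi i(z-(j/N)\tau)}$. Pull $\Omega$ back along $(\tau,z)\mapsto(\gamma\tau,z/(c'\tau+d))$ and write it in the frame given by the factor of automorphy $M_\gamma(\tau)\circ\exp\big(c'z\,\mathrm{ad}_X/(c'\tau+d)\big)$, where $M_\gamma(\tau)$ maps $X\mapsto(c'\tau+d)X$, $Y\mapsto(c'\tau+d)^{-1}Y+\frac{c'}{2\pi i}X$ and $t_\alpha\mapsto t_\alpha$.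 Its $dw$ component $H(q_N,w)$, that is, the connection along the fibers, extends holomorphically across $q_N=0$, and on the $j$-th component over the cusp $\gamma(i\infty)$ it is the cyclotomic KZ connection: $H(0,w)\,dw=\mathrm{ad}\,\varphi(\omega_{\mathrm{KZ}})$, with $\varphi$ as above, now given by $$\varphi(e_0)=\sum_\alpha\frac{e^{-y_\alpha X}}{e^X-1}\cdot t_{\alpha\gamma^{-1}}+\sum_{y_\alpha\ne j/N}e^{-y_\alpha X}\cdot t_{\alpha\gamma^{-1}},\qquad \varphi(e_\zeta)=e^{-(j/N)X}\cdot t_{\alpha\gamma^{-1}}\ \text{ for }\zeta=e^{2\pi ik/N},\ x_\alpha=k/N,\ y_\alpha=j/N,$$ where $y_\alpha\in[j/N,j/N+1)$ and $\mathrm{SL}_2(\mathbb Z)$ acts on torsion sections by $(y_\alpha\ x_\alpha)\mapsto(y_\alpha\ x_\alpha)\gamma$. -/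

import Mathlib

open scoped Topology
open scoped TensorProduct

noncomputable section

namespace KZB

/-! ### Non-commutative power series and completed free Lie algebras -/

/-- The algebra `ℂ⟪σ⟫` of formal power series in non-commuting letters `x ∈ σ`: a series is given by
its coefficient at each word. The product is the Cauchy product and the topology is coefficientwise
convergence. It is the completed tensor algebra on the letters. -/
def NCSeries (σ : Type) : Type := List σ → ℂ

namespace NCSeries

variable {σ : Type}

instance : AddCommGroup (NCSeries σ) := inferInstanceAs (AddCommGroup (List σ → ℂ))
instance : Module ℂ (NCSeries σ) := inferInstanceAs (Module ℂ (List σ → ℂ))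
instance : TopologicalSpace (NCSeries σ) := inferInstanceAs (TopologicalSpace (List σ → ℂ))

@[ext] theorem ext {f g : NCSeries σ} (h : ∀ w, f w = g w) : f = g := funext h

instance : One (NCSeries σ) := ⟨fun w => if w.length = 0 then 1 else 0⟩
instance : Mul (NCSeries σ) :=
  ⟨fun f g w => ∑ i ∈ Finset.range (w.length + 1), f (w.take i) * g (w.drop i)⟩

theorem mul_apply (f g : NCSeries σ) (w : List σ) :
    (f * g) w = ∑ i ∈ Finset.range (w.length + 1), f (w.take i) * g (w.drop i) := rfl
theorem one_apply (w : List σ) : (1 : NCSeries σ) w = if w.length = 0 then 1 else 0 := rfl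
@[simp] theorem add_apply (f g : NCSeries σ) (w : List σ) : (f + g) w = f w + g w := rfl
@[simp] theorem zero_apply (w : List σ) : (0 : NCSeries σ) w = 0 := rfl
@[simp] theorem smul_apply (c : ℂ) (f : NCSeries σ) (w : List σ) : (c • f) w = c * f w := rfl

/-- The left derivative. -/
def shift (a : σ) (f : NCSeries σ) : NCSeries σ := fun w => f (a :: w)

theorem mul_nil (f g : NCSeries σ) : (f * g) [] = f [] * g [] := by simp [mul_apply]

theorem mul_cons (f g : NCSeries σ) (a : σ) (w : List σ) :
    (f * g) (a :: w) = f [] * g (a :: w) + (shift a f * g) w := by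
  rw [mul_apply, List.length_cons, Finset.sum_range_succ', add_comm]
  simp [mul_apply, shift]

theorem shift_mul (f g : NCSeries σ) (a : σ) :
    shift a (f * g) = f [] • shift a g + shift a f * g := by
  ext w; exact mul_cons f g a w

protected theorem add_mul (f g h : NCSeries σ) : (f + g) * h = f * h + g * h := by
  ext w; simp [mul_apply, _root_.add_mul, Finset.sum_add_distrib]
protected theorem mul_add (f g h : NCSeries σ) : f * (g + h) = f * g + f * h := by
  ext w; simp [mul_apply, _root_.mul_add, Finset.sum_add_distrib]
protected theorem smul_mul (c : ℂ) (f g : NCSeries σ) : (c • f) * g = c • (f * g) := by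
  ext w; simp [mul_apply, Finset.mul_sum, _root_.mul_assoc]
protected theorem mul_smul (c : ℂ) (f g : NCSeries σ) : f * (c • g) = c • (f * g) := by
  ext w; simp [mul_apply, Finset.mul_sum, mul_left_comm]

protected theorem mul_assoc (f g h : NCSeries σ) : f * g * h = f * (g * h) := by
  ext w
  induction w generalizing f g h with
  | nil => simp [mul_nil, _root_.mul_assoc]
  | cons a w ih =>
    rw [mul_cons, mul_cons f, shift_mul, NCSeries.add_mul, NCSeries.smul_mul, add_apply,
      smul_apply, ih, mul_cons g, mul_nil]
    ring

protected theorem one_mul (f : NCSeries σ) : 1 * f = f := by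
  ext w
  cases w with
  | nil => simp [mul_nil, one_apply]
  | cons a w =>
    have h : shift a (1 : NCSeries σ) = 0 := by ext w; simp [shift, one_apply]
    have h0 : ((0 : NCSeries σ) * f) w = 0 := by simp [mul_apply]
    rw [mul_cons, h, h0]; simp [one_apply]

protected theorem mul_one (f : NCSeries σ) : f * 1 = f := by
  ext w
  induction w generalizing f with
  | nil => simp [mul_nil, one_apply]
  | cons a w ih => rw [mul_cons, ih]; simp [one_apply, shift]

instance : Ring (NCSeries σ) :=
  { (inferInstance : AddCommGroup (NCSeries σ)) with
    mul := (· * ·)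
    one := 1
    left_distrib := NCSeries.mul_add
    right_distrib := NCSeries.add_mul
    zero_mul := fun f => by ext w; simp [mul_apply]
    mul_zero := fun f => by ext w; simp [mul_apply]
    mul_assoc := NCSeries.mul_assoc
    one_mul := NCSeries.one_mul
    mul_one := NCSeries.mul_one }

instance : Algebra ℂ (NCSeries σ) := Algebra.ofModule NCSeries.smul_mul NCSeries.mul_smul

theorem continuous_eval (w : List σ) : Continuous fun f : NCSeries σ => f w :=
  continuous_apply (A := fun _ : List σ => ℂ) w

instance : IsTopologicalAddGroup (NCSeries σ) :=
  inferInstanceAs (IsTopologicalAddGroup (List σ → ℂ))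
instance : ContinuousSMul ℂ (NCSeries σ) :=
  inferInstanceAs (ContinuousSMul ℂ (List σ → ℂ))
instance : ContinuousMul (NCSeries σ) :=
  ⟨continuous_pi fun w => by
    change Continuous fun p : NCSeries σ × NCSeries σ =>
      ∑ i ∈ Finset.range (w.length + 1), p.1 (w.take i) * p.2 (w.drop i)
    exact continuous_finsetSum _ fun i _ =>
      ((continuous_eval _).comp continuous_fst).mul ((continuous_eval _).comp continuous_snd)⟩

instance : LieRing (NCSeries σ) := LieRing.ofAssociativeRing
instance : LieAlgebra ℂ (NCSeries σ) := LieAlgebra.ofAssociativeAlgebra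

open Classical in
/-- The letter `x`, as a series. -/
def letter (x : σ) : NCSeries σ := fun w => if w = [x] then 1 else 0

variable (σ) in
/-- The completed free Lie algebra `𝕃(σ)^` inside its completed enveloping algebra `ℂ⟪σ⟫`: the
closure of the Lie subalgebra generated by the letters. -/
def freeLie : LieSubalgebra ℂ (NCSeries σ) where
  toSubmodule := (LieSubalgebra.lieSpan ℂ (NCSeries σ)
    (Set.range (letter (σ := σ)))).toSubmodule.topologicalClosure
  lie_mem' := fun {f g} hf hg => by
    have hc : Continuous fun p : NCSeries σ × NCSeries σ => ⁅p.1, p.2⁆ := by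
      simp only [Ring.lie_def]; fun_prop
    exact map_mem_closure₂ (f := fun a b : NCSeries σ => ⁅a, b⁆) hc hf hg
      fun a ha b hb => LieSubalgebra.lie_mem _ ha hb

/-- The value `∑ pₘ uᵐ` of a power series at a non-commutative series `u` without constant term (the
coefficient of `uᵐ` at a word of length `< m` vanishes, so the sum at each word is finite). -/
def evalSeries (p : PowerSeries ℂ) (u : NCSeries σ) : NCSeries σ := fun w =>
  ∑ m ∈ Finset.range (w.length + 1), PowerSeries.coeff m p * (u ^ m) w

/-- The action `p(u) · v = ∑ pₘ ad_uᵐ(v)` of a power series in `u`, where `u` has no constant term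
(so the sum at each word is finite). -/
def adSeries (p : PowerSeries ℂ) (u v : NCSeries σ) : NCSeries σ := fun w =>
  ∑ m ∈ Finset.range (w.length + 1),
    PowerSeries.coeff m p * (((LieAlgebra.ad ℂ (NCSeries σ) u) ^ m) v) w

/-- The continuous derivation with value `c x` on the letter `x`: every occurrence of a letter `x`
in a word is replaced in turn by `c x`. The coefficient at `w = w₁w₂w₃` receives the coefficient of
`w₁ x w₃` times the coefficient of `c x` at `w₂`. -/
def der [Fintype σ] (c : σ → NCSeries σ) : NCSeries σ →ₗ[ℂ] NCSeries σ where
  toFun f := fun w => ∑ i ∈ Finset.range (w.length + 1),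
    ∑ k ∈ Finset.range (w.length - i + 1), ∑ x : σ,
      f (w.take i ++ x :: w.drop (i + k)) * c x ((w.drop i).take k)
  map_add' f g := by
    refine funext fun w => Eq.trans ?_ (add_apply _ _ w).symm
    simp only [add_apply, _root_.add_mul, Finset.sum_add_distrib]
  map_smul' a f := by
    refine funext fun w => Eq.trans ?_ (smul_apply _ _ w).symm
    simp only [smul_apply, RingHom.id_apply, Finset.mul_sum, _root_.mul_assoc]

/-- The continuous algebra homomorphism with value `c x` on the letter `x`, where the `c x` have no
constant term (so that only words no longer than `w` contribute to the coefficient at `w`). -/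
def substitute [Fintype σ] (c : σ → NCSeries σ) (f : NCSeries σ) : NCSeries σ := fun w =>
  ∑ n ∈ Finset.range (w.length + 1), ∑ v : Fin n → σ,
    f (List.ofFn v) * ((List.ofFn v).map c).prod w

end NCSeries

open NCSeries

/-! ### The Lie algebra of the connection -/

/-- The `N`-torsion sections; `α` has the coordinates `x_α = α.1 / N` and `y_α = α.2 / N`. -/
abbrev Tors (N : ℕ) : Type := ZMod N × ZMod N

/-- The `N`-torsion sections over `Y₁(N)`: those with `y_α = 0`. -/
def realTors (N : ℕ) : AddSubgroup (Tors N) := AddSubgroup.prod ⊤ ⊥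

/-- Free generators of the Lie algebra
`𝔭_S = 𝕃(X, Y, t_α | α ∈ S)^ / (∑ t_α = [X, Y])`: the relation eliminates `t_0`. -/
inductive Gen (N : ℕ) (S : AddSubgroup (Tors N)) : Type
  | X : Gen N S
  | Y : Gen N S
  | t (α : Tors N) (h : α ∈ S ∧ α ≠ 0) : Gen N S

section Lie

variable {N : ℕ} [NeZero N]

instance (S : AddSubgroup (Tors N)) : Fintype (Gen N S) :=
  Fintype.ofInjective (β := Option (Option (Tors N)))
    (fun g => match g with
      | Gen.X => none
      | Gen.Y => some none
      | Gen.t α _ => some (some α))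
    (fun a b h => by cases a <;> cases b <;> simp_all)

variable (S : AddSubgroup (Tors N))

/-- The Lie algebra `𝔭_S` with its completed enveloping algebra `NCSeries (Gen N S)`. -/
abbrev pLie : LieSubalgebra ℂ (NCSeries (Gen N S)) := freeLie (Gen N S)

/-- The generator `X`. -/
def genX : NCSeries (Gen N S) := letter Gen.X

/-- The generator `Y`. -/
def genY : NCSeries (Gen N S) := letter Gen.Y

open Classical in
/-- The generator `t_α` for `α ∈ S`, where `t_0 = [X, Y] - ∑_{α ≠ 0} t_α`; and `t_α = 0` for
`α ∉ S`. -/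
def genT (α : Tors N) : NCSeries (Gen N S) :=
  if h : α ∈ S ∧ α ≠ 0 then letter (Gen.t α h)
  else if α = 0 then
    ⁅genX S, genY S⁆ - ∑ β : Tors N, if h : β ∈ S ∧ β ≠ 0 then letter (Gen.t β h) else 0
  else 0

/-- The defining relation of `𝔭_S`. -/
theorem sum_genT : ∑ α : Tors N, genT S α = ⁅genX S, genY S⁆ := by
  classical
  have h0 : ∀ α ∈ Finset.univ.erase (0 : Tors N), genT S α =
      if h : α ∈ S ∧ α ≠ 0 then letter (Gen.t α h) else 0 := fun α hα => by
    simp [genT, Finset.ne_of_mem_erase hα]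
  rw [← Finset.add_sum_erase _ _ (Finset.mem_univ (0 : Tors N)), Finset.sum_congr rfl h0]
  have h1 : genT S (0 : Tors N) = ⁅genX S, genY S⁆ -
      ∑ β : Tors N, if h : β ∈ S ∧ β ≠ 0 then letter (Gen.t β h) else 0 := by simp [genT]
  rw [h1, ← Finset.add_sum_erase _ (fun β : Tors N =>
    if h : β ∈ S ∧ β ≠ 0 then letter (Gen.t β h) else (0 : NCSeries (Gen N S)))
    (Finset.mem_univ (0 : Tors N))]
  simp

/-- `p(X) · v` for a power series `p`. -/
def actX (p : PowerSeries ℂ) (v : NCSeries (Gen N S)) : NCSeries (Gen N S) :=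
  adSeries p (genX S) v

/-- `ad_Xᵐ(t_α)`. -/
def adXT (m : ℕ) (α : Tors N) : NCSeries (Gen N S) :=
  ((LieAlgebra.ad ℂ (NCSeries (Gen N S)) (genX S)) ^ m) (genT S α)

/-- The derivation `Y ∂/∂X`: `X ↦ Y`, `Y ↦ 0`, `t_α ↦ 0`. -/
def derYX : NCSeries (Gen N S) →ₗ[ℂ] NCSeries (Gen N S) :=
  der fun g => match g with
    | Gen.X => genY S
    | Gen.Y => 0
    | Gen.t _ _ => 0

/-- The derivation `δ_{m,α}`. -/
def delta (m : ℕ) (α : Tors N) : NCSeries (Gen N S) →ₗ[ℂ] NCSeries (Gen N S) :=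
  der fun g => match g with
    | Gen.X => 0
    | Gen.Y => ∑ j ∈ Finset.range m, ∑ β : Tors N,
        (-1 : ℂ) ^ j • ⁅adXT S j β, adXT S (m - 1 - j) (α + β)⁆
    | Gen.t β _ => ⁅genT S β, adXT S m (β + α) + (-1 : ℂ) ^ m • adXT S m (β - α)⁆

end Lie

/-! ### Jacobi forms -/

section Jacobi

open Complex
open scoped UpperHalfPlane

/-- The theta function `θ(v|τ)`. -/
def theta (v : ℂ) (τ : ℍ) : ℂ :=
  ∑' n : ℤ, (-1 : ℂ) ^ n * cexp (I * Real.pi * τ * (n + 1 / 2) ^ 2) * cexp (v * (n + 1 / 2))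

/-- Zagier's Jacobi form `θ'(0) θ(u + v) / (θ(u) θ(v))`. -/
def zagierF (u v : ℂ) (τ : ℍ) : ℂ :=
  deriv (fun s => theta s τ) 0 * theta (u + v) τ / (theta u τ * theta v τ)

/-- The Jacobi form `F(x, z, τ)`. -/
def jacobiF (x z : ℂ) (τ : ℍ) : ℂ := 2 * Real.pi * I * zagierF x (2 * Real.pi * I * z) τ

variable {N : ℕ}

/-- The lift in `[0, 1)` of the coordinate `x_α`. -/
def xCoord (α : Tors N) : ℂ := (α.1.val : ℂ) / N

/-- The lift in `[0, 1)` of the coordinate `y_α`. -/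
def yCoord (α : Tors N) : ℂ := (α.2.val : ℂ) / N

/-- The lift `x_α + y_α τ` of the torsion section `α`. -/
def torsPoint (α : Tors N) (τ : ℍ) : ℂ := xCoord α + yCoord α * τ

/-- The function `h_α(x, z|τ) = exp(-y_α x) F(x, z - α̃, τ) - 2πi/x`. -/
def hFun (α : Tors N) (x z : ℂ) (τ : ℍ) : ℂ :=
  cexp (-(yCoord α * x)) * jacobiF x (z - torsPoint α τ) τ - 2 * Real.pi * I / x

/-- The Taylor series at `0` of a function with a removable singularity there. -/
def taylorSeries (f : ℂ → ℂ) : PowerSeries ℂ := PowerSeries.mk fun n =>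
  iteratedDeriv n (Function.update f 0 (Filter.limUnder (𝓝[≠] (0 : ℂ)) f)) 0 / (n.factorial : ℂ)

/-- `h_α(x, z|τ)` as a power series in `x`. -/
def hSeries (α : Tors N) (z : ℂ) (τ : ℍ) : PowerSeries ℂ := taylorSeries fun x => hFun α x z τ

/-- `g_α(x, z|τ) = ∂h_α/∂x` as a power series in `x`. -/
def gSeries (α : Tors N) (z : ℂ) (τ : ℍ) : PowerSeries ℂ :=
  PowerSeries.derivative ℂ (hSeries α z τ)

/-- The coefficient `A_{m,α}(τ)` of `xᵐ` in `g_α(x, 0|τ)`. For `α = 0` the point `z = 0` is a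
removable singularity of `g_α`. -/
def coeffA (m : ℕ) (α : Tors N) (τ : ℍ) : ℂ :=
  Filter.limUnder (𝓝[≠] (0 : ℂ)) fun z => PowerSeries.coeff m (gSeries α z τ)

end Jacobi

/-! ### The KZB connection -/

section Connection

open Complex
open scoped UpperHalfPlane

variable {N : ℕ} [NeZero N] (S : AddSubgroup (Tors N))

/-- `ψ = ½ ∑ A_{m,α}(τ) δ_{m,α}` (the coefficient of `dτ`). As `δ_{m,α}` raises the degree by at
least `m`, the sum is finite at each word. -/
def psi (τ : ℍ) : NCSeries (Gen N S) →ₗ[ℂ] NCSeries (Gen N S) where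
  toFun f := fun w => (1 / 2) * ∑ m ∈ Finset.range (w.length + 1), ∑ α : Tors N,
    coeffA m α τ * (delta S m α f) w
  map_add' f g := by
    refine funext fun w => Eq.trans ?_ (NCSeries.add_apply _ _ w).symm
    simp only [map_add, NCSeries.add_apply, mul_add, Finset.sum_add_distrib]
  map_smul' a f := by
    refine funext fun w => Eq.trans ?_ (NCSeries.smul_apply _ _ w).symm
    simp only [map_smul, NCSeries.smul_apply, RingHom.id_apply, Finset.mul_sum]
    exact Finset.sum_congr rfl fun m _ => Finset.sum_congr rfl fun α _ => by ring

/-- `ν₁ = ∑ g_α(X, z|τ) · t_α` (the coefficient of `dτ`). -/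
def nu1 (τ : ℍ) (z : ℂ) : NCSeries (Gen N S) :=
  ∑ α : Tors N, actX S (gSeries α z τ) (genT S α)

/-- `ν₂ = 2πi Y + ∑ h_α(X, z|τ) · t_α` (the coefficient of `dz`). -/
def nu2 (τ : ℍ) (z : ℂ) : NCSeries (Gen N S) :=
  (2 * Real.pi * I : ℂ) • genY S + ∑ α : Tors N, actX S (hSeries α z τ) (genT S α)

/-- The coefficient of `dτ` in the connection form `Ω = 2πi Y ∂/∂X dτ + ψ + ν₁ + ν₂` of the KZB
connection `∇ = d + Ω`. -/
def omegaTau (τ : ℍ) (z : ℂ) : NCSeries (Gen N S) →ₗ[ℂ] NCSeries (Gen N S) :=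
  (2 * Real.pi * I : ℂ) • derYX S + psi S τ + LieAlgebra.ad ℂ (NCSeries (Gen N S)) (nu1 S τ z)

/-- The coefficient of `dz` in the connection form of the KZB connection. -/
def omegaZ (τ : ℍ) (z : ℂ) : NCSeries (Gen N S) →ₗ[ℂ] NCSeries (Gen N S) :=
  LieAlgebra.ad ℂ (NCSeries (Gen N S)) (nu2 S τ z)

/-- The local parameter `exp(2πiτ/c)` at a cusp of width `c`. -/
def qPar (c : ℕ) (τ : ℍ) : ℂ := cexp (2 * Real.pi * I * τ / c)

/-- The coordinate `exp(2πiz)` of `ℙ¹ - {0, ∞}`. -/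
def wPar (z : ℂ) : ℂ := cexp (2 * Real.pi * I * z)

/-- A neighbourhood of the component `ℙ¹ - {0, μ_N, ∞}` of the singular fiber, with the coordinates
`(q, w)`, away from the torsion sections. The component is the locus `q = 0`. -/
def fiberChart (N : ℕ) : Set (ℂ × ℂ) := {p | ‖p.1‖ < ‖p.2‖ ∧ ‖p.1‖ * ‖p.2‖ < 1 ∧ p.2 ^ N ≠ 1}

/-- A family of operators on `ℂ⟪X, Y, t_α⟫` is holomorphic if all its coefficients are. -/
def IsHolomorphicFamily (G : ℂ × ℂ → NCSeries (Gen N S) →ₗ[ℂ] NCSeries (Gen N S)) : Prop :=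
  ∀ (v : NCSeries (Gen N S)) (l : List (Gen N S)),
    DifferentiableOn ℂ (fun p : ℂ × ℂ => (G p v) l) (fiberChart N)

/-- The KZB connection form is `Ω = G dq/q + H dw` with `G`, `H` holomorphic near the identity
component of the singular fiber, where `q = exp(2πiτ/c)` and `w = exp(2πiz)`. The pullback of `Ω`
to the component `q = 0` is `H(0, w) dw`. -/
def IsLogForm (c : ℕ) (G H : ℂ × ℂ → NCSeries (Gen N S) →ₗ[ℂ] NCSeries (Gen N S)) : Prop :=
  IsHolomorphicFamily S G ∧ IsHolomorphicFamily S H ∧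
  ∀ (τ : ℍ) (z : ℂ), (qPar c τ, wPar z) ∈ fiberChart N →
    omegaTau S τ z = (2 * Real.pi * I / c : ℂ) • G (qPar c τ, wPar z) ∧
    omegaZ S τ z = (2 * Real.pi * I * wPar z : ℂ) • H (qPar c τ, wPar z)

end Connection

/-! ### The other cusps -/

section Cusps

open Complex
open scoped UpperHalfPlane MatrixGroups

variable {N : ℕ} [NeZero N] (S : AddSubgroup (Tors N))

/-- `cτ + d`. -/
def autFactor (γ : SL(2, ℤ)) (τ : ℍ) : ℂ := ((γ 1 0 : ℤ) : ℂ) * τ + ((γ 1 1 : ℤ) : ℂ)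

/-- The right action of `SL₂(ℤ)` on torsion sections: `(y, x) ↦ (y, x) γ`. -/
def torsAct (α : Tors N) (γ : SL(2, ℤ)) : Tors N :=
  (((γ 0 1 : ℤ) : ZMod N) * α.2 + ((γ 1 1 : ℤ) : ZMod N) * α.1,
   ((γ 0 0 : ℤ) : ZMod N) * α.2 + ((γ 1 0 : ℤ) : ZMod N) * α.1)

/-- The automorphism `M_γ(τ)`: `X ↦ (cτ + d) X`, `Y ↦ (cτ + d)⁻¹ Y + (c/2πi) X`, `t_α ↦ t_α`. -/
def modAut (γ : SL(2, ℤ)) (τ : ℍ) : NCSeries (Gen N S) → NCSeries (Gen N S) :=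
  substitute fun g => match g with
    | Gen.X => autFactor γ τ • genX S
    | Gen.Y => (autFactor γ τ)⁻¹ • genY S + (((γ 1 0 : ℤ) : ℂ) / (2 * Real.pi * I)) • genX S
    | Gen.t α h => letter (Gen.t α h)

/-- `exp(aX)`. -/
def expX (a : ℂ) : NCSeries (Gen N S) :=
  evalSeries (PowerSeries.rescale a (PowerSeries.exp ℂ)) (genX S)

/-- The factor of automorphy `M_γ(τ) ∘ exp(czX/(cτ + d))`; the exponential acts by conjugation. -/
def autFrame (γ : SL(2, ℤ)) (τ : ℍ) (z : ℂ) (v : NCSeries (Gen N S)) : NCSeries (Gen N S) :=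
  modAut S γ τ (expX S (((γ 1 0 : ℤ) : ℂ) * z / autFactor γ τ) * v *
    expX S (-(((γ 1 0 : ℤ) : ℂ) * z / autFactor γ τ)))

/-- The `j`-th component of the singular fiber over the cusp `γ(i∞)`: it has the coordinate
`w = exp(2πi(z - (j/N)τ))`, and the connection is pulled back along
`(τ, z) ↦ (γτ, z/(cτ + d))` and written in the frame given by the factor of automorphy. Its `dw`
component in this frame is `H(q, w)`, with `H` holomorphic near the component `q = 0`. -/
def IsCuspForm (γ : SL(2, ℤ)) (j : ℤ)
    (H : ℂ × ℂ → NCSeries (Gen N S) →ₗ[ℂ] NCSeries (Gen N S)) : Prop :=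
  IsHolomorphicFamily S H ∧
  ∀ (τ : ℍ) (z : ℂ), (qPar N τ, wPar (z - (j / N : ℂ) * τ)) ∈ fiberChart N →
    ∀ (v : NCSeries (Gen N S)) (l : List (Gen N S)),
      deriv (fun s => autFrame S γ τ s v l) z +
        (autFactor γ τ)⁻¹ *
          (omegaZ S (γ • τ) (z / autFactor γ τ) (autFrame S γ τ z v)) l =
      autFrame S γ τ z ((2 * Real.pi * I * wPar (z - (j / N : ℂ) * τ) : ℂ) •
        H (qPar N τ, wPar (z - (j / N : ℂ) * τ)) v) l

end Cusps

/-! ### The cyclotomic KZ connection and the change of variables -/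

/-- The letters `e_0` and `e_ζ`, with `ζ = exp(2πik/N)`. -/
inductive KZLetter (N : ℕ) : Type
  | zero : KZLetter N
  | root (k : ZMod N) : KZLetter N

section KZ

open Complex

variable {N : ℕ} [NeZero N] (S : AddSubgroup (Tors N))

/-- The root of unity `exp(2πik/N)`. -/
def rootOf (k : ZMod N) : ℂ := cexp (2 * Real.pi * I * k.val / N)

/-- The coefficient of `dw` in the form `e_0 dw/w + ∑ e_ζ dw/(w - ζ)` of the cyclotomic KZ
connection. -/
def kzForm (w : ℂ) : NCSeries (KZLetter N) :=
  w⁻¹ • letter KZLetter.zero + ∑ k : ZMod N, (w - rootOf k)⁻¹ • letter (KZLetter.root k)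

/-- The power series `(exp x - 1)/x`. -/
def expSubOneDiv : PowerSeries ℂ := PowerSeries.mk fun n => ((n + 1).factorial : ℂ)⁻¹

/-- The power series `exp(ax)`. -/
def expSeries (a : ℂ) : PowerSeries ℂ := PowerSeries.rescale a (PowerSeries.exp ℂ)

/-- The power series `exp(-yx)/(exp x - 1) - 1/x`. -/
def expQuot (y : ℂ) : PowerSeries ℂ := PowerSeries.mk fun n =>
  PowerSeries.coeff (n + 1) (expSeries (-y) * expSubOneDiv⁻¹)

/-- The representative of `y_α` in `[j/N, j/N + 1)`. -/
def yLift (j : ℤ) (α : Tors N) : ℂ := ((j : ℂ) + ((α.2 - (j : ZMod N)).val : ℂ)) / N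

open Classical in
/-- The series
`∑_α exp(-y_α X)/(exp X - 1) · t_α + ∑_{y_α ≠ j/N} exp(-y_α X) · t_α`, `y_α ∈ [j/N, j/N + 1)`,
where the polar part is read as `1/X · ∑_α t_α = 1/X · [X, Y] = Y`. The elements `t_α` are a
parameter `T`, to allow for a permutation of them. -/
def e0Series (T : Tors N → NCSeries (Gen N S)) (j : ℤ) : NCSeries (Gen N S) :=
  genY S + ∑ α : Tors N, actX S (expQuot (yLift j α)) (T α) +
    ∑ α : Tors N, if α.2 = (j : ZMod N) then 0 else actX S (expSeries (-(yLift j α))) (T α)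

end KZ

/-! ### Unipotent fundamental groups -/

section UnipotentCompletion

variable (Γ : Type) [Group Γ]

/-- The augmentation ideal `I` of the group algebra `ℂΓ`. -/
abbrev augIdeal : Ideal (MonoidAlgebra ℂ Γ) :=
  RingHom.ker (Bialgebra.counitAlgHom ℂ (MonoidAlgebra ℂ Γ))

/-- The `I`-adically completed group algebra `ℂΓ^ = lim ℂΓ/Iⁿ`, as the compatible sequences. -/
def completedGroupAlgebra : Subalgebra ℂ (∀ n : ℕ, MonoidAlgebra ℂ Γ ⧸ augIdeal Γ ^ n) where
  carrier := {u | ∀ m n : ℕ, ∀ h : m ≤ n,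
    Ideal.Quotient.factorₐ ℂ (Ideal.pow_le_pow_right (I := augIdeal Γ) h) (u n) = u m}
  mul_mem' := fun hu hv m n h => by
    rw [Pi.mul_apply, map_mul, hu m n h, hv m n h, Pi.mul_apply]
  add_mem' := fun hu hv m n h => by
    rw [Pi.add_apply, map_add, hu m n h, hv m n h, Pi.add_apply]
  algebraMap_mem' := fun r m n h => AlgHom.commutes _ r

instance : LieRing (completedGroupAlgebra Γ) := LieRing.ofAssociativeRing
instance : LieAlgebra ℂ (completedGroupAlgebra Γ) := LieAlgebra.ofAssociativeAlgebra

/-- The coproduct `γ ↦ γ ⊗ γ`, followed by the projection to `ℂΓ/Iᵃ ⊗ ℂΓ/Iᵇ`. It factors through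
`ℂΓ/Iᵃ⁺ᵇ`, and these maps together are the coproduct of `ℂΓ^`. -/
def coprod (a b : ℕ) : MonoidAlgebra ℂ Γ →ₐ[ℂ]
    (MonoidAlgebra ℂ Γ ⧸ augIdeal Γ ^ a) ⊗[ℂ] (MonoidAlgebra ℂ Γ ⧸ augIdeal Γ ^ b) :=
  (Algebra.TensorProduct.map (Ideal.Quotient.mkₐ ℂ (augIdeal Γ ^ a))
    (Ideal.Quotient.mkₐ ℂ (augIdeal Γ ^ b))).comp (Bialgebra.comulAlgHom ℂ (MonoidAlgebra ℂ Γ))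

/-- The Lie algebra (over `ℂ`) of the unipotent completion of `Γ`: the primitive elements
`Δu = u ⊗ 1 + 1 ⊗ u` of the completed group algebra. -/
def malcevLie : LieSubalgebra ℂ (completedGroupAlgebra Γ) where
  carrier := {u | ∀ a b : ℕ, ∃ y : MonoidAlgebra ℂ Γ,
    Ideal.Quotient.mkₐ ℂ (augIdeal Γ ^ (a + b)) y = u.1 (a + b) ∧
    coprod Γ a b y = Ideal.Quotient.mkₐ ℂ (augIdeal Γ ^ a) y ⊗ₜ[ℂ] 1 +
      1 ⊗ₜ[ℂ] Ideal.Quotient.mkₐ ℂ (augIdeal Γ ^ b) y}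
  zero_mem' := fun a b => ⟨0, by simp⟩
  add_mem' := fun {u v} hu hv a b => by
    obtain ⟨y, h1, h2⟩ := hu a b
    obtain ⟨z, h3, h4⟩ := hv a b
    refine ⟨y + z, ?_, ?_⟩
    · rw [map_add, h1, h3]; rfl
    · rw [map_add, h2, h4, map_add, map_add, TensorProduct.add_tmul, TensorProduct.tmul_add]
      abel
  smul_mem' := fun c u hu a b => by
    obtain ⟨y, h1, h2⟩ := hu a b
    refine ⟨c • y, ?_, ?_⟩
    · rw [map_smul, h1]; rfl
    · rw [map_smul, h2, map_smul, map_smul, smul_add, TensorProduct.smul_tmul',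
        TensorProduct.tmul_smul]
  lie_mem' := fun {u v} hu hv a b => by
    obtain ⟨y, h1, h2⟩ := hu a b
    obtain ⟨z, h3, h4⟩ := hv a b
    refine ⟨y * z - z * y, ?_, ?_⟩
    · rw [map_sub, map_mul, map_mul, h1, h3]; rfl
    · rw [map_sub, map_mul, map_mul, h2, h4]
      simp only [map_sub, map_mul, TensorProduct.sub_tmul, TensorProduct.tmul_sub, add_mul,
        mul_add, Algebra.TensorProduct.tmul_mul_tmul, mul_one, one_mul]
      abel

variable {Γ} {Γ' : Type} [Group Γ']

theorem counit_mapDomain (f : Γ →* Γ') : (Bialgebra.counitAlgHom ℂ (MonoidAlgebra ℂ Γ')).comp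
    (MonoidAlgebra.mapDomainAlgHom ℂ ℂ f) = Bialgebra.counitAlgHom ℂ (MonoidAlgebra ℂ Γ) :=
  by ext; simp

theorem augIdeal_le (f : Γ →* Γ') :
    augIdeal Γ ≤ (augIdeal Γ').comap (MonoidAlgebra.mapDomainAlgHom ℂ ℂ f) := fun y hy => by
  rw [RingHom.mem_ker, ← counit_mapDomain f] at hy
  exact hy

theorem augIdeal_pow_le (f : Γ →* Γ') (n : ℕ) : augIdeal Γ ^ n ≤
    (augIdeal Γ' ^ n).comap (MonoidAlgebra.mapDomainAlgHom ℂ ℂ f) := by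
  induction n with
  | zero => rw [Submodule.pow_zero, Submodule.pow_zero, Ideal.one_eq_top, Ideal.one_eq_top]; exact le_top
  | succ n ih =>
    rw [Submodule.pow_succ, Submodule.pow_succ, Ideal.mul_le]
    intro r hr s hs
    rw [Ideal.mem_comap, map_mul]
    exact Ideal.mul_mem_mul (ih hr) (augIdeal_le f hs)

/-- The map of completed group algebras induced by a group homomorphism. -/
def completedMap (f : Γ →* Γ') (u : completedGroupAlgebra Γ) : completedGroupAlgebra Γ' :=
  ⟨fun n => Ideal.quotientMapₐ (augIdeal Γ' ^ n) (MonoidAlgebra.mapDomainAlgHom ℂ ℂ f)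
    (augIdeal_pow_le f n) (u.1 n), fun m n h => by
      have hu := u.2 m n h
      obtain ⟨y, hy⟩ := Ideal.Quotient.mk_surjective (u.1 n)
      rw [← hy] at hu
      change Ideal.Quotient.factorₐ ℂ _ (Ideal.quotientMapₐ _ _ _ (u.1 n)) =
        Ideal.quotientMapₐ _ _ _ (u.1 m)
      rw [← hu, ← hy]; rfl⟩

/-- The continuous extension `ℂΓ^ → ℂ⟪σ⟫` of a homomorphism `Θ` from `Γ` to the series with constant
term `1`: as `Iⁿ` is sent to series without terms of degree `< n`, the coefficient at a word of
length `n - 1` is computed from a representative in `ℂΓ` of the component in `ℂΓ/Iⁿ`. -/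
def extendToCompletion {σ : Type} (Θ : Γ → NCSeries σ) (u : completedGroupAlgebra Γ) :
    NCSeries σ := fun w =>
  ((Function.surjInv Ideal.Quotient.mk_surjective (u.1 (w.length + 1)) :
    MonoidAlgebra ℂ Γ).coeff.sum fun g a => a • Θ g) w

end UnipotentCompletion

section Spaces

open Complex
open scoped UpperHalfPlane

/-- The fundamental group in which `αβ` is the path `α` followed by the path `β` (in Mathlib's
`FundamentalGroup` it is `β` followed by `α`). -/
abbrev PiOne (X : Type) [TopologicalSpace X] (x : X) : Type := (FundamentalGroup X x)ᵐᵒᵖ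

/-- The homomorphism of fundamental groups induced by a continuous map. -/
def piOneMap {X Y : Type} [TopologicalSpace X] [TopologicalSpace Y] (f : C(X, Y)) (x : X) :
    PiOne X x →* PiOne Y (f x) := MonoidHom.op (FundamentalGroup.map f x)

/-- The lattice `Λ_τ = ℤ ⊕ ℤτ`. -/
def lattice (τ : UpperHalfPlane) : AddSubgroup ℂ :=
  AddSubgroup.zmultiples (1 : ℂ) ⊔ AddSubgroup.zmultiples (τ : ℂ)

theorem mem_lattice {τ : UpperHalfPlane} {z : ℂ} :
    z ∈ lattice τ ↔ ∃ m n : ℤ, z = m * τ + n := by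
  simp only [lattice, AddSubgroup.mem_sup, AddSubgroup.mem_zmultiples_iff]
  constructor
  · rintro ⟨_, ⟨n, rfl⟩, _, ⟨m, rfl⟩, rfl⟩
    exact ⟨m, n, by simp [add_comm]⟩
  · rintro ⟨m, n, rfl⟩
    exact ⟨_, ⟨n, rfl⟩, _, ⟨m, rfl⟩, by simp [add_comm]⟩

/-- A coordinate `z` with `w = exp (2πiz)`. -/
def logCoord (w : ℂ) : ℂ := Complex.log w / (2 * Real.pi * I)

theorem exp_logCoord {w : ℂ} (hw : w ≠ 0) : exp (2 * Real.pi * I * logCoord w) = w := by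
  rw [logCoord, mul_div_cancel₀ _ Complex.two_pi_I_ne_zero, Complex.exp_log hw]

theorem continuousAt_mk_logCoord (τ : UpperHalfPlane) {w : ℂ} (hw : w ≠ 0) :
    ContinuousAt (fun v : ℂ => (QuotientAddGroup.mk (logCoord v) : ℂ ⧸ lattice τ)) w := by
  have hev : (fun v : ℂ => (QuotientAddGroup.mk (logCoord v) : ℂ ⧸ lattice τ)) =ᶠ[nhds w]
      fun v => QuotientAddGroup.mk (logCoord (v / w) + logCoord w) := by
    filter_upwards [isOpen_ne.mem_nhds hw] with v hv
    have hv : v ≠ 0 := hv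
    rw [QuotientAddGroup.eq, mem_lattice]
    have h : exp (2 * Real.pi * I * (-logCoord v + (logCoord (v / w) + logCoord w))) = 1 := by
      rw [mul_add, mul_add, Complex.exp_add, Complex.exp_add, mul_neg, Complex.exp_neg,
        exp_logCoord hv, exp_logCoord hw, exp_logCoord (div_ne_zero hv hw)]
      field_simp
    obtain ⟨n, hn⟩ := Complex.exp_eq_one_iff.1 h
    refine ⟨0, n, ?_⟩
    have : 2 * Real.pi * I * (-logCoord v + (logCoord (v / w) + logCoord w)) =
      2 * Real.pi * I * n := by rw [hn]; ring
    have := mul_left_cancel₀ Complex.two_pi_I_ne_zero this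
    rw [this]; simp
  rw [continuousAt_congr hev]
  refine (continuous_quotient_mk'.continuousAt).comp ?_
  have : ContinuousAt Complex.log (w / w) := by
    rw [div_self hw]; exact continuousAt_clog (by simp)
  unfold logCoord
  exact ((ContinuousAt.comp (f := fun v : ℂ => v / w) this
    (continuousAt_id.div_const w)).div_const _).add continuousAt_const

variable {N : ℕ}

/-- The elliptic curve `E_τ = ℂ/Λ_τ` with the torsion points in `S` removed. -/
abbrev PuncturedCurve (S : AddSubgroup (Tors N)) (τ : ℍ) : Type :=
  {P : ℂ ⧸ lattice τ // ∀ α ∈ S, P ≠ QuotientAddGroup.mk (torsPoint α τ)}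

variable (N) in
/-- `𝔾_m - μ_N = ℙ¹ - {0, μ_N, ∞}`. -/
abbrev PuncturedLine : Type := {w : ℂ // w ≠ 0 ∧ w ^ N ≠ 1}

variable (N) in
/-- The annulus `r < |w| < 1/r` without the `N`-th roots of unity. -/
abbrev PuncturedAnnulus (r : ℝ) : Type := {w : ℂ // r < ‖w‖ ∧ ‖w‖ < r⁻¹ ∧ w ^ N ≠ 1}

theorem PuncturedAnnulus.ne_zero {r : ℝ} (w : PuncturedAnnulus N r) : w.1 ≠ 0 := fun h => by
  obtain ⟨h1, h2, -⟩ := w.2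
  rw [h, norm_zero] at h1 h2
  exact absurd (inv_pos.1 h2) (not_lt.2 h1.le)

variable (N) in
/-- The inclusion of the annulus. -/
def annulusIncl (r : ℝ) : C(PuncturedAnnulus N r, PuncturedLine N) where
  toFun w := ⟨w.1, w.ne_zero, w.2.2.2⟩
  continuous_toFun := by fun_prop

variable [NeZero N]

theorem logCoord_ne_torsPoint {r : ℝ} (τ : ℍ) (hr : ‖qPar N τ‖ < r)
    (w : PuncturedAnnulus N r) (α : Tors N) :
    (QuotientAddGroup.mk (logCoord w.1) : ℂ ⧸ lattice τ) ≠
      QuotientAddGroup.mk (torsPoint α τ) := fun h => by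
  obtain ⟨h1, h2, h3⟩ := w.2
  rw [eq_comm, QuotientAddGroup.eq, mem_lattice] at h
  obtain ⟨m, n, h⟩ := h
  have hN : (N : ℂ) ≠ 0 := Nat.cast_ne_zero.2 (NeZero.ne N)
  have hz : logCoord w.1 = torsPoint α τ + (m * τ + n) := by rw [← h]; ring
  set k : ℤ := α.1.val + n * N with hk
  set j : ℤ := α.2.val + m * N with hj
  have hw : w.1 = cexp (2 * Real.pi * I * (k / N)) * qPar N τ ^ j := by
    rw [← exp_logCoord w.ne_zero, hz, qPar, ← Complex.exp_int_mul, ← Complex.exp_add]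
    congr 1
    simp only [torsPoint, xCoord, yCoord, hk, hj]
    push_cast
    field_simp
    ring
  have hn1 : ‖cexp (2 * Real.pi * I * (k / N))‖ = 1 := by
    have : (2 * Real.pi * I * (k / N) : ℂ) = ((2 * Real.pi * (k / N) : ℝ) : ℂ) * I := by
      push_cast; ring
    rw [this, Complex.norm_exp_ofReal_mul_I]
  have hnorm : ‖w.1‖ = ‖qPar N τ‖ ^ j := by
    rw [hw, norm_mul, hn1, one_mul, norm_zpow]
  have hq0 : 0 < ‖qPar N τ‖ := norm_pos_iff.2 (Complex.exp_ne_zero _)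
  have hr0 : 0 < r := hq0.trans hr
  have hr1 : r < 1 := by
    have h4 : r < r⁻¹ := h1.trans h2
    by_contra h5
    exact absurd (h4.trans_le (inv_le_one_of_one_le₀ (not_lt.1 h5))) h5
  have hq1 : ‖qPar N τ‖ ≤ 1 := (hr.trans hr1).le
  rcases lt_trichotomy j 0 with hj0 | hj0 | hj0
  · have : (‖qPar N τ‖ ^ (-1 : ℤ)) ≤ ‖qPar N τ‖ ^ j :=
      zpow_le_zpow_right_of_le_one₀ hq0 hq1 (by omega)
    rw [zpow_neg_one, ← hnorm] at this
    exact absurd (this.trans_lt h2) (not_lt.2 (inv_anti₀ hq0 hr.le))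
  · apply h3
    rw [hw, hj0, zpow_zero, mul_one, ← Complex.exp_nat_mul, Complex.exp_eq_one_iff]
    exact ⟨k, by field_simp⟩
  · have : ‖qPar N τ‖ ^ j ≤ ‖qPar N τ‖ ^ (1 : ℤ) :=
      zpow_le_zpow_right_of_le_one₀ hq0 hq1 (by omega)
    rw [zpow_one, ← hnorm] at this
    exact absurd (h1.trans_le this) (not_lt.2 hr.le)

/-- The map `w ↦ z` with `w = exp(2πiz)` from the annulus to the punctured elliptic curve `E_τ`,
defined when `|exp(2πiτ/N)| < r`. -/
def annulusToCurve (S : AddSubgroup (Tors N)) {r : ℝ} (τ : ℍ) (hr : ‖qPar N τ‖ < r) :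
    C(PuncturedAnnulus N r, PuncturedCurve S τ) where
  toFun w := ⟨QuotientAddGroup.mk (logCoord w.1), fun α _ => logCoord_ne_torsPoint τ hr w α⟩
  continuous_toFun := by
    refine Continuous.subtype_mk ?_ _
    exact continuous_iff_continuousAt.2 fun w =>
      (continuousAt_mk_logCoord τ w.ne_zero).comp continuousAt_subtype_val

/-- `T` is the inverse parallel transport `1 + ∫ ω + ∫ ωω + ⋯` of the connection `d + ω`,
`ω = f dz`, along the path `γ` in `ℂ`: `T = 1` at the start, and locally `T = Φ ∘ γ` with a
holomorphic `Φ` such that `dΦ = Φ ω`. -/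
def IsTransport {σ : Type} (f : ℂ → NCSeries σ) (γ : unitInterval → ℂ)
    (T : unitInterval → NCSeries σ) : Prop :=
  T 0 = 1 ∧ ∀ t : unitInterval, ∃ Φ : ℂ → NCSeries σ,
    (∀ᶠ z in 𝓝 (γ t), ∀ l : List σ, HasDerivAt (fun s => Φ s l) ((Φ z * f z) l) z) ∧
    ∀ᶠ s in 𝓝 t, T s = Φ (γ s)

/-- The inverse monodromy `Θ_τ` of the KZB connection along a loop `β` in the punctured elliptic
curve: the inverse transport of `ν₂` along a lift of `β` to `ℂ`, which starts at the lift `z₀` of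
the base point and ends at `z₀ + mτ + n`, times the factor of automorphy `exp(-mX)`. It does not
depend on the choices. -/
def curveMonodromy (S : AddSubgroup (Tors N)) (τ : ℍ) (z₀ : ℂ) (x : PuncturedCurve S τ)
    (g : PiOne (PuncturedCurve S τ) x) : NCSeries (Gen N S) :=
  Classical.epsilon fun a => ∃ (β : Path x x) (γ : C(unitInterval, ℂ))
    (T : unitInterval → NCSeries (Gen N S)) (m n : ℤ),
    Path.Homotopic.Quotient.mk β = FundamentalGroup.toPath g.unop ∧
    γ 0 = z₀ ∧ (∀ t, (QuotientAddGroup.mk (γ t) : ℂ ⧸ lattice τ) = (β t).1) ∧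
    γ 1 = z₀ + m * τ + n ∧ IsTransport (nu2 S τ) γ T ∧ a = T 1 * expX S (-(m : ℂ))

/-- The inverse monodromy of the cyclotomic KZ connection along a loop in `ℙ¹ - {0, μ_N, ∞}`. -/
def kzMonodromy (x : PuncturedLine N) (g : PiOne (PuncturedLine N) x) : NCSeries (KZLetter N) :=
  Classical.epsilon fun a => ∃ (β : Path x x) (T : unitInterval → NCSeries (KZLetter N)),
    Path.Homotopic.Quotient.mk β = FundamentalGroup.toPath g.unop ∧
    IsTransport kzForm (fun t => (β t).1) T ∧ a = T 1

/-- The comparison map `ψ_τ` from the Lie algebra of the unipotent completion of the fundamental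
group of the punctured elliptic curve, induced by the inverse monodromy:
`log β ↦ log Θ_τ(β)`. -/
def psiCurve (S : AddSubgroup (Tors N)) (τ : ℍ) (z₀ : ℂ) (x : PuncturedCurve S τ) :
    completedGroupAlgebra (PiOne (PuncturedCurve S τ) x) → NCSeries (Gen N S) :=
  extendToCompletion (curveMonodromy S τ z₀ x)

/-- The comparison map of the cyclotomic KZ connection, induced by its inverse monodromy. -/
def psiKZ (x : PuncturedLine N) :
    completedGroupAlgebra (PiOne (PuncturedLine N) x) → NCSeries (KZLetter N) :=
  extendToCompletion (kzMonodromy x)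

open Classical in
/-- `ψ_τ`, with base point the image of `w₀`, on (the image of) an element `u` of the completed
group algebra of the fundamental group of the annulus; defined when `|exp(2πiτ/N)| < r`. -/
def psiCurveOn (S : AddSubgroup (Tors N)) {r : ℝ} (w₀ : PuncturedAnnulus N r)
    (u : completedGroupAlgebra (PiOne (PuncturedAnnulus N r) w₀)) (τ : ℍ) :
    NCSeries (Gen N S) :=
  if hr : ‖qPar N τ‖ < r then
    psiCurve S τ (logCoord w₀.1) (annulusToCurve S τ hr w₀)
      (completedMap (piOneMap (annulusToCurve S τ hr) w₀) u)
  else 0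

end Spaces

end KZB

end

set_option linter.unusedSectionVars false

noncomputable section

namespace KZB

/-! ### Non-commutative power series -/

namespace NCSeries

variable {σ : Type}

instance : T2Space (NCSeries σ) := inferInstanceAs (T2Space (List σ → ℂ))

theorem hasSum_iff {ι : Type*} {F : ι → NCSeries σ} {f : NCSeries σ} :
    HasSum F f ↔ ∀ w, HasSum (fun i => F i w) (f w) := Pi.hasSum

theorem tendsto_iff {ι : Type*} {F : ι → NCSeries σ} {l : Filter ι} {f : NCSeries σ} :
    Filter.Tendsto F l (𝓝 f) ↔ ∀ w, Filter.Tendsto (fun i => F i w) l (𝓝 (f w)) :=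
  tendsto_pi_nhds

/-- Evaluation at a word. -/
def evalₗ (w : List σ) : NCSeries σ →ₗ[ℂ] ℂ where
  toFun f := f w
  map_add' _ _ := rfl
  map_smul' _ _ := rfl

@[simp] theorem sub_apply (f g : NCSeries σ) (w : List σ) : (f - g) w = f w - g w := rfl

theorem sum_apply {ι : Type*} (s : Finset ι) (F : ι → NCSeries σ) (w : List σ) :
    (∑ i ∈ s, F i) w = ∑ i ∈ s, F i w := map_sum (evalₗ w) F s

/-- The series without terms of degree `< n`. -/
def HasOrder (n : ℕ) (f : NCSeries σ) : Prop := ∀ w, w.length < n → f w = 0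

theorem hasOrder_one_iff {f : NCSeries σ} : HasOrder 1 f ↔ f [] = 0 := by
  refine ⟨fun h => h [] (by simp), fun h w hw => ?_⟩
  rw [List.length_eq_zero_iff.1 (by omega : w.length = 0), h]

theorem hasOrder_zero (f : NCSeries σ) : HasOrder 0 f := fun _ h => absurd h (by omega)

theorem HasOrder.mono {m n : ℕ} {f : NCSeries σ} (h : HasOrder n f) (hmn : m ≤ n) :
    HasOrder m f := fun w hw => h w (by omega)

theorem HasOrder.mul {m n : ℕ} {f g : NCSeries σ} (hf : HasOrder m f) (hg : HasOrder n g) :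
    HasOrder (m + n) (f * g) := fun w hw => by
  rw [mul_apply]
  refine Finset.sum_eq_zero fun i hi => ?_
  rw [Finset.mem_range] at hi
  by_cases h : i < m
  · rw [hf _ (by rw [List.length_take]; omega), zero_mul]
  · rw [hg _ (by rw [List.length_drop]; omega), mul_zero]

theorem HasOrder.sub {n : ℕ} {f g : NCSeries σ} (hf : HasOrder n f) (hg : HasOrder n g) :
    HasOrder n (f - g) := fun w hw => by rw [sub_apply, hf w hw, hg w hw, sub_zero]

theorem HasOrder.add {n : ℕ} {f g : NCSeries σ} (hf : HasOrder n f) (hg : HasOrder n g) :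
    HasOrder n (f + g) := fun w hw => by rw [add_apply, hf w hw, hg w hw, add_zero]

theorem HasOrder.smul {n : ℕ} (c : ℂ) {f : NCSeries σ} (hf : HasOrder n f) :
    HasOrder n (c • f) := fun w hw => by rw [smul_apply, hf w hw, mul_zero]

theorem HasOrder.sum {n : ℕ} {ι : Type*} {s : Finset ι} {F : ι → NCSeries σ}
    (h : ∀ i ∈ s, HasOrder n (F i)) : HasOrder n (∑ i ∈ s, F i) := fun w hw => by
  rw [sum_apply]; exact Finset.sum_eq_zero fun i hi => h i hi w hw

theorem HasOrder.lie {m n : ℕ} {f g : NCSeries σ} (hf : HasOrder m f) (hg : HasOrder n g) :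
    HasOrder (m + n) ⁅f, g⁆ := by
  rw [Ring.lie_def]; exact (hf.mul hg).sub (add_comm m n ▸ hg.mul hf)

theorem HasOrder.pow {u : NCSeries σ} (hu : HasOrder 1 u) (m : ℕ) : HasOrder m (u ^ m) := by
  induction m with
  | zero => exact hasOrder_zero _
  | succ m ih => rw [pow_succ]; exact ih.mul hu

theorem hasOrder_letter (x : σ) : HasOrder 1 (letter x) := by
  rw [hasOrder_one_iff]; simp [letter]

/-- The `m`-th power of `ad u`. -/
def adPow (u : NCSeries σ) (m : ℕ) : NCSeries σ →ₗ[ℂ] NCSeries σ :=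
  (LieAlgebra.ad ℂ (NCSeries σ) u) ^ m

@[simp] theorem adPow_zero (u v : NCSeries σ) : adPow u 0 v = v := rfl

theorem adPow_succ (u v : NCSeries σ) (m : ℕ) : adPow u (m + 1) v = ⁅u, adPow u m v⁆ := by
  rw [adPow, pow_succ']; rfl

theorem adPow_add (u v : NCSeries σ) (m n : ℕ) : adPow u (m + n) v = adPow u m (adPow u n v) := by
  rw [adPow, pow_add]; rfl

theorem adSeries_def (p : PowerSeries ℂ) (u v : NCSeries σ) (w : List σ) : adSeries p u v w =
    ∑ m ∈ Finset.range (w.length + 1), PowerSeries.coeff m p * adPow u m v w := rfl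

theorem HasOrder.adPow {u v : NCSeries σ} (hu : HasOrder 1 u) {n : ℕ} (hv : HasOrder n v) (m : ℕ) :
    HasOrder (m + n) (adPow u m v) := by
  induction m with
  | zero => simpa using hv
  | succ m ih => rw [adPow_succ]; exact (hu.lie ih).mono (by omega)

theorem continuous_lie_right (u : NCSeries σ) : Continuous fun v : NCSeries σ => ⁅u, v⁆ := by
  simp only [Ring.lie_def]; fun_prop

theorem continuous_adPow (u : NCSeries σ) (m : ℕ) : Continuous (adPow u m) := by
  induction m with
  | zero => exact continuous_id
  | succ m ih =>
    have : ⇑(adPow u (m + 1)) = fun v => ⁅u, adPow u m v⁆ := funext fun v => adPow_succ u v m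
    rw [this]; exact (continuous_lie_right u).comp ih

theorem adSeries_apply {u : NCSeries σ} (hu : HasOrder 1 u) (p : PowerSeries ℂ) (v : NCSeries σ)
    (w : List σ) {n : ℕ} (hn : w.length ≤ n) : adSeries p u v w =
      ∑ m ∈ Finset.range (n + 1), PowerSeries.coeff m p * adPow u m v w := by
  rw [adSeries_def]
  refine Finset.sum_subset (Finset.range_mono (by omega)) fun m _ hm => ?_
  rw [Finset.mem_range] at hm
  rw [(hu.adPow (hasOrder_zero v) m) w (by omega), mul_zero]

theorem hasSum_adSeries {u : NCSeries σ} (hu : HasOrder 1 u) (p : PowerSeries ℂ)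
    (v : NCSeries σ) : HasSum (fun m => PowerSeries.coeff m p • adPow u m v) (adSeries p u v) := by
  refine hasSum_iff.2 fun w => hasSum_sum_of_ne_finset_zero fun m hm => ?_
  rw [Finset.mem_range] at hm
  rw [smul_apply, (hu.adPow (hasOrder_zero v) m) w (by omega), mul_zero]

theorem evalSeries_apply {u : NCSeries σ} (hu : HasOrder 1 u) (p : PowerSeries ℂ)
    (w : List σ) {n : ℕ} (hn : w.length ≤ n) : evalSeries p u w =
      ∑ m ∈ Finset.range (n + 1), PowerSeries.coeff m p * (u ^ m) w := by
  refine Finset.sum_subset (Finset.range_mono (by omega)) fun m _ hm => ?_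
  rw [Finset.mem_range] at hm
  rw [(hu.pow m) w (by omega), mul_zero]

theorem hasSum_evalSeries {u : NCSeries σ} (hu : HasOrder 1 u) (p : PowerSeries ℂ) :
    HasSum (fun m => PowerSeries.coeff m p • u ^ m) (evalSeries p u) := by
  refine hasSum_iff.2 fun w => hasSum_sum_of_ne_finset_zero fun m hm => ?_
  rw [Finset.mem_range] at hm
  rw [smul_apply, (hu.pow m) w (by omega), mul_zero]

section adSeries

variable (p q : PowerSeries ℂ) (u v v' : NCSeries σ)

theorem adSeries_add : adSeries p u (v + v') = adSeries p u v + adSeries p u v' := by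
  ext w; simp [adSeries_def, mul_add, Finset.sum_add_distrib]

theorem adSeries_smul (c : ℂ) : adSeries p u (c • v) = c • adSeries p u v := by
  ext w; simp [adSeries_def, Finset.mul_sum, mul_left_comm]

/-- `v ↦ p(u) · v` as a linear map. -/
def adSeriesₗ : NCSeries σ →ₗ[ℂ] NCSeries σ where
  toFun := adSeries p u
  map_add' := adSeries_add p u
  map_smul' c v := adSeries_smul p u v c

theorem adSeries_zero : adSeries p u 0 = 0 := (adSeriesₗ p u).map_zero

theorem adSeries_sum {ι : Type*} (s : Finset ι) (F : ι → NCSeries σ) :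
    adSeries p u (∑ i ∈ s, F i) = ∑ i ∈ s, adSeries p u (F i) := map_sum (adSeriesₗ p u) F s

theorem add_adSeries : adSeries (p + q) u v = adSeries p u v + adSeries q u v := by
  ext w; simp [adSeries_def, add_mul, Finset.sum_add_distrib]

theorem smul_adSeries (c : ℂ) : adSeries (c • p) u v = c • adSeries p u v := by
  ext w; simp [adSeries_def, Finset.mul_sum, mul_assoc]

theorem C_adSeries (c : ℂ) : adSeries (PowerSeries.C c) u v = c • v := by
  ext w; simp [adSeries_def, PowerSeries.coeff_C]

theorem one_adSeries : adSeries 1 u v = v := by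
  rw [← map_one (PowerSeries.C (R := ℂ)), C_adSeries, one_smul]

variable {u}

theorem X_adSeries (hu : HasOrder 1 u) : adSeries PowerSeries.X u v = ⁅u, v⁆ := by
  refine (hasSum_adSeries hu _ v).unique ?_
  convert hasSum_single (f := fun m => PowerSeries.coeff m (PowerSeries.X : PowerSeries ℂ) •
    adPow u m v) 1 (fun m hm => by simp [PowerSeries.coeff_X, hm]) using 1
  simp [adPow_succ u v 0]

end adSeries

theorem sum_range_sum_range_eq_antidiagonal {M : Type*} [AddCommMonoid M] (n : ℕ) (a : ℕ → ℕ → M)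
    (h : ∀ i j, n < i + j → a i j = 0) :
    ∑ i ∈ Finset.range (n + 1), ∑ j ∈ Finset.range (n + 1), a i j =
      ∑ s ∈ Finset.range (n + 1), ∑ x ∈ Finset.HasAntidiagonal.antidiagonal s, a x.1 x.2 := by
  rw [← Finset.sum_product', Finset.sum_sigma']
  symm
  refine Finset.sum_of_injOn (fun x => x.2) ?_ ?_ ?_ ?_
  · rintro ⟨s, i, j⟩ hx ⟨s', i', j'⟩ hx' h
    simp_all
  · rintro ⟨s, i, j⟩ hx
    simp at hx ⊢
    omega
  · rintro ⟨i, j⟩ hx hx'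
    apply h
    by_contra hij
    exact hx' ⟨⟨i + j, i, j⟩, by simp; omega, rfl⟩
  · rintro ⟨s, i, j⟩ _
    rfl

theorem mul_adSeries (p q : PowerSeries ℂ) {u : NCSeries σ} (hu : HasOrder 1 u) (v : NCSeries σ) :
    adSeries (p * q) u v = adSeries p u (adSeries q u v) := by
  ext w
  rw [adSeries_apply hu p _ w le_rfl, adSeries_apply hu (p * q) _ w le_rfl]
  have h1 : ∀ m, adPow u m (adSeries q u v) w =
      ∑ k ∈ Finset.range (w.length + 1), PowerSeries.coeff k q * adPow u (m + k) v w := fun m => by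
    have h2 : HasSum (fun k => PowerSeries.coeff k q • adPow u (m + k) v)
        (adPow u m (adSeries q u v)) := by
      have := (hasSum_adSeries hu q v).map (adPow u m) (continuous_adPow u m)
      simpa only [Function.comp_def, map_smul, ← adPow_add] using this
    refine (hasSum_iff.1 h2 w).unique (hasSum_sum_of_ne_finset_zero fun k hk => ?_)
    rw [Finset.mem_range] at hk
    rw [smul_apply, (hu.adPow (hasOrder_zero v) (m + k)) w (by omega), mul_zero]
  simp only [h1, Finset.mul_sum]
  rw [sum_range_sum_range_eq_antidiagonal]
  · refine Finset.sum_congr rfl fun s _ => ?_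
    rw [PowerSeries.coeff_mul, Finset.sum_mul]
    refine Finset.sum_congr rfl fun x hx => ?_
    rw [Finset.HasAntidiagonal.mem_antidiagonal.1 hx, mul_assoc]
  · intro i j hij
    rw [(hu.adPow (hasOrder_zero v) (i + j)) w (by omega), mul_zero, mul_zero]

theorem sum_sub_hasOrder {F : ℕ → NCSeries σ} {f : NCSeries σ} (hf : HasSum F f)
    (hF : ∀ i, HasOrder i (F i)) (n : ℕ) : HasOrder n (f - ∑ i ∈ Finset.range n, F i) :=
  fun w hw => by
    rw [sub_apply, sum_apply, sub_eq_zero]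
    refine (hasSum_iff.1 hf w).unique (hasSum_sum_of_ne_finset_zero fun i hi => ?_)
    exact hF i w (by rw [Finset.mem_range] at hi; omega)

theorem mul_apply_of_hasSum {F G : ℕ → NCSeries σ} {f g : NCSeries σ} (v : NCSeries σ)
    (hf : HasSum F f) (hg : HasSum G g) (hF : ∀ i, HasOrder i (F i)) (hG : ∀ i, HasOrder i (G i))
    (w : List σ) : (f * v * g) w = ∑ s ∈ Finset.range (w.length + 1),
      ∑ x ∈ Finset.HasAntidiagonal.antidiagonal s, (F x.1 * v * G x.2) w := by
  set n := w.length + 1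
  have h1 := sum_sub_hasOrder hf hF n
  have h2 := sum_sub_hasOrder hg hG n
  set f' := ∑ i ∈ Finset.range n, F i with hf'
  set g' := ∑ i ∈ Finset.range n, G i with hg'
  have h3 : f * v * g = f' * v * g' + ((f - f') * (v * g) + f' * v * (g - g')) := by noncomm_ring
  have h4 : HasOrder n ((f - f') * (v * g) + f' * v * (g - g')) :=
    HasOrder.add (h1.mul (hasOrder_zero (v * g)))
      (by simpa using (hasOrder_zero (f' * v)).mul h2)
  rw [h3, add_apply, h4 w (by omega), add_zero, hf', hg', Finset.sum_mul, Finset.sum_mul_sum,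
    sum_apply]
  simp only [sum_apply]
  refine sum_range_sum_range_eq_antidiagonal _ _ fun i j hij => ?_
  exact ((hF i).mul (hasOrder_zero v)).mul (hG j) w (by omega)

theorem adPow_eq_sum (u v : NCSeries σ) (n : ℕ) :
    adPow u n v = ∑ x ∈ Finset.HasAntidiagonal.antidiagonal n,
      (n.choose x.1 : ℂ) • (u ^ x.1 * v * (-u) ^ x.2) := by
  have h1 : LieAlgebra.ad ℂ (NCSeries σ) u =
      LinearMap.mulLeft ℂ u + LinearMap.mulRight ℂ (-u) := by
    ext1 v; simp [Ring.lie_def, sub_eq_add_neg]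
  have h2 : Commute (LinearMap.mulLeft ℂ u) (LinearMap.mulRight ℂ (-u)) :=
    LinearMap.commute_mulLeft_right u (-u)
  rw [adPow, h1, h2.add_pow', LinearMap.sum_apply]
  refine Finset.sum_congr rfl fun x _ => ?_
  rw [LinearMap.pow_mulLeft, LinearMap.pow_mulRight]
  simp [Module.End.mul_apply, mul_assoc, Nat.cast_smul_eq_nsmul]

/-- `exp(u)` as the value of the exponential series at a multiple of `u`. -/
theorem evalSeries_rescale_exp_mul (a : ℂ) {u : NCSeries σ} (hu : HasOrder 1 u) (v : NCSeries σ) :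
    evalSeries (PowerSeries.rescale a (PowerSeries.exp ℂ)) u * v *
      evalSeries (PowerSeries.rescale (-a) (PowerSeries.exp ℂ)) u =
    adSeries (PowerSeries.rescale a (PowerSeries.exp ℂ)) u v := by
  ext w
  rw [mul_apply_of_hasSum v (hasSum_evalSeries hu _) (hasSum_evalSeries hu _)
    (fun i => (hu.pow i).smul _) (fun i => (hu.pow i).smul _), adSeries_def]
  refine Finset.sum_congr rfl fun s _ => ?_
  rw [adPow_eq_sum, sum_apply, Finset.mul_sum]
  refine Finset.sum_congr rfl fun x hx => ?_
  have hx := Finset.HasAntidiagonal.mem_antidiagonal.1 hx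
  simp only [PowerSeries.coeff_rescale, PowerSeries.coeff_exp, smul_mul_assoc, mul_smul_comm,
    smul_apply, eq_ratCast]
  have h1 : (-u) ^ x.2 = (-1 : ℂ) ^ x.2 • u ^ x.2 := by
    rw [← smul_pow, neg_one_smul]
  have h2 : ((s.choose x.1 : ℕ) : ℂ) * x.1.factorial * x.2.factorial = s.factorial := by
    rw [← hx]; exact_mod_cast Nat.choose_symm_add (a := x.1) (b := x.2) ▸ Nat.add_choose_mul_factorial_mul_factorial x.1 x.2
  rw [h1, mul_smul_comm, smul_apply, neg_pow a]
  have h3 : (x.1.factorial : ℂ) ≠ 0 := Nat.cast_ne_zero.2 (Nat.factorial_ne_zero _)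
  have h4 : (x.2.factorial : ℂ) ≠ 0 := Nat.cast_ne_zero.2 (Nat.factorial_ne_zero _)
  have h5 : (s.choose x.1 : ℂ) ≠ 0 := Nat.cast_ne_zero.2 (Nat.choose_pos (by omega)).ne'
  have h6 : a ^ s = a ^ x.1 * a ^ x.2 := by rw [← hx, pow_add]
  push_cast
  rw [← h2, h6]
  field_simp

theorem evalSeries_mul {u : NCSeries σ} (hu : HasOrder 1 u) (p q : PowerSeries ℂ) :
    evalSeries (p * q) u = evalSeries p u * evalSeries q u := by
  ext w
  rw [← mul_one (evalSeries p u), mul_apply_of_hasSum 1 (hasSum_evalSeries hu _)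
    (hasSum_evalSeries hu _) (fun i => (hu.pow i).smul _) (fun i => (hu.pow i).smul _),
    evalSeries_apply hu _ w le_rfl]
  refine Finset.sum_congr rfl fun s _ => ?_
  rw [PowerSeries.coeff_mul, Finset.sum_mul]
  refine Finset.sum_congr rfl fun x hx => ?_
  rw [mul_one, smul_mul_smul_comm, ← pow_add, Finset.HasAntidiagonal.mem_antidiagonal.1 hx, smul_apply]

theorem evalSeries_one (u : NCSeries σ) : evalSeries 1 u = 1 := by
  ext w; simp [evalSeries, PowerSeries.coeff_one]

/-! ### Words and substitution -/

/-- The product of the letters of a word. -/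
def mono (v : List σ) : NCSeries σ := (v.map letter).prod

open Classical in
theorem mono_apply (v w : List σ) : mono v w = if w = v then 1 else 0 := by
  induction v generalizing w with
  | nil => cases w <;> simp [mono, one_apply]
  | cons a v ih =>
    have h : mono (a :: v) = letter a * mono v := by simp [mono]
    rw [h]
    cases w with
    | nil => rw [mul_nil]; simp [letter]
    | cons b w =>
      rw [mul_cons]
      have h2 : shift b (letter a) = if b = a then (1 : NCSeries σ) else 0 := by
        ext w'
        by_cases hb : b = a <;> simp [shift, letter, one_apply, hb]
      rw [h2]
      by_cases hb : b = a
      · simp [letter, hb, ih]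
      · simp [letter, hb]

theorem hasSum_mono (f : NCSeries σ) : HasSum (fun v => f v • mono v) f := by
  classical
  refine hasSum_iff.2 fun w => ?_
  convert hasSum_single (f := fun v => (f v • mono v) w) w (fun v hv => ?_) using 1
  · simp [mono_apply]
  · simp [mono_apply, hv.symm]

/-- Continuous linear maps are determined by their values on words. -/
theorem linearMap_ext_mono {τ : Type} {L L' : NCSeries σ →ₗ[ℂ] NCSeries τ} (hL : Continuous L)
    (hL' : Continuous L') (h : ∀ v, L (mono v) = L' (mono v)) : L = L' := by
  ext1 f
  have h1 := (hasSum_mono f).map L hL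
  have h2 := (hasSum_mono f).map L' hL'
  simp only [Function.comp_def, map_smul, h] at h1 h2
  exact h1.unique h2

section substitute

variable {τ : Type} (c : σ → NCSeries τ)

/-- The product of the values of the letters of a word. -/
def wordProd (v : List σ) : NCSeries τ := (v.map c).prod

theorem wordProd_append (v w : List σ) : wordProd c (v ++ w) = wordProd c v * wordProd c w := by
  simp [wordProd]

variable {c}

theorem hasOrder_wordProd (hc : ∀ x, HasOrder 1 (c x)) (v : List σ) :
    HasOrder v.length (wordProd c v) := by
  induction v with
  | nil => exact hasOrder_zero _
  | cons a v ih =>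
    have h : wordProd c (a :: v) = c a * wordProd c v := by simp [wordProd]
    rw [h, List.length_cons, add_comm]; exact (hc a).mul ih

theorem mono_append (v w : List σ) : mono (v ++ w) = mono v * mono w := by simp [mono]

variable [Fintype σ]

variable (c) in
/-- The substitution of series without constant term for the letters. -/
def subst (f : NCSeries σ) : NCSeries τ := fun w =>
  ∑ n ∈ Finset.range (w.length + 1), ∑ v : Fin n → σ,
    f (List.ofFn v) * wordProd c (List.ofFn v) w

variable (c)

theorem substitute_eq_subst (c : σ → NCSeries σ) : substitute c = subst c := rfl

theorem subst_apply (f : NCSeries σ) (w : List τ) : subst c f w =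
    ∑ n ∈ Finset.range (w.length + 1), ∑ v : Fin n → σ,
      f (List.ofFn v) * wordProd c (List.ofFn v) w := rfl

/-- Substitution as a linear map. -/
def substₗ : NCSeries σ →ₗ[ℂ] NCSeries τ where
  toFun := subst c
  map_add' f g := by
    ext w; simp [subst_apply, add_mul, Finset.sum_add_distrib]
  map_smul' a f := by
    ext w; simp [subst_apply, Finset.mul_sum, mul_assoc]

theorem continuous_substₗ : Continuous (substₗ c) :=
  continuous_pi fun w => by
    change Continuous fun f : NCSeries σ => ∑ n ∈ Finset.range (w.length + 1), ∑ v : Fin n → σ,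
      f (List.ofFn v) * wordProd c (List.ofFn v) w
    exact continuous_finsetSum _ fun _ _ => continuous_finsetSum _ fun _ _ =>
      (continuous_eval _).mul continuous_const

variable {c}

theorem substₗ_mono (hc : ∀ x, HasOrder 1 (c x)) (v : List σ) :
    substₗ c (mono v) = wordProd c v := by
  classical
  ext w
  change subst c (mono v) w = _
  rw [subst_apply]
  by_cases h : v.length ≤ w.length
  · rw [Finset.sum_eq_single_of_mem v.length (by simp; omega), Finset.sum_eq_single v.get]
    · simp [mono_apply]
    · intro u _ hu
      rw [mono_apply, if_neg, zero_mul]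
      intro h
      apply hu
      rw [← List.ofFn_injective.eq_iff, h, List.ofFn_get]
    · simp
    · intro n _ hn
      refine Finset.sum_eq_zero fun u _ => ?_
      rw [mono_apply, if_neg, zero_mul]
      rintro rfl
      simp at hn
  · rw [hasOrder_wordProd hc v w (by omega)]
    refine Finset.sum_eq_zero fun n hn => Finset.sum_eq_zero fun u _ => ?_
    rw [mono_apply, if_neg, zero_mul]
    rintro rfl
    simp at hn h
    omega

theorem substₗ_mul (hc : ∀ x, HasOrder 1 (c x)) (f g : NCSeries σ) :
    substₗ c (f * g) = substₗ c f * substₗ c g := by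
  have hcont := continuous_substₗ c
  have h1 : ∀ v, substₗ c (f * mono v) = substₗ c f * substₗ c (mono v) := by
    intro v
    refine LinearMap.congr_fun (linearMap_ext_mono
      (L := substₗ c ∘ₗ LinearMap.mulRight ℂ (mono v))
      (L' := LinearMap.mulRight ℂ (substₗ c (mono v)) ∘ₗ substₗ c) ?_ ?_ fun w => ?_) f
    · exact hcont.comp (continuous_id.mul continuous_const)
    · exact hcont.mul continuous_const
    · simp [← mono_append, substₗ_mono hc, wordProd_append]
  refine LinearMap.congr_fun (linearMap_ext_mono
    (L := substₗ c ∘ₗ LinearMap.mulLeft ℂ f)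
    (L' := LinearMap.mulLeft ℂ (substₗ c f) ∘ₗ substₗ c) ?_ ?_ fun w => ?_) g
  · exact hcont.comp (continuous_const.mul continuous_id)
  · exact continuous_const.mul hcont
  · simpa using h1 w

/-- Substitution as an algebra homomorphism. -/
def substₐ (hc : ∀ x, HasOrder 1 (c x)) : NCSeries σ →ₐ[ℂ] NCSeries τ :=
  AlgHom.ofLinearMap (substₗ c)
    (by
      have := substₗ_mono hc []
      simpa [mono, wordProd] using this)
    (substₗ_mul hc)

theorem substₐ_apply (hc : ∀ x, HasOrder 1 (c x)) (f : NCSeries σ) :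
    substₐ hc f = subst c f := rfl

theorem continuous_substₐ (hc : ∀ x, HasOrder 1 (c x)) : Continuous (substₐ hc) :=
  continuous_substₗ c

theorem substₐ_letter (hc : ∀ x, HasOrder 1 (c x)) (x : σ) :
    substₐ hc (letter x) = c x := by
  have := substₗ_mono hc [x]
  simp only [mono, wordProd, List.map_cons, List.map_nil, List.prod_cons, List.prod_nil,
    mul_one] at this
  exact this

theorem HasOrder.substₐ (hc : ∀ x, HasOrder 1 (c x)) {n : ℕ} {f : NCSeries σ}
    (hf : HasOrder n f) : HasOrder n (substₐ hc f) := fun w hw => by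
  rw [substₐ_apply, subst_apply]
  refine Finset.sum_eq_zero fun m hm => Finset.sum_eq_zero fun v _ => ?_
  rw [Finset.mem_range] at hm
  rw [hf _ (by rw [List.length_ofFn]; omega), zero_mul]

/-- The coefficients of `subst c f` are finite linear combinations of those of `f`. -/
theorem hasDerivAt_subst (c : σ → NCSeries τ) {F : ℂ → NCSeries σ} {F' : NCSeries σ} {z : ℂ}
    (h : ∀ l, HasDerivAt (fun s => F s l) (F' l) z) (l : List τ) :
    HasDerivAt (fun s => subst c (F s) l) (subst c F' l) z := by
  simp only [subst_apply]
  exact HasDerivAt.fun_sum fun n _ => HasDerivAt.fun_sum fun v _ => (h _).mul_const _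

end substitute

theorem map_adSeries {τ : Type} (L : NCSeries σ →ₐ[ℂ] NCSeries τ) (hL : Continuous L)
    (p : PowerSeries ℂ) {u : NCSeries σ} (hu : HasOrder 1 u) (hu' : HasOrder 1 (L u))
    (v : NCSeries σ) : L (adSeries p u v) = adSeries p (L u) (L v) := by
  have h1 : ∀ m, L (adPow u m v) = adPow (L u) m (L v) := fun m => by
    induction m with
    | zero => rfl
    | succ m ih => rw [adPow_succ, adPow_succ, Ring.lie_def, map_sub, map_mul, map_mul, ih,
        Ring.lie_def]
  have := (hasSum_adSeries hu p v).map L hL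
  simp only [Function.comp_def, map_smul, h1] at this
  exact this.unique (hasSum_adSeries hu' p (L v))

theorem adPow_smul_left (a : ℂ) (u v : NCSeries σ) (m : ℕ) :
    adPow (a • u) m v = a ^ m • adPow u m v := by
  induction m with
  | zero => simp
  | succ m ih => rw [adPow_succ, adPow_succ, ih, lie_smul, smul_lie, smul_smul, pow_succ]

theorem adSeries_smul_left (p : PowerSeries ℂ) (a : ℂ) (u v : NCSeries σ) :
    adSeries p (a • u) v = adSeries (PowerSeries.rescale a p) u v := by
  ext w
  simp only [adSeries_def, adPow_smul_left, PowerSeries.coeff_rescale, smul_apply]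
  exact Finset.sum_congr rfl fun m _ => by ring

theorem HasOrder.adSeries {u v : NCSeries σ} (hu : HasOrder 1 u) {n : ℕ} (hv : HasOrder n v)
    (p : PowerSeries ℂ) : HasOrder n (adSeries p u v) := fun w hw => by
  rw [adSeries_def]
  exact Finset.sum_eq_zero fun m _ => by
    rw [(hu.adPow hv m) w (by omega), mul_zero]

theorem isClosed_freeLie : IsClosed (freeLie σ : Set (NCSeries σ)) :=
  Submodule.isClosed_topologicalClosure _

theorem letter_mem_freeLie (x : σ) : letter x ∈ freeLie σ :=
  Submodule.le_topologicalClosure _ (LieSubalgebra.subset_lieSpan ⟨x, rfl⟩)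

theorem adSeries_mem_freeLie (p : PowerSeries ℂ) {u v : NCSeries σ} (hu : HasOrder 1 u)
    (hu' : u ∈ freeLie σ) (hv : v ∈ freeLie σ) : adSeries p u v ∈ freeLie σ := by
  refine isClosed_freeLie.mem_of_tendsto (hasSum_adSeries hu p v) (.of_forall fun s => ?_)
  refine Submodule.sum_mem (freeLie σ).toSubmodule fun m _ => Submodule.smul_mem _ _ ?_
  clear * - hu' hv
  induction m with
  | zero => exact hv
  | succ m ih => rw [adPow_succ]; exact (freeLie σ).lie_mem hu' ih

theorem map_mem_freeLie {τ : Type} (L : NCSeries σ →ₐ[ℂ] NCSeries τ) (hL : Continuous L)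
    (h : ∀ x, L (letter x) ∈ freeLie τ) {f : NCSeries σ} (hf : f ∈ freeLie σ) :
    L f ∈ freeLie τ := by
  have h1 : Set.MapsTo L
      (LieSubalgebra.lieSpan ℂ (NCSeries σ) (Set.range (letter (σ := σ)))) (freeLie τ) := by
    intro f hf
    induction hf using LieSubalgebra.lieSpan_induction with
    | mem x hx => obtain ⟨x, rfl⟩ := hx; exact h x
    | zero => rw [map_zero]; exact (freeLie τ).zero_mem
    | smul a x hx h => rw [map_smul]; exact (freeLie τ).smul_mem a h
    | add x y hx hy h h' => rw [map_add]; exact (freeLie τ).add_mem h h'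
    | lie x y hx hy h h' =>
      rw [Ring.lie_def, map_sub, map_mul, map_mul, ← Ring.lie_def]
      exact (freeLie τ).lie_mem h h'
  have h2 := h1.closure hL hf
  rwa [isClosed_freeLie.closure_eq] at h2

end NCSeries

open NCSeries

/-! ### Shifted power series -/

/-- The power series `(p - p₀)/x`. -/
def tail (p : PowerSeries ℂ) : PowerSeries ℂ := PowerSeries.mk fun n => PowerSeries.coeff (n + 1) p

theorem C_add_X_mul_tail (p : PowerSeries ℂ) :
    PowerSeries.C (PowerSeries.constantCoeff p) + PowerSeries.X * tail p = p := by
  ext n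
  cases n with
  | zero => simp
  | succ n => simp [PowerSeries.coeff_succ_X_mul, tail]

theorem tail_C_add_X_mul (a : ℂ) (p : PowerSeries ℂ) :
    tail (PowerSeries.C a + PowerSeries.X * p) = p := by
  ext n
  simp [PowerSeries.coeff_succ_X_mul, tail]

theorem tail_mul {p q : PowerSeries ℂ} (hp : PowerSeries.constantCoeff p = 1)
    (hq : PowerSeries.constantCoeff q = 1) : tail (p * q) = tail p + p * tail q := by
  rw [← tail_C_add_X_mul 1 (tail p + p * tail q)]
  have hp' := C_add_X_mul_tail p
  have hq' := C_add_X_mul_tail q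
  rw [hp, map_one] at hp'
  rw [hq, map_one] at hq'
  rw [map_one]
  congr 1
  linear_combination -p * hq' - hp'

theorem tail_rescale (a : ℂ) (p : PowerSeries ℂ) :
    tail (PowerSeries.rescale a p) = a • PowerSeries.rescale a (tail p) := by
  ext n
  simp [tail, PowerSeries.coeff_rescale, pow_succ]
  ring

theorem constantCoeff_expSeries (a : ℂ) : PowerSeries.constantCoeff (expSeries a) = 1 := by
  rw [← PowerSeries.coeff_zero_eq_constantCoeff_apply, expSeries, PowerSeries.coeff_rescale]
  simp

theorem constantCoeff_expSubOneDiv : PowerSeries.constantCoeff expSubOneDiv = 1 := by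
  rw [← PowerSeries.coeff_zero_eq_constantCoeff_apply, expSubOneDiv]
  simp

theorem expSubOneDiv_mul_inv : expSubOneDiv * expSubOneDiv⁻¹ = 1 :=
  PowerSeries.mul_inv_cancel _ (by rw [constantCoeff_expSubOneDiv]; exact one_ne_zero)

theorem constantCoeff_expSubOneDiv_inv : PowerSeries.constantCoeff expSubOneDiv⁻¹ = 1 := by
  rw [PowerSeries.constantCoeff_inv, constantCoeff_expSubOneDiv, inv_one]

theorem one_add_X_mul_expSubOneDiv : 1 + PowerSeries.X * expSubOneDiv = expSeries 1 := by
  ext n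
  cases n with
  | zero => simp [expSeries]
  | succ n =>
    simp [expSeries, PowerSeries.coeff_succ_X_mul, expSubOneDiv, PowerSeries.coeff_one]

theorem expSeries_zero : expSeries 0 = 1 := by
  ext n
  simp only [expSeries, PowerSeries.coeff_rescale, PowerSeries.coeff_one]
  cases n <;> simp

theorem expSeries_add (a b : ℂ) : expSeries (a + b) = expSeries a * expSeries b :=
  (PowerSeries.exp_mul_exp_eq_exp_add a b).symm

theorem rescale_expSeries (a b : ℂ) :
    PowerSeries.rescale a (expSeries b) = expSeries (a * b) := by
  rw [expSeries, expSeries, PowerSeries.rescale_rescale, mul_comm]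

theorem expQuot_eq_tail (y : ℂ) : expQuot y = tail (expSeries (-y) * expSubOneDiv⁻¹) := rfl

/-! ### The connection in terms of a family of power series -/

variable {N : ℕ} [NeZero N] (S : AddSubgroup (Tors N))

theorem hasOrder_genX : HasOrder 1 (genX S) := hasOrder_letter _

theorem hasOrder_genY : HasOrder 1 (genY S) := hasOrder_letter _

theorem hasOrder_genT (α : Tors N) : HasOrder 1 (genT S α) := by
  classical
  unfold genT
  split_ifs with h1 h2
  · exact hasOrder_letter _
  · refine HasOrder.sub (((hasOrder_genX S).lie (hasOrder_genY S)).mono (by omega))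
      (HasOrder.sum fun β _ => ?_)
    split_ifs
    · exact hasOrder_letter _
    · exact fun _ _ => rfl
  · exact fun _ _ => rfl

theorem genX_mem : genX S ∈ pLie S := letter_mem_freeLie _

theorem genY_mem : genY S ∈ pLie S := letter_mem_freeLie _

theorem genT_mem (α : Tors N) : genT S α ∈ pLie S := by
  classical
  unfold genT
  split_ifs with h1 h2
  · exact letter_mem_freeLie _
  · refine (pLie S).sub_mem ((pLie S).lie_mem (genX_mem S) (genY_mem S)) (sum_mem fun β _ => ?_)
    split_ifs
    · exact letter_mem_freeLie _
    · exact (pLie S).zero_mem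
  · exact (pLie S).zero_mem

theorem genT_of_not_mem {α : Tors N} (h : α ∉ S) : genT S α = 0 := by
  rw [genT, dif_neg (fun h' => h h'.1), if_neg]
  rintro rfl
  exact h S.zero_mem

theorem actX_mem (p : PowerSeries ℂ) {v : NCSeries (Gen N S)} (hv : v ∈ pLie S) :
    actX S p v ∈ pLie S := adSeries_mem_freeLie p (hasOrder_genX S) (genX_mem S) hv

theorem HasOrder.actX (p : PowerSeries ℂ) {n : ℕ} {v : NCSeries (Gen N S)} (hv : HasOrder n v) :
    HasOrder n (actX S p v) := HasOrder.adSeries (hasOrder_genX S) hv p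

theorem actX_mul (p q : PowerSeries ℂ) (v : NCSeries (Gen N S)) :
    actX S (p * q) v = actX S p (actX S q v) := mul_adSeries p q (hasOrder_genX S) v

theorem actX_add (p q : PowerSeries ℂ) (v : NCSeries (Gen N S)) :
    actX S (p + q) v = actX S p v + actX S q v := add_adSeries p q _ v

theorem actX_smul (a : ℂ) (p : PowerSeries ℂ) (v : NCSeries (Gen N S)) :
    actX S (a • p) v = a • actX S p v := smul_adSeries p _ v a

theorem actX_X (v : NCSeries (Gen N S)) : actX S PowerSeries.X v = ⁅genX S, v⁆ :=
  X_adSeries v (hasOrder_genX S)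

/-- The series `Y + ∑ (Φ_α(X) - Φ_α(0))/X · T_α`. -/
def conn (T : Tors N → NCSeries (Gen N S)) (Φ : Tors N → PowerSeries ℂ) : NCSeries (Gen N S) :=
  genY S + ∑ α : Tors N, actX S (tail (Φ α)) (T α)

variable {S}

theorem actX_conn {T : Tors N → NCSeries (Gen N S)} (hT : ∑ α, T α = ⁅genX S, genY S⁆)
    {Φ : Tors N → PowerSeries ℂ} (hΦ : ∀ α, PowerSeries.constantCoeff (Φ α) = 1)
    {E : PowerSeries ℂ} (hE : PowerSeries.constantCoeff E = 1) :
    actX S E (conn S T Φ) = conn S T fun α => E * Φ α := by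
  have h1 : actX S E (genY S) = genY S + ∑ α, actX S (tail E) (T α) := by
    conv_lhs => rw [← C_add_X_mul_tail E, hE, map_one, mul_comm, actX_add, actX_mul, actX_X,
      ← hT, actX, one_adSeries]
    rw [actX, adSeries_sum]; rfl
  rw [conn, conn, actX, adSeries_add, adSeries_sum, ← actX, h1, add_assoc, ← Finset.sum_add_distrib]
  congr 1
  refine Finset.sum_congr rfl fun α _ => ?_
  rw [tail_mul hE (hΦ α), actX_add, actX_mul]
  rfl

/-! ### The factor of automorphy -/

section Automorphy

open Complex
open scoped UpperHalfPlane MatrixGroups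

variable (S) (γ : SL(2, ℤ)) (τ : ℍ)

/-- The values of the factor of automorphy on the generators. -/
def modGen : Gen N S → NCSeries (Gen N S)
  | Gen.X => autFactor γ τ • genX S
  | Gen.Y => (autFactor γ τ)⁻¹ • genY S + (((γ 1 0 : ℤ) : ℂ) / (2 * Real.pi * I)) • genX S
  | Gen.t α h => letter (Gen.t α h)

theorem modAut_eq : modAut S γ τ = subst (modGen S γ τ) := by
  rw [modAut, substitute_eq_subst]
  congr 1

theorem hasOrder_modGen (g : Gen N S) : HasOrder 1 (modGen S γ τ g) := by
  cases g with
  | X => exact (hasOrder_genX S).smul _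
  | Y => exact ((hasOrder_genY S).smul _).add ((hasOrder_genX S).smul _)
  | t α h => exact hasOrder_letter _

/-- The factor of automorphy as an algebra homomorphism. -/
def modHom : NCSeries (Gen N S) →ₐ[ℂ] NCSeries (Gen N S) := substₐ (hasOrder_modGen S γ τ)

theorem modAut_eq_modHom (v : NCSeries (Gen N S)) : modAut S γ τ v = modHom S γ τ v := by
  rw [modAut_eq]; rfl

theorem autFactor_ne_zero : autFactor γ τ ≠ 0 := by
  have := UpperHalfPlane.denom_ne_zero (γ : GL (Fin 2) ℝ) τ
  simpa [autFactor, UpperHalfPlane.denom] using this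

theorem modHom_genX : modHom S γ τ (genX S) = autFactor γ τ • genX S := substₐ_letter _ _

theorem modHom_genY : modHom S γ τ (genY S) =
    (autFactor γ τ)⁻¹ • genY S + (((γ 1 0 : ℤ) : ℂ) / (2 * Real.pi * I)) • genX S :=
  substₐ_letter _ _

theorem modHom_genT (α : Tors N) : modHom S γ τ (genT S α) = genT S α := by
  classical
  unfold genT
  split_ifs with h1 h2
  · exact substₐ_letter _ _
  · rw [map_sub, map_sum, Ring.lie_def, map_sub, map_mul, map_mul, modHom_genX, modHom_genY,
      ← Ring.lie_def, lie_add, lie_smul, lie_smul, smul_lie, smul_lie, lie_self, smul_smul,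
      inv_mul_cancel₀ (autFactor_ne_zero γ τ), one_smul, smul_zero, smul_zero, add_zero]
    congr 1
    refine Finset.sum_congr rfl fun β _ => ?_
    split_ifs
    · exact substₐ_letter _ _
    · rw [map_zero]
  · rw [map_zero]

theorem modHom_actX (p : PowerSeries ℂ) (v : NCSeries (Gen N S)) :
    modHom S γ τ (actX S p v) =
      actX S (PowerSeries.rescale (autFactor γ τ) p) (modHom S γ τ v) := by
  have hX : HasOrder 1 (modHom S γ τ (genX S)) := by
    rw [modHom_genX]; exact (hasOrder_genX S).smul _
  refine (map_adSeries (modHom S γ τ) (continuous_substₐ _) p (hasOrder_genX S) hX v).trans ?_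
  rw [modHom_genX, adSeries_smul_left, actX]

theorem modHom_conn (f : Tors N → Tors N) (Φ : Tors N → PowerSeries ℂ) :
    modHom S γ τ (conn S (fun α => genT S (f α)) Φ) =
      (((γ 1 0 : ℤ) : ℂ) / (2 * Real.pi * I)) • genX S + (autFactor γ τ)⁻¹ •
        conn S (fun α => genT S (f α)) fun α => PowerSeries.rescale (autFactor γ τ) (Φ α) := by
  have h0 := autFactor_ne_zero γ τ
  rw [conn, conn, map_add, map_sum, modHom_genY, smul_add, Finset.smul_sum]
  have h : ∀ α, modHom S γ τ (actX S (tail (Φ α)) (genT S (f α))) = (autFactor γ τ)⁻¹ •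
      actX S (tail (PowerSeries.rescale (autFactor γ τ) (Φ α))) (genT S (f α)) := fun α => by
    rw [modHom_actX, modHom_genT, tail_rescale, actX_smul, smul_smul, inv_mul_cancel₀ h0, one_smul]
  rw [Finset.sum_congr rfl fun α _ => h α]
  abel

theorem autFrame_eq (z : ℂ) (v : NCSeries (Gen N S)) : autFrame S γ τ z v =
    modHom S γ τ (actX S (expSeries (((γ 1 0 : ℤ) : ℂ) * z / autFactor γ τ)) v) := by
  rw [autFrame, expX, expX, evalSeries_rescale_exp_mul _ (hasOrder_genX S), modAut_eq_modHom]
  rfl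

theorem autFrame_smul (z a : ℂ) (v : NCSeries (Gen N S)) :
    autFrame S γ τ z (a • v) = a • autFrame S γ τ z v := by
  rw [autFrame_eq, autFrame_eq, actX, adSeries_smul, map_smul]; rfl

theorem expX_mul (a b : ℂ) : expX S a * expX S b = expX S (a + b) := by
  rw [expX, expX, expX, ← evalSeries_mul (hasOrder_genX S), PowerSeries.exp_mul_exp_eq_exp_add]

theorem expX_zero : expX S 0 = 1 := by
  rw [expX, ← evalSeries_one (genX S)]
  exact congrArg (evalSeries · (genX S)) expSeries_zero

theorem expX_nil (a : ℂ) : expX S a [] = 1 := by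
  simp [expX, evalSeries, one_apply]

theorem autFrame_lie (z : ℂ) (v v' : NCSeries (Gen N S)) :
    autFrame S γ τ z ⁅v, v'⁆ = ⁅autFrame S γ τ z v, autFrame S γ τ z v'⁆ := by
  simp only [autFrame, modAut_eq_modHom]
  set a := ((γ 1 0 : ℤ) : ℂ) * z / autFactor γ τ
  have h : expX S (-a) * expX S a = 1 := by rw [expX_mul, neg_add_cancel, expX_zero]
  have h1 : ∀ v v', expX S a * (v * v') * expX S (-a) =
      (expX S a * v * expX S (-a)) * (expX S a * v' * expX S (-a)) := fun v v' => by
    calc _ = expX S a * v * 1 * v' * expX S (-a) := by noncomm_ring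
      _ = _ := by rw [← h]; noncomm_ring
  rw [Ring.lie_def, Ring.lie_def, ← map_mul, ← map_mul, ← h1, ← h1, ← map_sub]
  congr 1
  noncomm_ring

theorem hasDerivAt_actX_expSeries (κ z : ℂ) (v : NCSeries (Gen N S)) (l : List (Gen N S)) :
    HasDerivAt (fun s => actX S (expSeries (κ * s)) v l)
      ((κ • ⁅genX S, actX S (expSeries (κ * z)) v⁆) l) z := by
  have h1 : ∀ s, actX S (expSeries (κ * s)) v l = ∑ m ∈ Finset.range (l.length + 2),
      (κ * s) ^ m / m.factorial * adPow (genX S) m v l := fun s => by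
    rw [actX, adSeries_apply (hasOrder_genX S) _ _ _ (Nat.le_succ _)]
    refine Finset.sum_congr rfl fun m _ => ?_
    simp [expSeries, PowerSeries.coeff_rescale, div_eq_mul_inv]
  have h2 : (κ • ⁅genX S, actX S (expSeries (κ * z)) v⁆) l =
      ∑ m ∈ Finset.range (l.length + 2),
        (m * (κ * z) ^ (m - 1) * κ) / m.factorial * adPow (genX S) m v l := by
    rw [smul_apply, ← actX_X, ← actX_mul, mul_comm PowerSeries.X, actX_mul, actX_X, Finset.sum_range_succ',
      actX, adSeries_def, Finset.mul_sum]
    simp only [Nat.cast_zero, zero_mul, zero_div, add_zero]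
    refine Finset.sum_congr rfl fun m _ => ?_
    rw [adPow_add, adPow_succ, adPow_zero, Nat.factorial_succ]
    have : (m.factorial : ℂ) ≠ 0 := Nat.cast_ne_zero.2 (Nat.factorial_ne_zero _)
    have : (m : ℂ) + 1 ≠ 0 := Nat.cast_add_one_ne_zero m
    simp [expSeries, PowerSeries.coeff_rescale]
    field_simp
  rw [h2]
  simp only [h1]
  refine HasDerivAt.fun_sum fun m _ => HasDerivAt.mul_const ?_ _
  refine HasDerivAt.div_const ?_ _
  have := ((hasDerivAt_id z).const_mul κ).fun_pow m
  simpa using this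

theorem deriv_autFrame (z : ℂ) (v : NCSeries (Gen N S)) (l : List (Gen N S)) :
    deriv (fun s => autFrame S γ τ s v l) z =
      ⁅((γ 1 0 : ℤ) : ℂ) • genX S, autFrame S γ τ z v⁆ l := by
  have h0 := autFactor_ne_zero γ τ
  set κ := ((γ 1 0 : ℤ) : ℂ) / autFactor γ τ with hκ
  have h1 : ∀ s, autFrame S γ τ s v = subst (modGen S γ τ) (actX S (expSeries (κ * s)) v) :=
    fun s => by rw [autFrame_eq, hκ, div_mul_eq_mul_div]; rfl
  have h2 : ⁅((γ 1 0 : ℤ) : ℂ) • genX S, autFrame S γ τ z v⁆ =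
      subst (modGen S γ τ) (κ • ⁅genX S, actX S (expSeries (κ * z)) v⁆) := by
    change _ = modHom S γ τ _
    rw [h1, map_smul, Ring.lie_def (genX S), map_sub, map_mul, map_mul, ← Ring.lie_def,
      modHom_genX, smul_lie, smul_lie, smul_smul, hκ, div_mul_cancel₀ _ h0]
    rfl
  rw [h2]
  simp only [h1]
  exact (hasDerivAt_subst _ (fun l => hasDerivAt_actX_expSeries S κ z v l) l).deriv

end Automorphy

/-! ### The change of variables -/

section ChangeOfVariables

instance : Fintype (KZLetter N) :=
  Fintype.ofInjective (β := Option (ZMod N))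
    (fun g => match g with
      | KZLetter.zero => none
      | KZLetter.root k => some k)
    (fun a b h => by cases a <;> cases b <;> simp_all)

variable (S) (T : Tors N → NCSeries (Gen N S)) (j : ℤ)

/-- The values of the change of variables on the letters. -/
def kzGen : KZLetter N → NCSeries (Gen N S)
  | KZLetter.zero => e0Series S T j
  | KZLetter.root k => actX S (expSeries (-(j / N : ℂ))) (T (k, (j : ZMod N)))

variable {S T}

theorem e0Series_eq_add : e0Series S T j = genY S + ∑ α : Tors N,
    (actX S (expQuot (yLift j α)) (T α) +
      if α.2 = (j : ZMod N) then 0 else actX S (expSeries (-(yLift j α))) (T α)) := by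
  classical
  rw [e0Series, add_assoc, ← Finset.sum_add_distrib]

theorem hasOrder_kzGen (hT : ∀ α, HasOrder 1 (T α)) (x : KZLetter N) :
    HasOrder 1 (kzGen S T j x) := by
  cases x with
  | zero =>
    rw [kzGen, e0Series_eq_add]
    refine (hasOrder_genY S).add (HasOrder.sum fun α _ => (HasOrder.actX S _ (hT α)).add ?_)
    split_ifs
    · exact fun _ _ => rfl
    · exact HasOrder.actX S _ (hT α)
  | root k => exact HasOrder.actX S _ (hT _)

theorem kzGen_mem (hT : ∀ α, T α ∈ pLie S) (x : KZLetter N) : kzGen S T j x ∈ pLie S := by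
  cases x with
  | zero =>
    rw [kzGen, e0Series_eq_add]
    refine (pLie S).add_mem (genY_mem S) (sum_mem fun α _ => (pLie S).add_mem (actX_mem S _ (hT α)) ?_)
    split_ifs
    · exact (pLie S).zero_mem
    · exact actX_mem S _ (hT α)
  | root k => exact actX_mem S _ (hT _)

/-- The change of variables. -/
def kzHom (hT : ∀ α, HasOrder 1 (T α)) : NCSeries (KZLetter N) →ₐ[ℂ] NCSeries (Gen N S) :=
  substₐ (hasOrder_kzGen j hT)

/-- The power series that yield the cyclotomic KZ connection. -/
def kzPower (w : ℂ) (α : Tors N) : PowerSeries ℂ :=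
  expSeries (-(yLift j α)) * (expSubOneDiv⁻¹ + PowerSeries.C
    (if α.2 = (j : ZMod N) then w / (w - rootOf α.1) else 1) * PowerSeries.X)

theorem yLift_of_eq {α : Tors N} (h : α.2 = (j : ZMod N)) : yLift j α = j / N := by
  simp [yLift, h]

theorem tail_kzPower (w : ℂ) (α : Tors N) : tail (kzPower j w α) = expQuot (yLift j α) +
    (if α.2 = (j : ZMod N) then w / (w - rootOf α.1) else 1 : ℂ) • expSeries (-(yLift j α)) := by
  rw [expQuot_eq_tail, kzPower]
  set a : ℂ := if α.2 = (j : ZMod N) then w / (w - rootOf α.1) else 1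
  set p := expSeries (-(yLift j α))
  conv_lhs => rw [mul_add, ← C_add_X_mul_tail (p * expSubOneDiv⁻¹)]
  rw [← tail_C_add_X_mul (PowerSeries.constantCoeff (p * expSubOneDiv⁻¹))
    (tail (p * expSubOneDiv⁻¹) + a • p), PowerSeries.smul_eq_C_mul]
  congr 1
  ring

theorem kzHom_kzForm (hT : ∀ α, HasOrder 1 (T α)) {w : ℂ} (hw : w ≠ 0) :
    kzHom j hT (kzForm w) = w⁻¹ • conn S T (kzPower j w) := by
  have h0 : kzHom j hT (letter KZLetter.zero) = e0Series S T j := substₐ_letter _ _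
  have h1 : ∀ k, kzHom j hT (letter (KZLetter.root k)) =
      actX S (expSeries (-(j / N : ℂ))) (T (k, (j : ZMod N))) := fun k => substₐ_letter _ _
  rw [kzForm, map_add, map_smul, map_sum, h0, e0Series_eq_add, conn, smul_add, smul_add, add_assoc]
  congr 1
  simp only [map_smul, h1]
  have h2 : ∑ k : ZMod N, (w - rootOf k)⁻¹ • actX S (expSeries (-(j / N : ℂ)))
      (T (k, (j : ZMod N))) = ∑ α : Tors N, if α.2 = (j : ZMod N) then
        (w - rootOf α.1)⁻¹ • actX S (expSeries (-(yLift j α))) (T α) else 0 := by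
    rw [Fintype.sum_prod_type]
    refine Finset.sum_congr rfl fun k _ => ?_
    rw [Finset.sum_eq_single (j : ZMod N)]
    · simp [yLift_of_eq j (α := (k, (j : ZMod N))) rfl]
    · intro b _ hb; rw [if_neg hb]
    · simp
  rw [h2, Finset.smul_sum, Finset.smul_sum, ← Finset.sum_add_distrib]
  refine Finset.sum_congr rfl fun α _ => ?_
  rw [tail_kzPower, actX_add, actX_smul, smul_add, smul_add, add_assoc]
  congr 1
  split_ifs with h
  · rw [smul_zero, zero_add, smul_smul, div_eq_mul_inv, inv_mul_cancel_left₀ hw]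
  · simp

/-- The change of variables for `Γ₁(N)`. -/
theorem e0Series_realTors : e0Series (realTors N) (genT (realTors N)) 0 =
    actX (realTors N) expSubOneDiv⁻¹ (genY (realTors N)) := by
  set S := realTors N
  have h1 : ∀ α : Tors N, (actX S (expQuot (yLift 0 α)) (genT S α) +
      if α.2 = ((0 : ℤ) : ZMod N) then 0 else actX S (expSeries (-(yLift 0 α))) (genT S α)) =
      actX S (expQuot 0) (genT S α) := fun α => by
    by_cases h : α.2 = ((0 : ℤ) : ZMod N)
    · rw [if_pos h, yLift_of_eq 0 h]; simp
    · have : genT S α = 0 := genT_of_not_mem S fun hα => h (by simpa using hα.2)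
      rw [if_neg h, this]
      simp [actX, adSeries_zero]
  rw [e0Series_eq_add, Finset.sum_congr rfl fun α _ => h1 α, expQuot_eq_tail, neg_zero,
    expSeries_zero, one_mul]
  have h2 : ∑ α, actX S (tail expSubOneDiv⁻¹) (genT S α) =
      actX S (PowerSeries.X * tail expSubOneDiv⁻¹) (genY S) := by
    rw [mul_comm, actX_mul, actX_X, ← sum_genT S, actX, adSeries_sum]; rfl
  rw [h2]
  conv_rhs => rw [← C_add_X_mul_tail expSubOneDiv⁻¹, constantCoeff_expSubOneDiv_inv, map_one,
    actX_add, actX, one_adSeries]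

end ChangeOfVariables

/-! ### Local solutions of `dΦ = Φ f dz` -/

section Solutions

variable {σ : Type} {f : ℂ → NCSeries σ} {Φ Ψ : ℂ → NCSeries σ}

/-- `Φ` satisfies `dΦ = Φ f dz` at the point `z`. -/
def IsSol (f Φ : ℂ → NCSeries σ) (z : ℂ) : Prop :=
  ∀ l : List σ, HasDerivAt (fun s => Φ s l) ((Φ z * f z) l) z

theorem mul_apply_of_nil {g : NCSeries σ} (hg : g [] = 0) (h : NCSeries σ) (l : List σ) :
    (h * g) l = ∑ i ∈ Finset.range l.length, h (l.take i) * g (l.drop i) := by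
  rw [mul_apply, Finset.sum_range_succ]; simp [hg]

theorem IsSol.const_mul {z : ℂ} (h : IsSol f Φ z) (a : NCSeries σ) :
    IsSol f (fun s => a * Φ s) z := fun l => by
  rw [mul_assoc]
  exact HasDerivAt.fun_sum fun i _ => (h _).const_mul _

theorem IsSol.mul_const {z : ℂ} (h : IsSol f Φ z) {a : NCSeries σ} {g : ℂ → NCSeries σ}
    (hab : f z * a = a * g z) : IsSol g (fun s => Φ s * a) z := fun l => by
  rw [mul_assoc, ← hab, ← mul_assoc]
  exact HasDerivAt.fun_sum fun i _ => (h _).mul_const _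

theorem eqOn_of_isSol {K : Set ℂ} (hK : IsOpen K) (hK' : IsPreconnected K)
    (h0 : ∀ z, f z [] = 0) (hΦ : ∀ z ∈ K, IsSol f Φ z) (hΨ : ∀ z ∈ K, IsSol f Ψ z) {a : ℂ}
    (ha : a ∈ K) (h : Φ a = Ψ a) : Set.EqOn Φ Ψ K := by
  suffices ∀ l : List σ, ∀ z ∈ K, Φ z l = Ψ z l from fun z hz => NCSeries.ext fun l => this l z hz
  intro l
  induction hn : l.length using Nat.strong_induction_on generalizing l with
  | _ n ih =>
    refine hK.eqOn_of_deriv_eq (f := fun z => Φ z l) (g := fun z => Ψ z l) hK'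
      (fun z hz => (hΦ z hz l).differentiableAt.differentiableWithinAt)
      (fun z hz => (hΨ z hz l).differentiableAt.differentiableWithinAt) (fun z hz => ?_) ha
      (congrFun h l)
    rw [(hΦ z hz l).deriv, (hΨ z hz l).deriv, mul_apply_of_nil (h0 z), mul_apply_of_nil (h0 z)]
    refine Finset.sum_congr rfl fun i hi => ?_
    rw [Finset.mem_range] at hi
    rw [ih (l.take i).length (by rw [List.length_take]; omega) _ rfl z hz]

open Classical in
/-- A primitive on a ball with value `0` at `a`. -/
def primitive (c : ℂ) (r : ℝ) (a : ℂ) (g : ℂ → ℂ) : ℂ → ℂ :=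
  if h : ∃ G : ℂ → ℂ, G a = 0 ∧ ∀ z ∈ Metric.ball c r, HasDerivAt G (g z) z then h.choose else 0

theorem primitive_spec {c : ℂ} {r : ℝ} (a : ℂ) {g : ℂ → ℂ}
    (hg : DifferentiableOn ℂ g (Metric.ball c r)) : primitive c r a g a = 0 ∧
      ∀ z ∈ Metric.ball c r, HasDerivAt (primitive c r a g) (g z) z := by
  have h : ∃ G : ℂ → ℂ, G a = 0 ∧ ∀ z ∈ Metric.ball c r, HasDerivAt G (g z) z :=
    hg.isExactOn_ball.with_val_at a 0
  rw [primitive, dif_pos h]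
  exact h.choose_spec

/-- The coefficients of the solution on a ball with value `1` at `a`. -/
def solCoeff (f : ℂ → NCSeries σ) (c : ℂ) (r : ℝ) (a : ℂ) (l : List σ) : ℂ → ℂ := fun z =>
  (1 : NCSeries σ) l + primitive c r a (fun z => ∑ i : Fin l.length,
    solCoeff f c r a (l.take i) z * f z (l.drop i)) z
termination_by l.length
decreasing_by simp

theorem solCoeff_eq (f : ℂ → NCSeries σ) (c : ℂ) (r : ℝ) (a : ℂ) (l : List σ) :
    solCoeff f c r a l = fun z => (1 : NCSeries σ) l +
      primitive c r a (fun z => ∑ i : Fin l.length,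
        solCoeff f c r a (l.take i) z * f z (l.drop i)) z := by
  funext z; rw [solCoeff]

/-- The solution on a ball with value `1` at `a`. -/
def ballSol (f : ℂ → NCSeries σ) (c : ℂ) (r : ℝ) (a : ℂ) (z : ℂ) : NCSeries σ :=
  fun l => solCoeff f c r a l z

variable {c : ℂ} {r : ℝ}

theorem ballSol_spec (h0 : ∀ z, f z [] = 0)
    (hf : ∀ l, DifferentiableOn ℂ (fun z => f z l) (Metric.ball c r)) (a : ℂ) :
    ballSol f c r a a = 1 ∧ ∀ z ∈ Metric.ball c r, IsSol f (ballSol f c r a) z := by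
  have h1 : ∀ l : List σ, (solCoeff f c r a l a = (1 : NCSeries σ) l) ∧
      ∀ z ∈ Metric.ball c r, HasDerivAt (solCoeff f c r a l)
        (∑ i : Fin l.length, solCoeff f c r a (l.take i) z * f z (l.drop i)) z := by
    intro l
    induction hn : l.length using Nat.strong_induction_on generalizing l with
    | _ n ih =>
      subst hn
      have hd : DifferentiableOn ℂ (fun z => ∑ i : Fin l.length,
          solCoeff f c r a (l.take i) z * f z (l.drop i)) (Metric.ball c r) := by
        refine DifferentiableOn.fun_sum fun i _ => DifferentiableOn.fun_mul (fun z hz => ?_) (hf _)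
        exact ((ih _ (by simp) (l.take i) rfl).2 z
          hz).differentiableAt.differentiableWithinAt
      obtain ⟨h2, h3⟩ := primitive_spec a hd
      constructor
      · rw [solCoeff_eq]
        simp only [h2, add_zero]
      · intro z hz
        rw [solCoeff_eq]
        exact (h3 z hz).const_add _
  refine ⟨NCSeries.ext fun l => (h1 l).1, fun z hz l => ?_⟩
  rw [mul_apply_of_nil (h0 z), Finset.sum_range]
  exact (h1 l).2 z hz

theorem isUnit_of_isSol (h0 : ∀ z, f z [] = 0)
    (hf : ∀ l, DifferentiableOn ℂ (fun z => f z l) (Metric.ball c r)) {b : ℂ}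
    (hb : b ∈ Metric.ball c r) (hΦ : ∀ z ∈ Metric.ball c r, IsSol f Φ z) (h1 : Φ b = 1) {a : ℂ}
    (ha : a ∈ Metric.ball c r) : IsUnit (Φ a) := by
  obtain ⟨h2, h3⟩ := ballSol_spec h0 hf a
  set Ψ := ballSol f c r a
  have hK := Metric.isOpen_ball (x := c) (ε := r)
  have hK' := (convex_ball c r).isPreconnected
  have e1 := eqOn_of_isSol hK hK' h0 (fun z hz => (h3 z hz).const_mul (Φ a)) hΦ ha
    (by simp [h2]) hb
  have e2 := eqOn_of_isSol hK hK' h0 (fun z hz => (hΦ z hz).const_mul (Ψ b)) h3 hb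
    (by simp [h1]) ha
  exact ⟨⟨Φ a, Ψ b, by simpa [h1] using e1, by simpa [h2] using e2⟩, rfl⟩

end Solutions

/-! ### Transport along paths -/

section Transport

variable {σ : Type} {f : ℂ → NCSeries σ} {X : Type*} [TopologicalSpace X]

/-- `T` is locally the composition of `γ` with a solution. -/
def IsLocSol (f : ℂ → NCSeries σ) (γ : X → ℂ) (T : X → NCSeries σ) : Prop :=
  ∀ t : X, ∃ Φ : ℂ → NCSeries σ, (∀ᶠ z in 𝓝 (γ t), IsSol f Φ z) ∧ ∀ᶠ s in 𝓝 t, T s = Φ (γ s)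

theorem IsLocSol.comp {γ : X → ℂ} {T : X → NCSeries σ} (h : IsLocSol f γ T) {Y : Type*}
    [TopologicalSpace Y] {g : Y → X} (hg : Continuous g) : IsLocSol f (γ ∘ g) (T ∘ g) := fun t => by
  obtain ⟨Φ, h1, h2⟩ := h (g t)
  exact ⟨Φ, h1, hg.continuousAt.eventually h2⟩

theorem IsLocSol.const_mul {γ : X → ℂ} {T : X → NCSeries σ} (h : IsLocSol f γ T)
    (a : NCSeries σ) : IsLocSol f γ (fun t => a * T t) := fun t => by
  obtain ⟨Φ, h1, h2⟩ := h t
  exact ⟨fun z => a * Φ z, h1.mono fun z hz => hz.const_mul a, h2.mono fun s hs => congrArg (a * ·) hs⟩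

theorem isLocSol_of_isSol {γ : X → ℂ} {K : Set ℂ} (hK : IsOpen K)
    (h : ∀ t, γ t ∈ K) {Φ : ℂ → NCSeries σ} (hΦ : ∀ z ∈ K, IsSol f Φ z) :
    IsLocSol f γ fun t => Φ (γ t) := fun t =>
  ⟨Φ, Filter.eventually_of_mem (hK.mem_nhds (h t)) hΦ, .of_forall fun _ => rfl⟩

theorem IsLocSol.unique [PreconnectedSpace X] (h0 : ∀ z, f z [] = 0) {γ : X → ℂ}
    (hγ : Continuous γ) {T T' : X → NCSeries σ} (h : IsLocSol f γ T) (h' : IsLocSol f γ T') {t₀ : X}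
    (ht₀ : T t₀ = T' t₀) : T = T' := by
  have key : ∀ t : X, (∀ᶠ s in 𝓝 t, T s = T' s) ∨ ∀ᶠ s in 𝓝 t, T s ≠ T' s := by
    intro t
    obtain ⟨Φ, h1, h2⟩ := h t
    obtain ⟨Ψ, h3, h4⟩ := h' t
    obtain ⟨r, hr, hr'⟩ := Metric.eventually_nhds_iff_ball.1 (h1.and h3)
    have hb : ∀ᶠ s in 𝓝 t, γ s ∈ Metric.ball (γ t) r :=
      hγ.continuousAt.eventually (Metric.ball_mem_nhds _ hr)
    by_cases hc : Φ (γ t) = Ψ (γ t)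
    · left
      have := eqOn_of_isSol Metric.isOpen_ball (convex_ball _ _).isPreconnected h0
        (fun z hz => (hr' z hz).1) (fun z hz => (hr' z hz).2) (Metric.mem_ball_self hr) hc
      filter_upwards [h2, h4, hb] with s h5 h6 h7
      rw [h5, h6, this h7]
    · right
      filter_upwards [h2, h4, hb] with s h5 h6 h7 h8
      refine hc (eqOn_of_isSol Metric.isOpen_ball (convex_ball _ _).isPreconnected h0
        (fun z hz => (hr' z hz).1) (fun z hz => (hr' z hz).2) h7 ?_ (Metric.mem_ball_self hr))
      rw [← h5, ← h6, h8]
  have hcl : IsClopen {t | T t = T' t} := by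
    constructor
    · rw [← isOpen_compl_iff, isOpen_iff_mem_nhds]
      intro t ht
      rcases key t with h | h
      · exact absurd h.self_of_nhds ht
      · exact h
    · rw [isOpen_iff_mem_nhds]
      intro t ht
      rcases key t with h | h
      · exact h
      · exact absurd ht h.self_of_nhds
  have := hcl.eq_univ ⟨t₀, ht₀⟩
  exact funext fun t => Set.eq_univ_iff_forall.1 this t

end Transport

/-! ### The covering space of local solutions -/

section Covering

/-- A type with the discrete topology. -/
def Discrete (α : Type*) : Type _ := α

/-- The underlying element. -/
def Discrete.val {α : Type*} (a : Discrete α) : α := a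

instance (α : Type*) : TopologicalSpace (Discrete α) := ⊥
instance (α : Type*) : DiscreteTopology (Discrete α) := ⟨rfl⟩

variable {σ : Type} {f : ℂ → NCSeries σ} {U : Set ℂ}

theorem exists_ball_subset (hU : IsOpen U) (x : U) : ∃ r > 0, Metric.ball (x : ℂ) r ⊆ U :=
  Metric.isOpen_iff.1 hU x x.2

/-- The solution near a point `x` of `U`, with value `1` at `x`. -/
def locSol (f : ℂ → NCSeries σ) (hU : IsOpen U) (x : U) : ℂ → NCSeries σ :=
  ballSol f x (exists_ball_subset hU x).choose x

/-- The domain of the local solution. -/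
def locBall (hU : IsOpen U) (x : U) : Set ℂ := Metric.ball (x : ℂ) (exists_ball_subset hU x).choose

theorem isOpen_locBall (hU : IsOpen U) (x : U) : IsOpen (locBall hU x) := Metric.isOpen_ball

theorem mem_locBall (hU : IsOpen U) (x : U) : (x : ℂ) ∈ locBall hU x :=
  Metric.mem_ball_self (exists_ball_subset hU x).choose_spec.1

/-- `d + f dz` is a holomorphic connection on the open set `U`, nilpotent with respect to the
grading by degree. -/
structure IsConnForm (f : ℂ → NCSeries σ) (U : Set ℂ) : Prop where
  isOpen : IsOpen U
  nil : ∀ z, f z [] = 0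
  diff : ∀ l, DifferentiableOn ℂ (fun z => f z l) U

variable (h : IsConnForm f U)

theorem locSol_spec (h : IsConnForm f U) (x : U) :
    locSol f h.isOpen x x = 1 ∧ ∀ z ∈ locBall h.isOpen x, IsSol f (locSol f h.isOpen x) z :=
  ballSol_spec h.nil (fun l => (h.diff l).mono (exists_ball_subset h.isOpen x).choose_spec.2) x

theorem isUnit_locSol (h : IsConnForm f U) (x : U) {a : ℂ} (ha : a ∈ locBall h.isOpen x) : IsUnit (locSol f h.isOpen x a) :=
  isUnit_of_isSol h.nil (fun l => (h.diff l).mono (exists_ball_subset h.isOpen x).choose_spec.2)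
    (mem_locBall h.isOpen x) (locSol_spec h x).2 (locSol_spec h x).1 ha

theorem locSol_mul_inverse (h : IsConnForm f U) {x y : U} {a b : ℂ} (ha : a ∈ locBall h.isOpen x ∩ locBall h.isOpen y)
    (hb : b ∈ locBall h.isOpen x ∩ locBall h.isOpen y) :
    locSol f h.isOpen x a * Ring.inverse (locSol f h.isOpen y a) =
      locSol f h.isOpen x b * Ring.inverse (locSol f h.isOpen y b) := by
  set k := locSol f h.isOpen x a * Ring.inverse (locSol f h.isOpen y a) with hk
  have hK : IsOpen (locBall h.isOpen x ∩ locBall h.isOpen y) := (isOpen_locBall h.isOpen x).inter (isOpen_locBall h.isOpen y)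
  have hK' : IsPreconnected (locBall h.isOpen x ∩ locBall h.isOpen y) :=
    ((convex_ball _ _).inter (convex_ball _ _)).isPreconnected
  have := eqOn_of_isSol hK hK' h.nil
    (fun z hz => ((locSol_spec h y).2 z hz.2).const_mul k)
    (fun z hz => (locSol_spec h x).2 z hz.1) ha
    (by rw [hk, mul_assoc, Ring.inverse_mul_cancel _ (isUnit_locSol h y ha.2), mul_one]) hb
  rw [← this, mul_assoc, Ring.mul_inverse_cancel _ (isUnit_locSol h y hb.2), mul_one]

/-- The local system of solutions. -/
def solCore : FiberBundleCore U U (Discrete (NCSeries σ)) where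
  baseSet x := {y : U | (y : ℂ) ∈ locBall h.isOpen x}
  isOpen_baseSet x := (isOpen_locBall h.isOpen x).preimage continuous_subtype_val
  indexAt x := x
  mem_baseSet_at x := mem_locBall h.isOpen x
  coordChange x y z v := (v.val * (locSol f h.isOpen x z * Ring.inverse (locSol f h.isOpen y z)) : NCSeries σ)
  coordChange_self x z hz v := by
    rw [Ring.mul_inverse_cancel _ (isUnit_locSol h x hz)]
    exact mul_one v.val
  continuousOn_coordChange x y := by
    rintro ⟨z, v⟩ ⟨hz, -⟩
    let k : Discrete (NCSeries σ) :=
      (v.val * (locSol f h.isOpen x z * Ring.inverse (locSol f h.isOpen y z)) : NCSeries σ)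
    refine ContinuousWithinAt.congr_of_eventuallyEq (f := fun _ => k)
      continuousWithinAt_const ?_ rfl
    have h1 : ∀ᶠ p : U × Discrete (NCSeries σ) in 𝓝 (z, v), p.2 = v :=
      (continuous_snd.tendsto (z, v)).eventually ((isOpen_discrete {v}).mem_nhds rfl)
    filter_upwards [self_mem_nhdsWithin, nhdsWithin_le_nhds h1] with p hp hp'
    change p.2.val * (locSol f h.isOpen x p.1 * Ring.inverse (locSol f h.isOpen y p.1)) = k
    rw [hp', locSol_mul_inverse h hp.1 hz]
  coordChange_comp x y w z hz v := by
    obtain ⟨⟨hx, hy⟩, hw⟩ := hz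
    have h1 := Ring.inverse_mul_cancel _ (isUnit_locSol h y hy)
    calc (v.val * (locSol f h.isOpen x z * Ring.inverse (locSol f h.isOpen y z)) *
        (locSol f h.isOpen y z * Ring.inverse (locSol f h.isOpen w z)) : NCSeries σ)
      _ = v.val * locSol f h.isOpen x z *
        (Ring.inverse (locSol f h.isOpen y z) * locSol f h.isOpen y z) *
          Ring.inverse (locSol f h.isOpen w z) := by simp only [mul_assoc]
      _ = _ := by rw [h1, mul_one, mul_assoc]

theorem isCoveringMap_solCore : IsCoveringMap (solCore h).proj :=
  FiberBundle.isCoveringMap (E := (solCore h).Fiber)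

theorem isLocSol_lift (Γ : C(unitInterval, (solCore h).TotalSpace)) :
    IsLocSol f (fun t => ((Γ t).1 : ℂ)) (fun t => (Discrete.val (Γ t).2)) := by
  intro t
  let Z := solCore h
  let x : U := (Γ t).1
  refine ⟨fun z => (Discrete.val (Γ t).2) * locSol f h.isOpen x z, ?_, ?_⟩
  · filter_upwards [(isOpen_locBall h.isOpen x).mem_nhds (mem_locBall h.isOpen x)] with z hz
    exact ((locSol_spec h x).2 z hz).const_mul _
  · have h1 : ContinuousAt (fun s => ((Z.localTriv x) (Γ s)).2) t := by
      refine continuous_snd.continuousAt.comp (ContinuousAt.comp ?_ Γ.continuous.continuousAt)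
      exact (Z.localTriv x).continuousAt (by
        rw [Z.mem_localTriv_source]; exact mem_locBall h.isOpen x)
    have h2 : ∀ᶠ s in 𝓝 t, ((Z.localTriv x) (Γ s)).2 = ((Z.localTriv x) (Γ t)).2 :=
      h1.eventually ((isOpen_discrete {((Z.localTriv x) (Γ t)).2}).mem_nhds rfl)
    have h3 : ∀ᶠ s in 𝓝 t, ((Γ s).1 : ℂ) ∈ locBall h.isOpen x := by
      have : Continuous fun s => ((Γ s).1 : ℂ) :=
        continuous_subtype_val.comp (Z.continuous_proj.comp Γ.continuous)
      exact this.continuousAt.eventually ((isOpen_locBall h.isOpen x).mem_nhds (mem_locBall h.isOpen x))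
    filter_upwards [h2, h3] with s h4 h5
    have h6 : ∀ s, ((Z.localTriv x) (Γ s)).2 = (Discrete.val (Γ s).2 *
      (locSol f h.isOpen (Γ s).1 (Γ s).1 * Ring.inverse (locSol f h.isOpen x (Γ s).1)) : NCSeries σ) :=
      fun s => rfl
    rw [h6, h6, (locSol_spec h _).1, (locSol_spec h _).1, one_mul, one_mul,
      Ring.inverse_one, mul_one] at h4
    change Discrete.val (Γ s).2 = Discrete.val (Γ t).2 * locSol f h.isOpen x (Γ s).1
    rw [← h4, mul_assoc, Ring.inverse_mul_cancel _ (isUnit_locSol h x h5), mul_one]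

/-- Existence of the transport. -/
theorem exists_isTransport (h : IsConnForm f U) (γ : C(unitInterval, U)) :
    ∃ T, IsTransport f (fun t => (γ t : ℂ)) T := by
  let Z := solCore h
  obtain ⟨Γ, h1, h2⟩ := (isCoveringMap_solCore h).exists_path_lifts γ
    (⟨γ 0, (1 : NCSeries σ)⟩ : Z.TotalSpace) rfl
  have h3 : ∀ t, (Γ t).1 = γ t := fun t => congrFun h1 t
  have h4 := isLocSol_lift h Γ
  simp only [h3] at h4
  have h5 : Discrete.val (Γ 0).2 = 1 := by rw [h2]; rfl
  exact ⟨fun t => (Discrete.val (Γ t).2), h5, h4⟩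

/-- Homotopy invariance of the transport. -/
theorem IsTransport.eq_of_homotopicRel (h : IsConnForm f U) {γ γ' : C(unitInterval, U)}
    (hγ : γ.HomotopicRel γ' {0, 1}) {T T' : unitInterval → NCSeries σ}
    (hT : IsTransport f (fun t => (γ t : ℂ)) T) (hT' : IsTransport f (fun t => (γ' t : ℂ)) T') :
    T 1 = T' 1 := by
  let Z := solCore h
  have cov := isCoveringMap_solCore h
  have h00 : γ' 0 = γ 0 := (hγ.some.fst_eq_snd (x := 0) (Or.inl rfl)).symm
  let e : Z.TotalSpace := ⟨γ 0, (1 : NCSeries σ)⟩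
  have key : ∀ (γ₁ : C(unitInterval, U)) (h1 : γ₁ 0 = Z.proj e) (T₁ : unitInterval → NCSeries σ),
      IsTransport f (fun t => (γ₁ t : ℂ)) T₁ → T₁ 1 = Discrete.val (cov.liftPath γ₁ e h1 1).2 := by
    intro γ₁ h1 T₁ hT₁
    set Γ := cov.liftPath γ₁ e h1
    have h3 : ∀ t, (Γ t).1 = γ₁ t := fun t => congrFun (cov.liftPath_lifts γ₁ e h1) t
    have h4 := isLocSol_lift h Γ
    simp only [h3] at h4
    refine congrFun (IsLocSol.unique h.nil (by fun_prop) hT₁.2 h4 (t₀ := 0) ?_) 1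
    have h5 : Γ 0 = e := cov.liftPath_zero γ₁ e h1
    rw [hT₁.1, h5]
    rfl
  rw [key γ rfl T hT, key γ' h00 T' hT', cov.liftPath_apply_one_eq_of_homotopicRel hγ e rfl h00]

end Covering

/-! ### Functoriality of the transport -/

section Functoriality

variable {σ : Type} {f : ℂ → NCSeries σ} {X : Type*} [TopologicalSpace X]

theorem IsLocSol.subst {τ : Type} [Fintype σ] {c : σ → NCSeries τ} (hc : ∀ x, HasOrder 1 (c x))
    {γ : X → ℂ} {T : X → NCSeries σ} (h : IsLocSol f γ T) :
    IsLocSol (fun z => substₐ hc (f z)) γ (fun t => substₐ hc (T t)) := fun t => by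
  obtain ⟨Φ, h1, h2⟩ := h t
  refine ⟨fun z => substₐ hc (Φ z), h1.mono fun z hz l => ?_,
    h2.mono fun s hs => congrArg (substₐ hc ·) hs⟩
  rw [← map_mul]
  exact hasDerivAt_subst c hz l

theorem IsSol.comp {Φ : ℂ → NCSeries σ} {g : ℂ → ℂ} {g' z : ℂ} (hg : HasDerivAt g g' z)
    (h : IsSol f Φ (g z)) {k : ℂ → NCSeries σ} (hk : k z = g' • f (g z)) :
    IsSol k (fun s => Φ (g s)) z := fun l => by
  have := (h l).comp z hg
  rw [hk, mul_smul_comm, smul_apply, mul_comm]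
  exact this

theorem IsLocSol.of_comp {g g' : ℂ → ℂ} (hg : ∀ z, HasDerivAt g (g' z) z) {γ : X → ℂ}
    {T : X → NCSeries σ} (h : IsLocSol f (fun t => g (γ t)) T) :
    IsLocSol (fun z => g' z • f (g z)) γ T := fun t => by
  obtain ⟨Φ, h1, h2⟩ := h t
  exact ⟨fun z => Φ (g z), ((hg (γ t)).continuousAt.eventually h1).mono fun z hz =>
    hz.comp (hg z) rfl, h2⟩

theorem IsLocSol.apply_nil [PreconnectedSpace X] (h0 : ∀ z, f z [] = 0) {γ : X → ℂ}
    (hγ : Continuous γ) {T : X → NCSeries σ} (h : IsLocSol f γ T) {t₀ : X} (ht₀ : T t₀ [] = 1)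
    (t : X) : T t [] = 1 := by
  have h1 : IsLocSol (fun _ => (0 : NCSeries σ)) γ fun t => (T t []) • (1 : NCSeries σ) := by
    intro t
    obtain ⟨Φ, h1, h2⟩ := h t
    refine ⟨fun z => Φ z [] • (1 : NCSeries σ), h1.mono fun z hz l => ?_,
      h2.mono fun s hs => congrArg (fun a : NCSeries σ => a [] • (1 : NCSeries σ)) hs⟩
    have := (hz []).mul_const ((1 : NCSeries σ) l)
    rw [mul_nil, h0, mul_zero, zero_mul] at this
    simpa using this
  have h2 : IsLocSol (fun _ => (0 : NCSeries σ)) γ fun _ => (1 : NCSeries σ) := fun t =>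
    ⟨fun _ => 1, .of_forall fun z l => by simpa using hasDerivAt_const z _,
      .of_forall fun _ => rfl⟩
  have h3 := congrFun (h1.unique (fun _ => rfl) hγ h2 (t₀ := t₀) (by simp [ht₀])) t
  simpa [one_apply] using congrFun h3 []

theorem IsTransport.unique (h0 : ∀ z, f z [] = 0) {γ : unitInterval → ℂ} (hγ : Continuous γ)
    {T T' : unitInterval → NCSeries σ} (h : IsTransport f γ T) (h' : IsTransport f γ T') : T = T' :=
  IsLocSol.unique h0 hγ h.2 h'.2 (h.1.trans h'.1.symm)

/-- The transport along a concatenation of paths. -/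
theorem IsTransport.trans (h0 : ∀ z, f z [] = 0) {a b c : ℂ} (γ : Path a b) (γ' : Path b c)
    {T T' T'' : unitInterval → NCSeries σ} (h : IsTransport f γ T) (h' : IsTransport f γ' T')
    (h'' : IsTransport f (γ.trans γ') T'') : T'' 1 = T 1 * T' 1 := by
  let u : unitInterval → unitInterval := fun t => ⟨t / 2, by
    constructor <;> linarith [t.2.1, t.2.2]⟩
  let v : unitInterval → unitInterval := fun t => ⟨(1 + t) / 2, by
    constructor <;> linarith [t.2.1, t.2.2]⟩
  have hu : Continuous u := by fun_prop
  have hv : Continuous v := by fun_prop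
  have hγu : γ.trans γ' ∘ u = γ := by
    funext t
    have ht : ((u t : unitInterval) : ℝ) ≤ 1 / 2 := by change (t : ℝ) / 2 ≤ 1 / 2; linarith [t.2.2]
    rw [Function.comp_apply, Path.trans_apply, dif_pos ht]
    congr 1
    ext
    change 2 * ((t : ℝ) / 2) = t
    ring
  have hγv : γ.trans γ' ∘ v = γ' := by
    funext t
    rw [Function.comp_apply, Path.trans_apply]
    split_ifs with ht
    · have h2 : (1 + (t : ℝ)) / 2 ≤ 1 / 2 := ht
      have h3 : t = 0 := Subtype.ext (le_antisymm (by simp; linarith) t.2.1)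
      have h4 : (⟨2 * (v t : ℝ), (unitInterval.mul_pos_mem_iff zero_lt_two).2 ⟨(v t).2.1, ht⟩⟩ :
          unitInterval) = 1 := by
        ext
        change 2 * ((1 + (t : ℝ)) / 2) = 1
        rw [h3]; simp
      rw [h4, γ.target, h3, γ'.source]
    · congr 1
      ext
      change 2 * ((1 + (t : ℝ)) / 2) - 1 = t
      ring
  have e1 : T'' ∘ u = T := by
    refine IsTransport.unique h0 γ.continuous ⟨?_, ?_⟩ h
    · have : u 0 = 0 := by ext; simp [u]
      rw [Function.comp_apply, this, h''.1]
    · have := IsLocSol.comp h''.2 hu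
      rwa [hγu] at this
  have e2 : T'' ∘ v = fun t => T 1 * T' t := by
    have h3 := IsLocSol.comp h''.2 hv
    rw [hγv] at h3
    refine IsLocSol.unique h0 γ'.continuous h3 (IsLocSol.const_mul h'.2 (T 1)) (t₀ := 0) ?_
    rw [h'.1, mul_one, ← e1]
    have : v 0 = u 1 := by ext; simp [u, v]
    rw [Function.comp_apply, this]; rfl
  have : v 1 = 1 := by ext; simp [v]
  rw [← congrFun e2 1, Function.comp_apply, this]

end Functoriality

/-! ### Dependence on parameters -/

section Parameters

variable {σ : Type} {ι : Type*} {p : Filter ι} {f : ι → ℂ → NCSeries σ} {f₀ : ℂ → NCSeries σ}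

theorem tendstoLocallyUniformlyOn_primitive {c a : ℂ} {r : ℝ} (ha : a ∈ Metric.ball c r)
    {g : ι → ℂ → ℂ} {g₀ : ℂ → ℂ} {G : ι → ℂ → ℂ} {G₀ : ℂ → ℂ}
    (hg : TendstoLocallyUniformlyOn g g₀ p (Metric.ball c r))
    (hG : ∀ᶠ i in p, ∀ z ∈ Metric.ball c r, HasDerivAt (G i) (g i z) z)
    (hG₀ : ∀ z ∈ Metric.ball c r, HasDerivAt G₀ (g₀ z) z) (hi : ∀ᶠ i in p, G i a = G₀ a) :
    TendstoLocallyUniformlyOn G G₀ p (Metric.ball c r) := by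
  rw [tendstoLocallyUniformlyOn_iff_forall_isCompact Metric.isOpen_ball] at hg ⊢
  intro K hKr hK
  obtain ⟨ρ, hρ, hKρ⟩ : ∃ ρ < r, K ⊆ Metric.closedBall c ρ := by
    rcases K.eq_empty_or_nonempty with rfl | hne
    · exact ⟨r - 1, by linarith, Set.empty_subset _⟩
    obtain ⟨x, hx, hx'⟩ := hK.exists_isMaxOn hne (f := fun z => dist z c) (by fun_prop)
    exact ⟨dist x c, hKr hx, fun z hz => hx' hz⟩
  set ρ' := max ρ (dist a c)
  have hρ' : ρ' < r := max_lt hρ ha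
  have hsub : Metric.closedBall c ρ' ⊆ Metric.ball c r := Metric.closedBall_subset_ball hρ'
  have ha' : a ∈ Metric.closedBall c ρ' := Metric.mem_closedBall.2 (le_max_right _ _)
  have h1 := hg _ hsub (isCompact_closedBall c ρ')
  have hKρ' : K ⊆ Metric.closedBall c ρ' :=
    hKρ.trans (Metric.closedBall_subset_closedBall (le_max_left _ _))
  refine TendstoUniformlyOn.mono ?_ hKρ'
  rw [Metric.tendstoUniformlyOn_iff] at h1 ⊢
  intro ε hε
  have hρ0 : 0 ≤ ρ' := dist_nonneg.trans (le_max_right _ _)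
  filter_upwards [h1 (ε / (2 * ρ' + 1)) (by positivity), hG, hi] with i h2 h3 h4 z hz
  have h5 : ‖(G₀ z - G i z) - (G₀ a - G i a)‖ ≤ ε / (2 * ρ' + 1) * ‖z - a‖ :=
    (convex_closedBall c ρ').norm_image_sub_le_of_norm_hasDerivWithin_le
      (f := fun z => G₀ z - G i z) (f' := fun z => g₀ z - g i z)
      (fun x hx => ((hG₀ x (hsub hx)).sub (h3 x (hsub hx))).hasDerivWithinAt)
      (fun x hx => by rw [← dist_eq_norm]; exact (h2 x hx).le) ha' hz
  rw [h4, sub_self, sub_zero, ← dist_eq_norm] at h5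
  have h6 : ‖z - a‖ ≤ 2 * ρ' := by
    rw [← dist_eq_norm]
    calc dist z a ≤ dist z c + dist c a := dist_triangle _ _ _
      _ ≤ ρ' + ρ' := add_le_add hz (by rw [dist_comm]; exact ha')
      _ = 2 * ρ' := by ring
  refine h5.trans_lt ?_
  rw [div_mul_eq_mul_div, div_lt_iff₀ (by positivity)]
  nlinarith

theorem tendstoLocallyUniformlyOn_ballSol {c a : ℂ} {r : ℝ} (ha : a ∈ Metric.ball c r)
    (h0 : ∀ i z, f i z [] = 0) (h0' : ∀ z, f₀ z [] = 0)
    (hf : ∀ᶠ i in p, ∀ l, DifferentiableOn ℂ (fun z => f i z l) (Metric.ball c r))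
    (hf₀ : ∀ l, DifferentiableOn ℂ (fun z => f₀ z l) (Metric.ball c r))
    (h : ∀ l, TendstoLocallyUniformlyOn (fun i z => f i z l) (fun z => f₀ z l) p (Metric.ball c r))
    (l : List σ) : TendstoLocallyUniformlyOn (fun i z => ballSol (f i) c r a z l)
      (fun z => ballSol f₀ c r a z l) p (Metric.ball c r) := by
  have h1 := ballSol_spec h0' hf₀ a
  induction hn : l.length using Nat.strong_induction_on generalizing l with
  | _ n ih =>
    subst hn
    refine tendstoLocallyUniformlyOn_primitive ha
      (g := fun i z => ∑ j ∈ Finset.range l.length, ballSol (f i) c r a z (l.take j) *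
        f i z (l.drop j))
      (g₀ := fun z => ∑ j ∈ Finset.range l.length, ballSol f₀ c r a z (l.take j) *
        f₀ z (l.drop j)) ?_ ?_ ?_ ?_
    · have h2 : ∀ j ∈ Finset.range l.length, TendstoLocallyUniformlyOn
          (fun i z => ballSol (f i) c r a z (l.take j) * f i z (l.drop j))
          (fun z => ballSol f₀ c r a z (l.take j) * f₀ z (l.drop j)) p (Metric.ball c r) :=
        fun j hj => (ih _ (by rw [Finset.mem_range] at hj; simp; omega) (l.take j) rfl).mul₀ (h _)
          (fun z hz => (h1.2 z hz _).continuousAt.continuousWithinAt) (hf₀ _).continuousOn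
      generalize Finset.range l.length = s at h2
      induction s using Finset.cons_induction with
      | empty =>
        simp only [Finset.sum_empty]
        exact fun u hu x _ => ⟨Set.univ, Filter.univ_mem, .of_forall fun _ _ _ => refl_mem_uniformity hu⟩
      | cons j s hj ihs =>
        simp only [Finset.sum_cons]
        exact (h2 j (by simp)).add (ihs fun k hk => h2 k (by simp [hk]))
    · filter_upwards [hf] with i hi z hz
      have := (ballSol_spec (h0 i) hi a).2 z hz l
      rwa [mul_apply_of_nil (h0 i z)] at this
    · intro z hz
      have := h1.2 z hz l
      rwa [mul_apply_of_nil (h0' z)] at this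
    · filter_upwards [hf] with i hi
      rw [(ballSol_spec (h0 i) hi a).1, h1.1]

/-- The transport depends continuously on the connection. -/
theorem tendsto_transport [p.NeBot] {U : Set ℂ} (h0 : ∀ i z, f i z [] = 0) (hf₀ : IsConnForm f₀ U)
    (hf : ∀ x ∈ U, ∃ r > 0, Metric.ball x r ⊆ U ∧ ∀ᶠ i in p, ∀ l,
      DifferentiableOn ℂ (fun z => f i z l) (Metric.ball x r))
    (h : ∀ l, TendstoLocallyUniformlyOn (fun i z => f i z l) (fun z => f₀ z l) p U)
    {γ : unitInterval → ℂ} (hγ : Continuous γ) (hγU : ∀ t, γ t ∈ U)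
    {T : ι → unitInterval → NCSeries σ} {T₀ : unitInterval → NCSeries σ}
    (hT : ∀ᶠ i in p, IsTransport (f i) γ (T i)) (hT₀ : IsTransport f₀ γ T₀) :
    Filter.Tendsto (fun i => T i 1) p (𝓝 (T₀ 1)) := by
  set A : Set unitInterval := {t | Filter.Tendsto (fun i => T i t) p (𝓝 (T₀ t))} with hA
  have key : ∀ t, ∃ V ∈ 𝓝 t, ∀ s ∈ V, ∀ s' ∈ V, s ∈ A → s' ∈ A := by
    intro t
    obtain ⟨r, hr, hrU, hr'⟩ := hf (γ t) (hγU t)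
    obtain ⟨δ, hδ, hδ'⟩ := Metric.mem_nhds_iff.1
      (hγ.continuousAt.preimage_mem_nhds (Metric.ball_mem_nhds (γ t) hr))
    set V : Set unitInterval := Subtype.val ⁻¹' Set.Ioo ((t : ℝ) - δ) (t + δ) with hV
    have hVs : V ⊆ γ ⁻¹' Metric.ball (γ t) r := by
      refine Set.Subset.trans (fun s hs => ?_) hδ'
      rw [Metric.mem_ball, Subtype.dist_eq, Real.dist_eq, abs_lt]
      constructor <;> linarith [hs.1, hs.2]
    have hVo : IsOpen V := isOpen_Ioo.preimage continuous_subtype_val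
    have htV : t ∈ V := ⟨by linarith, by linarith⟩
    have hVc : IsPreconnected V :=
      (Set.ordConnected_Ioo.preimage_mono (Subtype.mono_coe _)).isPreconnected
    refine ⟨V, hVo.mem_nhds htV, fun s hs s' hs' hsA => ?_⟩
    have : PreconnectedSpace V := Subtype.preconnectedSpace hVc
    have step : ∀ (g : ℂ → NCSeries σ) (R : unitInterval → NCSeries σ), (∀ z, g z [] = 0) →
        (∀ l, DifferentiableOn ℂ (fun z => g z l) (Metric.ball (γ t) r)) → IsTransport g γ R →
        R s' = R s * ballSol g (γ t) r (γ s) (γ s') := by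
      intro g R g0 hg hR
      obtain ⟨h1, h2⟩ := ballSol_spec g0 hg (γ s)
      have h3 : IsLocSol g (fun u : V => γ u) (fun u : V => R u) :=
        IsLocSol.comp hR.2 continuous_subtype_val
      have h4 : IsLocSol g (fun u : V => γ u)
          (fun u : V => R s * ballSol g (γ t) r (γ s) (γ u)) :=
        (isLocSol_of_isSol Metric.isOpen_ball (fun u : V => hVs u.2) h2).const_mul _
      exact congrFun (h3.unique g0 (by fun_prop) h4 (t₀ := ⟨s, hs⟩) (by simp [h1])) ⟨s', hs'⟩
    have h1 : Filter.Tendsto (fun i => T i s * ballSol (f i) (γ t) r (γ s) (γ s')) p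
        (𝓝 (T₀ s * ballSol f₀ (γ t) r (γ s) (γ s'))) := by
      refine Filter.Tendsto.mul hsA (tendsto_iff.2 fun l => ?_)
      exact (tendstoLocallyUniformlyOn_ballSol (hVs hs) h0 hf₀.nil hr'
        (fun l => (hf₀.diff l).mono hrU) (fun l => (h l).mono hrU) l).tendsto_at (hVs hs')
    rw [← step f₀ T₀ hf₀.nil (fun l => (hf₀.diff l).mono hrU) hT₀] at h1
    refine h1.congr' ?_
    filter_upwards [hT, hr'] with i h2 h3
    exact (step (f i) (T i) (h0 i) h3 h2).symm
  have hcl : IsClopen A := by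
    constructor
    · rw [← isOpen_compl_iff, isOpen_iff_mem_nhds]
      intro t ht
      obtain ⟨V, hV, h1⟩ := key t
      filter_upwards [hV] with s hs hsA
      exact ht (h1 s hs t (mem_of_mem_nhds hV) hsA)
    · rw [isOpen_iff_mem_nhds]
      intro t ht
      obtain ⟨V, hV, h1⟩ := key t
      filter_upwards [hV] with s hs
      exact h1 t (mem_of_mem_nhds hV) s hs ht
  have h00 : (0 : unitInterval) ∈ A := by
    have : ∀ᶠ i in p, T i 0 = T₀ 0 := hT.mono fun i hi => hi.1.trans hT₀.1.symm
    exact tendsto_const_nhds.congr' (this.mono fun i hi => hi.symm)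
  exact Set.eq_univ_iff_forall.1 (hcl.eq_univ ⟨0, h00⟩) 1

end Parameters

/-! ### Holomorphic functions given by series -/

section Series

theorem norm_fderiv_le_of_ball {E : Type*} [NormedAddCommGroup E] [NormedSpace ℂ E] {F : E → ℂ}
    {x : E} {r C : ℝ} (hr : 0 < r) (hF : DifferentiableOn ℂ F (Metric.ball x (2 * r)))
    (hC : ∀ y ∈ Metric.ball x (2 * r), ‖F y‖ ≤ C) {y : E} (hy : y ∈ Metric.ball x r) :
    ‖fderiv ℂ F y‖ ≤ C / r := by
  have hC0 : 0 ≤ C := (norm_nonneg _).trans (hC x (Metric.mem_ball_self (by linarith)))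
  refine ContinuousLinearMap.opNorm_le_bound _ (by positivity) fun v => ?_
  rcases eq_or_ne v 0 with rfl | hv
  · simp
  have hv' : 0 < ‖v‖ := norm_pos_iff.2 hv
  have hmem : ∀ t ∈ Metric.closedBall (0 : ℂ) (r / ‖v‖), y + t • v ∈ Metric.ball x (2 * r) := by
    intro t ht
    rw [mem_closedBall_zero_iff, le_div_iff₀ hv'] at ht
    rw [Metric.mem_ball] at hy ⊢
    calc dist (y + t • v) x ≤ dist (y + t • v) y + dist y x := dist_triangle _ _ _
      _ < r + r := by
        refine add_lt_add_of_le_of_lt ?_ hy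
        rw [dist_eq_norm, add_sub_cancel_left, norm_smul]; exact ht
      _ = 2 * r := by ring
  have hd : DifferentiableOn ℂ (fun t : ℂ => F (y + t • v)) (Metric.closedBall 0 (r / ‖v‖)) := by
    refine hF.comp (f := fun t : ℂ => y + t • v) ?_ hmem
    fun_prop
  have h1 := Complex.norm_deriv_le_of_forall_mem_sphere_norm_le (C := C) (div_pos hr hv')
    (hd.diffContOnCl_ball subset_rfl)
    (fun t ht => hC _ (hmem t (Metric.sphere_subset_closedBall ht)))
  have hy' : DifferentiableAt ℂ F (y + (0 : ℂ) • v) := by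
    rw [zero_smul, add_zero]
    exact hF.differentiableAt (Metric.isOpen_ball.mem_nhds
      (Metric.ball_subset_ball (by linarith) hy))
  have h2 : HasDerivAt (fun t : ℂ => F (y + t • v)) (fderiv ℂ F (y + (0 : ℂ) • v) v) 0 := by
    refine hy'.hasFDerivAt.comp_hasDerivAt 0 ?_
    simpa using ((hasDerivAt_id (0 : ℂ)).smul_const v).const_add y
  rw [h2.deriv, zero_smul, add_zero] at h1
  rwa [div_div_eq_mul_div, mul_div_right_comm] at h1

theorem differentiableOn_tsum_of_locally_bounded {E : Type*} [NormedAddCommGroup E]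
    [NormedSpace ℂ E] {ι : Type*} {F : ι → E → ℂ} {U : Set E} (hU : IsOpen U)
    (hF : ∀ i, DifferentiableOn ℂ (F i) U)
    (hb : ∀ x ∈ U, ∃ V ∈ 𝓝 x, ∃ u : ι → ℝ, Summable u ∧ ∀ i, ∀ y ∈ V, ‖F i y‖ ≤ u i) :
    DifferentiableOn ℂ (fun x => ∑' i, F i x) U := by
  intro x hx
  obtain ⟨V, hV, u, hu, hV'⟩ := hb x hx
  obtain ⟨ε, hε, hεV⟩ := Metric.mem_nhds_iff.1 (Filter.inter_mem hV (hU.mem_nhds hx))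
  set r := ε / 2 with hr
  have hr0 : 0 < r := half_pos hε
  have h2r : 2 * r = ε := by rw [hr]; ring
  rw [← h2r] at hεV
  have hx' : x ∈ Metric.ball x r := Metric.mem_ball_self hr0
  have hsub : Metric.ball x r ⊆ Metric.ball x (2 * r) := Metric.ball_subset_ball (by linarith)
  refine (hasFDerivAt_tsum_of_isPreconnected (u := fun i => u i / r) (hu.div_const r)
    (Metric.isOpen_ball (x := x) (ε := r)) ?_
    (f' := fun i y => fderiv ℂ (F i) y) (fun i y hy => ?_) (fun i y hy => ?_) hx' ?_
    hx').differentiableAt.differentiableWithinAt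
  · exact (@convex_ball E _ (NormedSpace.restrictScalars ℝ ℂ E) x r).isPreconnected
  · exact ((hF i).differentiableAt (hU.mem_nhds (hεV (hsub hy)).2)).hasFDerivAt
  · exact norm_fderiv_le_of_ball hr0 ((hF i).mono fun z hz => (hεV hz).2)
      (fun z hz => hV' i z (hεV hz).1) hy
  · exact Summable.of_norm_bounded hu fun i => hV' i x (hεV (hsub hx')).1

end Series

/-! ### Theta series -/

section ThetaSeries

/-- The exponent `M n(n+1)/2 - a n`. -/
def thetaExp (M a : ℕ) (n : ℤ) : ℕ := (M * (n * (n + 1) / 2) - a * n).toNat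

theorem two_mul_tri (n : ℤ) : 2 * (n * (n + 1) / 2) = n * (n + 1) :=
  Int.mul_ediv_cancel' (Int.even_mul_succ_self n).two_dvd

theorem two_mul_tri_sub (M a : ℕ) (n : ℤ) :
    2 * (M * (n * (n + 1) / 2) - a * n : ℤ) = M * (n * (n + 1)) - 2 * a * n := by
  have := two_mul_tri n
  linear_combination (M : ℤ) * this

theorem natAbs_mul_le {M a : ℕ} (h : a < M) (n : ℤ) :
    |n| * (|n| - 1) ≤ 2 * (M * (n * (n + 1) / 2) - a * n : ℤ) := by
  rw [two_mul_tri_sub]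
  have hM : (1 : ℤ) ≤ M := by exact_mod_cast Nat.one_le_iff_ne_zero.2 (by omega)
  have ha : (a : ℤ) + 1 ≤ M := by exact_mod_cast h
  have ha0 : (0 : ℤ) ≤ a := Int.natCast_nonneg a
  rcases le_or_gt 0 n with hn | hn
  · rw [abs_of_nonneg hn]
    have h1 : 0 ≤ n * (n - 1) := by
      rcases hn.eq_or_lt with rfl | hn
      · simp
      · exact mul_nonneg hn.le (by omega)
    nlinarith [mul_nonneg (sub_nonneg.2 hM) h1, mul_nonneg (sub_nonneg.2 ha) hn]
  · rw [abs_of_neg hn]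
    have h1 : 0 ≤ (-n) * (-n - 1) := mul_nonneg (by omega) (by omega)
    nlinarith [mul_nonneg (sub_nonneg.2 hM) h1, mul_nonneg ha0 (neg_nonneg.2 hn.le)]

theorem coe_thetaExp {M a : ℕ} (h : a < M) (n : ℤ) :
    (thetaExp M a n : ℤ) = M * (n * (n + 1) / 2) - a * n := by
  refine Int.toNat_of_nonneg ?_
  have h1 := natAbs_mul_le h n
  have h2 : 0 ≤ |n| * (|n| - 1) := by
    rcases eq_or_ne n 0 with rfl | hn
    · simp
    · exact mul_nonneg (abs_nonneg n) (sub_nonneg.2 (Int.one_le_abs hn))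
  omega

theorem le_thetaExp {M a : ℕ} (h : a < M) (n : ℤ) :
    n.natAbs * (n.natAbs - 1) / 2 ≤ thetaExp M a n := by
  have h1 := natAbs_mul_le h n
  rw [← coe_thetaExp h n] at h1
  refine Nat.div_le_of_le_mul ?_
  rcases Nat.eq_zero_or_pos n.natAbs with h0 | h0
  · simp [h0]
  zify [h0]
  exact h1

theorem thetaExp_eq_zero {M a : ℕ} (h : a < M) {n : ℤ} :
    thetaExp M a n = 0 ↔ n = 0 ∨ (a = 0 ∧ n = -1) := by
  have h2 := coe_thetaExp h n
  have h3 := two_mul_tri_sub M a n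
  rw [← h2] at h3
  have ha : (a : ℤ) + 1 ≤ M := by exact_mod_cast h
  have ha0 : (0 : ℤ) ≤ a := Int.natCast_nonneg a
  constructor
  · intro h0
    rw [h0] at h3
    by_contra hc
    push Not at hc
    have h4 : n * (M * (n + 1) - 2 * a) = 0 := by linear_combination -h3
    rcases mul_eq_zero.1 h4 with h5 | h5
    · exact hc.1 h5
    · rcases lt_trichotomy n (-1) with h6 | h6 | h6
      · nlinarith
      · subst h6
        exact hc.2 (by omega) rfl
      · rcases lt_trichotomy n 0 with h7 | h7 | h7
        · omega
        · exact hc.1 h7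
        · nlinarith
  · rintro (rfl | ⟨rfl, rfl⟩) <;> simp [thetaExp]

/-- The series `∑ (-1)ⁿ nᵏ p^(M n(n+1)/2 - a n) wⁿ`. -/
def thetaSer (M a k : ℕ) (p w : ℂ) : ℂ :=
  ∑' n : ℤ, (-1 : ℂ) ^ n * (n : ℂ) ^ k * p ^ thetaExp M a n * w ^ n

theorem summable_gauss (k : ℕ) {ρ R : ℝ} (hρ0 : 0 < ρ) (hρ : ρ < 1) (hR : 1 ≤ R) :
    Summable fun n : ℤ => (n.natAbs : ℝ) ^ k * ρ ^ (n.natAbs * (n.natAbs - 1) / 2) *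
      R ^ n.natAbs := by
  have h1 : Summable fun m : ℕ => (k.factorial : ℝ) *
      ((Real.exp 1 * R) ^ m * ρ ^ (m * (m - 1) / 2)) := by
    refine Summable.mul_left _ ?_
    have hR0 : 0 < Real.exp 1 * R := by positivity
    refine summable_of_ratio_test_tendsto_lt_one (l := 0) one_pos (.of_forall fun m => by positivity) ?_
    have h2 : ∀ m : ℕ, ‖(Real.exp 1 * R) ^ (m + 1) * ρ ^ ((m + 1) * (m + 1 - 1) / 2)‖ /
        ‖(Real.exp 1 * R) ^ m * ρ ^ (m * (m - 1) / 2)‖ = Real.exp 1 * R * ρ ^ m := fun m => by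
      have h3 : (m + 1) * (m + 1 - 1) / 2 = m * (m - 1) / 2 + m := by
        rw [Nat.add_sub_cancel, ← Nat.choose_two_right, mul_comm]
        have := Nat.choose_two_right (m + 1)
        rw [Nat.add_sub_cancel, mul_comm] at this
        rw [← this, Nat.choose_succ_succ]; simp [add_comm]
      rw [Real.norm_of_nonneg (by positivity), Real.norm_of_nonneg (by positivity), h3, pow_succ]
      field_simp
      rw [pow_add]
    simp only [h2]
    simpa using (tendsto_pow_atTop_nhds_zero_of_lt_one hρ0.le hρ).const_mul (Real.exp 1 * R)
  have h2 : Summable fun m : ℕ => (m : ℝ) ^ k * ρ ^ (m * (m - 1) / 2) * R ^ m := by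
    refine Summable.of_nonneg_of_le (fun m => by positivity) (fun m => ?_) h1
    have h3 : (m : ℝ) ^ k ≤ k.factorial * Real.exp 1 ^ m := by
      have := Real.pow_div_factorial_le_exp (m : ℝ) (Nat.cast_nonneg m) k
      rw [div_le_iff₀ (by positivity)] at this
      rw [← Real.exp_nat_mul, mul_one, mul_comm]
      exact this
    calc (m : ℝ) ^ k * ρ ^ (m * (m - 1) / 2) * R ^ m
        ≤ (k.factorial * Real.exp 1 ^ m) * ρ ^ (m * (m - 1) / 2) * R ^ m := by gcongr
      _ = _ := by rw [mul_pow]; ring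
  refine Summable.of_nat_of_neg ?_ ?_ <;> simpa using h2

theorem norm_zpow_le {w : ℂ} {R : ℝ} (h1 : R⁻¹ ≤ ‖w‖) (h2 : ‖w‖ ≤ R) (hR : 1 ≤ R) (n : ℤ) :
    ‖w ^ n‖ ≤ R ^ n.natAbs := by
  have hR0 : 0 < R := by linarith
  have hw : 0 < ‖w‖ := (inv_pos.2 hR0).trans_le h1
  obtain ⟨m, rfl | rfl⟩ := n.eq_nat_or_neg
  · simpa using pow_le_pow_left₀ hw.le h2 m
  · simp only [zpow_neg, zpow_natCast, norm_inv, norm_pow, Int.natAbs_neg, Int.natAbs_natCast]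
    rw [← inv_pow]
    exact pow_le_pow_left₀ (by positivity) (inv_le_of_inv_le₀ hR0 h1) m

theorem norm_thetaSer_term_le {M a : ℕ} (h : a < M) (k : ℕ) {p w : ℂ} {ρ R : ℝ} (hp : ‖p‖ ≤ ρ)
    (hρ : ρ < 1) (hR : 1 ≤ R) (h1 : R⁻¹ ≤ ‖w‖) (h2 : ‖w‖ ≤ R) (n : ℤ) :
    ‖(-1 : ℂ) ^ n * (n : ℂ) ^ k * p ^ thetaExp M a n * w ^ n‖ ≤
      (n.natAbs : ℝ) ^ k * ρ ^ (n.natAbs * (n.natAbs - 1) / 2) * R ^ n.natAbs := by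
  have hρ0 : 0 ≤ ρ := (norm_nonneg p).trans hp
  rw [norm_mul, norm_mul, norm_mul, norm_zpow, norm_neg, norm_one, one_zpow, one_mul, norm_pow,
    norm_pow, Complex.norm_intCast, Nat.cast_natAbs, Int.cast_abs]
  gcongr
  · exact (pow_le_pow_left₀ (norm_nonneg p) hp _).trans
      (pow_le_pow_of_le_one hρ0 hρ.le (le_thetaExp h n))
  · exact norm_zpow_le h1 h2 hR n

theorem exists_bounds {p w : ℂ} (hp : ‖p‖ < 1) (hw : w ≠ 0) : ∃ ρ R : ℝ, 0 < ρ ∧ ρ < 1 ∧ 1 ≤ R ∧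
    ‖p‖ < ρ ∧ R⁻¹ < ‖w‖ ∧ ‖w‖ < R := by
  obtain ⟨ρ, h1, h2⟩ := exists_between hp
  have hw' : 0 < ‖w‖ := norm_pos_iff.2 hw
  refine ⟨ρ, 1 + ‖w‖ + ‖w‖⁻¹, (norm_nonneg p).trans_lt h1, h2, ?_, h1, ?_, ?_⟩
  · have : 0 < ‖w‖⁻¹ := inv_pos.2 hw'
    linarith
  · rw [inv_lt_comm₀ (by positivity) hw']; linarith
  · have : 0 < ‖w‖⁻¹ := inv_pos.2 hw'
    linarith

theorem summable_thetaSer {M a : ℕ} (h : a < M) (k : ℕ) {p w : ℂ} (hp : ‖p‖ < 1) (hw : w ≠ 0) :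
    Summable fun n : ℤ => (-1 : ℂ) ^ n * (n : ℂ) ^ k * p ^ thetaExp M a n * w ^ n := by
  obtain ⟨ρ, R, h1, h2, h3, h4, h5, h6⟩ := exists_bounds hp hw
  exact Summable.of_norm_bounded (summable_gauss k h1 h2 h3)
    (norm_thetaSer_term_le h k h4.le h2 h3 h5.le h6.le)

theorem isOpen_thetaDomain : IsOpen {x : ℂ × ℂ | ‖x.1‖ < 1 ∧ x.2 ≠ 0} :=
  (isOpen_lt (continuous_norm.comp continuous_fst) continuous_const).inter
    (isOpen_ne.preimage continuous_snd)

theorem differentiableOn_thetaSer {M a : ℕ} (h : a < M) (k : ℕ) :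
    DifferentiableOn ℂ (fun x : ℂ × ℂ => thetaSer M a k x.1 x.2)
      {x : ℂ × ℂ | ‖x.1‖ < 1 ∧ x.2 ≠ 0} := by
  refine differentiableOn_tsum_of_locally_bounded isOpen_thetaDomain (fun n => ?_) ?_
  · intro x hx
    refine DifferentiableAt.differentiableWithinAt ?_
    refine DifferentiableAt.mul (by fun_prop) ?_
    exact (differentiableAt_zpow.2 (.inl hx.2)).comp x differentiableAt_snd
  · rintro ⟨p, w⟩ ⟨hp, hw⟩
    obtain ⟨ρ, R, h1, h2, h3, h4, h5, h6⟩ := exists_bounds hp hw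
    refine ⟨{x | ‖x.1‖ < ρ ∧ R⁻¹ < ‖x.2‖ ∧ ‖x.2‖ < R}, ?_, _, summable_gauss k h1 h2 h3,
      fun n y hy => norm_thetaSer_term_le h k hy.1.le h2 h3 hy.2.1.le hy.2.2.le n⟩
    refine IsOpen.mem_nhds ?_ ⟨h4, h5, h6⟩
    exact (isOpen_lt (continuous_norm.comp continuous_fst) continuous_const).inter
      ((isOpen_lt continuous_const (continuous_norm.comp continuous_snd)).inter
        (isOpen_lt (continuous_norm.comp continuous_snd) continuous_const))

theorem hasDerivAt_thetaSer_exp {M a : ℕ} (h : a < M) (k : ℕ) {p w : ℂ} (hp : ‖p‖ < 1)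
    (hw : w ≠ 0) (x : ℂ) : HasDerivAt (fun x => thetaSer M a k p (w * Complex.exp x))
      (thetaSer M a (k + 1) p (w * Complex.exp x)) x := by
  have hw' : w * Complex.exp x ≠ 0 := mul_ne_zero hw (Complex.exp_ne_zero x)
  obtain ⟨ρ, R, h1, h2, h3, h4, h5, h6⟩ := exists_bounds hp hw'
  have hc : Continuous fun y : ℂ => ‖w * Complex.exp y‖ := by fun_prop
  have hO : IsOpen {y : ℂ | R⁻¹ < ‖w * Complex.exp y‖ ∧ ‖w * Complex.exp y‖ < R} :=
    (isOpen_lt continuous_const hc).inter (isOpen_lt hc continuous_const)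
  obtain ⟨r, hr, hr'⟩ := Metric.isOpen_iff.1 hO x ⟨h5, h6⟩
  have hx := Metric.mem_ball_self (x := x) hr
  refine hasDerivAt_tsum_of_isPreconnected
    (g := fun (n : ℤ) y => (-1 : ℂ) ^ n * (n : ℂ) ^ k * p ^ thetaExp M a n * (w * Complex.exp y) ^ n)
    (g' := fun (n : ℤ) y =>
      (-1 : ℂ) ^ n * (n : ℂ) ^ (k + 1) * p ^ thetaExp M a n * (w * Complex.exp y) ^ n) (summable_gauss (k + 1) h1 h2 h3) Metric.isOpen_ball
    (convex_ball x r).isPreconnected (fun n y _ => ?_) (fun n y hy => ?_) hx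
    (summable_thetaSer h k hp hw') hx
  · have h7 : ∀ y, (w * Complex.exp y) ^ n = w ^ n * Complex.exp (n * y) := fun y => by
      rw [mul_zpow, Complex.exp_int_mul]
    simp only [h7]
    have h8 : HasDerivAt (fun y : ℂ => Complex.exp (n * y)) (Complex.exp (n * y) * n) y := by
      simpa using ((hasDerivAt_id y).const_mul (n : ℂ)).cexp
    refine ((h8.const_mul (w ^ n)).const_mul
      ((-1 : ℂ) ^ n * (n : ℂ) ^ k * p ^ thetaExp M a n)).congr_deriv ?_
    rw [pow_succ]
    ring
  · exact norm_thetaSer_term_le h (k + 1) h4.le h2 h3 (hr' hy).1.le (hr' hy).2.le n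

theorem thetaSer_zero_of_pos {M a : ℕ} (h : a < M) (ha : a ≠ 0) (k : ℕ) (w : ℂ) :
    thetaSer M a k 0 w = 0 ^ k := by
  rw [thetaSer, tsum_eq_single 0]
  · simp [thetaExp]
  · intro n hn
    rw [zero_pow fun h0 => ?_, mul_zero, zero_mul]
    rcases (thetaExp_eq_zero h).1 h0 with h1 | h1
    · exact hn h1
    · exact ha h1.1

theorem thetaSer_zero {M : ℕ} (h : 0 < M) (k : ℕ) (w : ℂ) :
    thetaSer M 0 k 0 w = 0 ^ k - (-1) ^ k * w⁻¹ := by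
  rw [thetaSer, tsum_eq_sum (s := {0, -1})]
  · rw [Finset.sum_pair (by norm_num)]
    simp [thetaExp]
    ring
  · intro n hn
    rw [zero_pow fun h0 => ?_, mul_zero, zero_mul]
    rcases (thetaExp_eq_zero h).1 h0 with h1 | h1
    · exact hn (by simp [h1])
    · exact hn (by simp [h1.2])

theorem thetaSer_eq_base {M a : ℕ} (h : a < M) {p : ℂ} (hp : p ≠ 0) (w : ℂ) :
    thetaSer M a 0 p w = thetaSer 1 0 0 (p ^ M) (w * (p ^ a)⁻¹) := by
  rw [thetaSer, thetaSer]
  refine tsum_congr fun n => ?_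
  rw [mul_assoc, mul_assoc ((-1 : ℂ) ^ n * _)]
  congr 1
  rw [mul_zpow, ← zpow_natCast p (thetaExp M a n), coe_thetaExp h,
    ← zpow_natCast (p ^ M) (thetaExp 1 0 n), coe_thetaExp one_pos, ← zpow_natCast p M,
    ← zpow_natCast p a, ← zpow_neg, ← zpow_mul, ← zpow_mul, mul_left_comm, ← zpow_add₀ hp, mul_comm]
  congr 2
  push_cast
  ring

end ThetaSeries

/-! ### The Jacobi triple product and the zeros of theta -/

section TripleProduct

/-- The Gaussian binomial coefficient. -/
def qBinom (q : ℂ) : ℕ → ℕ → ℂ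
  | _, 0 => 1
  | 0, _ + 1 => 0
  | m + 1, k + 1 => qBinom q m (k + 1) + q ^ (m - k) * qBinom q m k

/-- The product `∏_{1 ≤ i ≤ n} (1 - qⁱ)`. -/
def qFact (q : ℂ) (n : ℕ) : ℂ := ∏ i ∈ Finset.range n, (1 - q ^ (i + 1))

theorem qFact_succ (q : ℂ) (n : ℕ) : qFact q (n + 1) = qFact q n * (1 - q ^ (n + 1)) :=
  Finset.prod_range_succ _ _

theorem qBinom_zero_right (q : ℂ) (m : ℕ) : qBinom q m 0 = 1 := by cases m <;> rfl

theorem qBinom_eq_zero (q : ℂ) {m k : ℕ} (h : m < k) : qBinom q m k = 0 := by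
  induction m generalizing k with
  | zero => cases k with
    | zero => omega
    | succ k => rfl
  | succ m ih => cases k with
    | zero => omega
    | succ k => rw [qBinom, ih (by omega), ih (by omega)]; simp

theorem qBinom_mul (q : ℂ) {m k : ℕ} (h : k ≤ m) :
    qBinom q m k * (qFact q k * qFact q (m - k)) = qFact q m := by
  induction m generalizing k with
  | zero => obtain rfl : k = 0 := by omega
            simp [qBinom, qFact]
  | succ m ih => cases k with
    | zero => simp [qBinom_zero_right, qFact]
    | succ k =>
      rcases (show k ≤ m by omega).eq_or_lt with rfl | hk
      · have := ih (le_refl k)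
        rw [qBinom, qBinom_eq_zero q (Nat.lt_succ_self k), qFact_succ]
        simp only [Nat.sub_self, pow_zero] at *
        linear_combination (1 - q ^ (k + 1)) * this
      · obtain ⟨d, rfl⟩ : ∃ d, m = k + 1 + d := ⟨m - (k + 1), by omega⟩
        have h1 := ih (k := k + 1) (by omega)
        have h2 := ih (k := k) (by omega)
        rw [show k + 1 + d - (k + 1) = d by omega] at h1
        rw [show k + 1 + d - k = d + 1 by omega] at h2
        rw [qBinom, show k + 1 + d + 1 - (k + 1) = d + 1 by omega,
          show k + 1 + d - k = d + 1 by omega, qFact_succ q (k + 1 + d)]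
        have h3 : q ^ (k + 1 + d + 1) = q ^ (d + 1) * q ^ (k + 1) := by ring
        rw [qFact_succ q d] at h2 ⊢
        rw [h3]
        rw [qFact_succ q k] at h1 ⊢
        linear_combination (1 - q ^ (d + 1)) * h1 + q ^ (d + 1) * (1 - q ^ (k + 1)) * h2

theorem prod_one_sub_mul_pow (q x : ℂ) (m : ℕ) : ∏ i ∈ Finset.range m, (1 - x * q ^ i) =
    ∑ k ∈ Finset.range (m + 1), (-1) ^ k * q ^ (k * (k - 1) / 2) * qBinom q m k * x ^ k := by
  induction m with
  | zero => simp [qBinom]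
  | succ m ih =>
    have htri : ∀ k : ℕ, (k + 1) * (k + 1 - 1) / 2 = k * (k - 1) / 2 + k := fun k => by
      rw [Nat.add_sub_cancel, ← Nat.choose_two_right, mul_comm]
      have := Nat.choose_two_right (k + 1)
      rw [Nat.add_sub_cancel, mul_comm] at this
      rw [← this, Nat.choose_succ_succ]; simp [add_comm]
    rw [Finset.prod_range_succ, ih, Finset.sum_range_succ' _ (m + 1), mul_sub, mul_one]
    have h1 : ∑ k ∈ Finset.range (m + 1), (-1) ^ k * q ^ (k * (k - 1) / 2) * qBinom q m k * x ^ k =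
        ∑ k ∈ Finset.range (m + 1), (-1) ^ (k + 1) * q ^ ((k + 1) * (k + 1 - 1) / 2) *
          qBinom q m (k + 1) * x ^ (k + 1) + 1 := by
      rw [Finset.sum_range_succ', Finset.sum_range_succ _ m, qBinom_eq_zero q (Nat.lt_succ_self m)]
      simp [qBinom_zero_right]
    nth_rw 1 [h1]
    rw [Finset.sum_mul, add_sub_right_comm, ← Finset.sum_sub_distrib]
    congr 1
    · refine Finset.sum_congr rfl fun k hk => ?_
      have hk : k ≤ m := Nat.lt_succ_iff.1 (Finset.mem_range.1 hk)
      have h2 : q ^ m = q ^ (m - k) * q ^ k := by rw [← pow_add]; congr 1; omega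
      rw [qBinom, htri, h2, pow_add]
      ring
    · simp [qBinom_zero_right]

theorem tri_mul_two (k : ℕ) : 2 * ((k * (k - 1) / 2 : ℕ) : ℤ) = k * (k - 1) := by
  have := Nat.div_two_mul_two_of_even (Nat.even_mul_pred_self k)
  rcases Nat.eq_zero_or_pos k with h0 | h0
  · subst h0; simp
  · have h1 : ((k - 1 : ℕ) : ℤ) = k - 1 := by omega
    have h2 : ((k * (k - 1) : ℕ) : ℤ) = k * (k - 1) := by rw [Nat.cast_mul, h1]
    rw [← h2, ← this, Nat.mul_div_cancel _ two_pos]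
    push_cast
    ring

/-- The truncated triple product. -/
theorem prod_mul_prod_eq_sum {q η : ℂ} (hq : q ≠ 0) (hη : η ≠ 0) (n : ℕ) :
    (∏ i ∈ Finset.range n, (1 - q ^ (i + 1) * η)) * ∏ i ∈ Finset.range n, (1 - q ^ i * η⁻¹) =
      ∑ j ∈ Finset.Icc (-n : ℤ) n, (-1) ^ j * q ^ thetaExp 1 0 j *
        qBinom q (2 * n) (j + n).toNat * η ^ j := by
  have h1 := prod_one_sub_mul_pow q (q * (q ^ n)⁻¹ * η) (2 * n)
  rw [two_mul, Finset.prod_range_add] at h1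
  have h2 : ∏ i ∈ Finset.range n, (1 - q * (q ^ n)⁻¹ * η * q ^ (n + i)) =
      ∏ i ∈ Finset.range n, (1 - q ^ (i + 1) * η) := Finset.prod_congr rfl fun i _ => by
    have := pow_ne_zero n hq
    rw [pow_add, pow_succ]; field_simp
  have h3 : ∏ i ∈ Finset.range n, (1 - q * (q ^ n)⁻¹ * η * q ^ i) =
      ∏ i ∈ Finset.range n, ((-(η * (q ^ i)⁻¹)) * (1 - q ^ i * η⁻¹)) := by
    rw [← Finset.prod_range_reflect]
    refine Finset.prod_congr rfl fun i hi => ?_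
    have hi := Finset.mem_range.1 hi
    have h4 : q ^ n = q ^ (n - 1 - i) * q ^ i * q := by
      rw [← pow_add, ← pow_succ]; congr 1; omega
    rw [h4]
    field_simp
    ring
  have h4 : ∏ i ∈ Finset.range n, (-(η * (q ^ i)⁻¹)) =
      (-1) ^ n * η ^ n * (q ^ (n * (n - 1) / 2))⁻¹ := by
    rw [← Finset.sum_range_id_mul_two n, Nat.mul_div_cancel _ two_pos, ← Finset.prod_pow_eq_pow_sum,
      ← Finset.prod_inv_distrib]
    have := Finset.prod_const (s := Finset.range n) (-η)
    rw [Finset.card_range, neg_pow] at this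
    rw [← this, ← Finset.prod_mul_distrib]
    exact Finset.prod_congr rfl fun i _ => by rw [neg_mul]
  rw [h2, h3, Finset.prod_mul_distrib, h4] at h1
  have h5 : (-1 : ℂ) ^ n * η ^ n * (q ^ (n * (n - 1) / 2))⁻¹ ≠ 0 := by
    refine mul_ne_zero (mul_ne_zero (pow_ne_zero _ (by norm_num)) (pow_ne_zero _ hη))
      (inv_ne_zero (pow_ne_zero _ hq))
  refine mul_left_cancel₀ h5 ?_
  rw [mul_comm (∏ i ∈ Finset.range n, (1 - q ^ (i + 1) * η)), ← mul_assoc, h1, Finset.mul_sum]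
  refine Finset.sum_nbij' (fun k => (k : ℤ) - n) (fun j => (j + n).toNat) ?_ ?_ ?_ ?_ ?_
  · intro k hk; simp at hk ⊢; omega
  · intro j hj; simp at hj ⊢; omega
  · intro k hk; simp
  · intro j hj; simp at hj ⊢; omega
  · intro k hk
    obtain ⟨j, hj⟩ : ∃ j : ℤ, (k : ℤ) = n + j := ⟨k - n, by ring⟩
    rw [show (k : ℤ) - n = j by omega, show (j + n).toNat = k by omega, two_mul]
    simp only [← zpow_natCast]
    rw [coe_thetaExp one_pos, hj]
    have e1 := tri_mul_two k
    have e2 := tri_mul_two n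
    have e3 := two_mul_tri j
    rw [hj] at e1
    simp only [Nat.cast_one, Nat.cast_zero]
    generalize ((k * (k - 1) / 2 : ℕ) : ℤ) = A at *
    generalize ((n * (n - 1) / 2 : ℕ) : ℤ) = B at *
    generalize j * (j + 1) / 2 = C at *
    have e4 : A = -B + C + (n - 1) * (n + j) := by linarith
    have e5 : (q * (q ^ (n : ℤ))⁻¹ * η) ^ (n + j : ℤ) = q ^ (-((n - 1) * (n + j) : ℤ)) *
        (η ^ (n : ℤ) * η ^ j) := by
      rw [mul_zpow, zpow_add₀ hη, ← zpow_neg, ← zpow_one_add₀ hq, ← zpow_mul]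
      congr 2
      ring
    rw [e5, e4, zpow_add₀ (by norm_num : (-1 : ℂ) ≠ 0), zpow_add₀ hq, zpow_add₀ hq, zpow_neg,
      zpow_neg, one_mul, zero_mul, sub_zero]
    have := zpow_ne_zero ((n - 1) * (n + j) : ℤ) hq
    field_simp

theorem exists_tendsto_prod {q : ℂ} (hq : ‖q‖ < 1) (x : ℂ) (h : ∀ i : ℕ, 1 - q ^ i * x ≠ 0) :
    ∃ L ≠ 0, Filter.Tendsto (fun n => ∏ i ∈ Finset.range n, (1 - q ^ i * x)) Filter.atTop (𝓝 L) := by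
  have hs : Summable fun i : ℕ => ‖-(q ^ i * x)‖ := by
    simp only [norm_neg, norm_mul, norm_pow]
    exact (summable_geometric_of_lt_one (norm_nonneg q) hq).mul_right _
  simp only [sub_eq_add_neg] at h ⊢
  exact ⟨_, tprod_one_add_ne_zero_of_summable h hs,
    (multipliable_one_add_of_summable hs).tendsto_prod_tprod_nat⟩

theorem one_sub_pow_ne_zero {q : ℂ} (hq : ‖q‖ < 1) (i : ℕ) : 1 - q ^ (i + 1) ≠ 0 := fun h => by
  have h1 : ‖q ^ (i + 1)‖ = 1 := by rw [← sub_eq_zero.1 h, norm_one]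
  rw [norm_pow] at h1
  exact (pow_lt_one₀ (norm_nonneg q) hq (Nat.succ_ne_zero i)).ne h1

theorem qFact_ne_zero {q : ℂ} (hq : ‖q‖ < 1) (n : ℕ) : qFact q n ≠ 0 :=
  Finset.prod_ne_zero_iff.2 fun i _ => one_sub_pow_ne_zero hq i

theorem exists_tendsto_qFact {q : ℂ} (hq : ‖q‖ < 1) :
    ∃ L ≠ 0, Filter.Tendsto (qFact q) Filter.atTop (𝓝 L) := by
  obtain ⟨L, hL, h⟩ := exists_tendsto_prod hq q fun i => by
    rw [← pow_succ]; exact one_sub_pow_ne_zero hq i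
  simp only [← pow_succ] at h
  exact ⟨L, hL, h⟩

theorem qBinom_eq {q : ℂ} (hq : ‖q‖ < 1) {m k : ℕ} (h : k ≤ m) :
    qBinom q m k = qFact q m * ((qFact q k)⁻¹ * (qFact q (m - k))⁻¹) := by
  rw [← mul_inv, ← qBinom_mul q h, mul_assoc, mul_inv_cancel₀, mul_one]
  exact mul_ne_zero (qFact_ne_zero hq _) (qFact_ne_zero hq _)

theorem exists_qBinom_le {q : ℂ} (hq : ‖q‖ < 1) : ∃ K, ∀ m k, ‖qBinom q m k‖ ≤ K := by
  obtain ⟨L, hL, h⟩ := exists_tendsto_qFact hq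
  obtain ⟨A, hA⟩ := (Metric.isBounded_range_of_tendsto _ h).exists_norm_le
  obtain ⟨B, hB⟩ := (Metric.isBounded_range_of_tendsto _ (h.inv₀ hL)).exists_norm_le
  have hA' : ∀ n, ‖qFact q n‖ ≤ A := fun n => hA _ ⟨n, rfl⟩
  have hB' : ∀ n, ‖(qFact q n)⁻¹‖ ≤ B := fun n => hB _ ⟨n, rfl⟩
  have hA0 : 0 ≤ A := (norm_nonneg _).trans (hA' 0)
  have hB0 : 0 ≤ B := (norm_nonneg _).trans (hB' 0)
  refine ⟨A * (B * B), fun m k => ?_⟩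
  rcases le_or_gt k m with hk | hk
  · rw [qBinom_eq hq hk, norm_mul, norm_mul]
    exact mul_le_mul (hA' _) (mul_le_mul (hB' _) (hB' _) (norm_nonneg _) hB0) (by positivity) hA0
  · rw [qBinom_eq_zero q hk, norm_zero]; positivity

theorem tendsto_sum_qBinom {q η L : ℂ} (hq : ‖q‖ < 1) (hη : η ≠ 0) (hL : L ≠ 0)
    (h : Filter.Tendsto (qFact q) Filter.atTop (𝓝 L)) (k : ℕ) :
    Filter.Tendsto (fun n : ℕ => ∑ j ∈ Finset.Icc (-n : ℤ) n, (-1) ^ j * (j : ℂ) ^ k *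
      q ^ thetaExp 1 0 j * qBinom q (2 * n) (j + n).toNat * η ^ j) Filter.atTop
      (𝓝 (thetaSer 1 0 k q η * L⁻¹)) := by
  obtain ⟨K, hK⟩ := exists_qBinom_le hq
  have hK0 : 0 ≤ K := (norm_nonneg _).trans (hK 0 0)
  set F : ℕ → ℤ → ℂ := fun n j => if j ∈ Finset.Icc (-n : ℤ) n then (-1) ^ j * (j : ℂ) ^ k *
      q ^ thetaExp 1 0 j * qBinom q (2 * n) (j + n).toNat * η ^ j else 0 with hF
  have h1 : ∀ n : ℕ, ∑ j ∈ Finset.Icc (-n : ℤ) n, (-1) ^ j * (j : ℂ) ^ k *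
      q ^ thetaExp 1 0 j * qBinom q (2 * n) (j + n).toNat * η ^ j = ∑' j, F n j := fun n => by
    rw [tsum_eq_sum (s := Finset.Icc (-n : ℤ) n) fun j hj => if_neg hj]
    exact Finset.sum_congr rfl fun j hj => (if_pos hj).symm
  simp only [h1]
  rw [thetaSer, ← tsum_mul_right]
  refine tendsto_tsum_of_dominated_convergence
    ((summable_thetaSer one_pos k hq hη).norm.mul_left K) (fun j => ?_)
    (.of_forall fun n j => ?_)
  · have h2 : ∀ᶠ n : ℕ in Filter.atTop, (-1) ^ j * (j : ℂ) ^ k * q ^ thetaExp 1 0 j *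
        (qFact q (2 * n) * ((qFact q (j + n).toNat)⁻¹ * (qFact q (n - j).toNat)⁻¹)) * η ^ j =
        F n j := by
      filter_upwards [Filter.eventually_ge_atTop j.natAbs] with n hn
      rw [hF]
      dsimp only
      rw [if_pos (Finset.mem_Icc.2 (by omega)), qBinom_eq hq (by omega),
        show 2 * n - (j + n).toNat = (n - j).toNat by omega]
    refine Filter.Tendsto.congr' h2 ?_
    have t1 : Filter.Tendsto (fun n : ℕ => 2 * n) Filter.atTop Filter.atTop :=
      Filter.tendsto_atTop_mono (fun n => by rw [id]; omega) Filter.tendsto_id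
    have t2 : Filter.Tendsto (fun n : ℕ => (j + n).toNat) Filter.atTop Filter.atTop :=
      Filter.tendsto_atTop_mono (fun n => by omega) (Filter.tendsto_sub_atTop_nat j.natAbs)
    have t3 : Filter.Tendsto (fun n : ℕ => (n - j).toNat) Filter.atTop Filter.atTop :=
      Filter.tendsto_atTop_mono (fun n => by omega) (Filter.tendsto_sub_atTop_nat j.natAbs)
    have h3 := ((h.comp t1).mul (((h.comp t2).inv₀ hL).mul ((h.comp t3).inv₀ hL))).const_mul
      ((-1 : ℂ) ^ j * (j : ℂ) ^ k * q ^ thetaExp 1 0 j) |>.mul_const (η ^ j)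
    have e : (-1 : ℂ) ^ j * (j : ℂ) ^ k * q ^ thetaExp 1 0 j * (L * (L⁻¹ * L⁻¹)) * η ^ j =
        (-1) ^ j * (j : ℂ) ^ k * q ^ thetaExp 1 0 j * η ^ j * L⁻¹ := by
      rw [mul_inv_cancel_left₀ hL]; ring
    rw [e] at h3
    exact h3
  · rw [hF]
    dsimp only
    split_ifs
    · rw [mul_right_comm, norm_mul _ (qBinom _ _ _), mul_comm]
      exact mul_le_mul_of_nonneg_right (hK _ _) (norm_nonneg _)
    · rw [norm_zero]; positivity

theorem exists_eq_zpow_of_thetaSer_eq_zero {q η : ℂ} (hq0 : q ≠ 0) (hq : ‖q‖ < 1) (hη : η ≠ 0)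
    (h0 : thetaSer 1 0 0 q η = 0) : ∃ k : ℤ, η = q ^ k := by
  by_contra hc
  push Not at hc
  obtain ⟨L, hL, h⟩ := exists_tendsto_qFact hq
  have h1 := tendsto_sum_qBinom hq hη hL h 0
  obtain ⟨A, hA, hA'⟩ := exists_tendsto_prod hq (q * η) fun i hi => hc (-(i + 1 : ℕ)) <| by
    rw [← mul_assoc, ← pow_succ, sub_eq_zero] at hi
    rw [zpow_neg, zpow_natCast]
    exact eq_inv_of_mul_eq_one_right hi.symm
  obtain ⟨B, hB, hB'⟩ := exists_tendsto_prod hq η⁻¹ fun i hi => hc i <| by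
    rw [sub_eq_zero, ← div_eq_mul_inv, eq_div_iff hη, one_mul] at hi
    rw [zpow_natCast, hi]
  have h2 := hA'.mul hB'
  simp only [← mul_assoc, ← pow_succ, prod_mul_prod_eq_sum hq0 hη] at h2
  simp only [pow_zero, mul_one] at h1
  have h3 := tendsto_nhds_unique h1 h2
  rw [h0, zero_mul] at h3
  exact mul_ne_zero hA hB h3.symm

theorem thetaSer_one_ne_zero {q : ℂ} (hq : ‖q‖ < 1) : thetaSer 1 0 1 q 1 ≠ 0 := by
  rcases eq_or_ne q 0 with rfl | hq0
  · rw [thetaSer_zero one_pos]; norm_num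
  obtain ⟨L, hL, h⟩ := exists_tendsto_qFact hq
  have h1 := tendsto_sum_qBinom hq one_ne_zero hL h 1
  have h2 : ∀ n : ℕ, ∑ j ∈ Finset.Icc (-(n + 1 : ℕ) : ℤ) (n + 1 : ℕ), (-1) ^ j * (j : ℂ) ^ 1 *
      q ^ thetaExp 1 0 j * qBinom q (2 * (n + 1)) (j + (n + 1 : ℕ)).toNat * 1 ^ j =
      qFact q (n + 1) * qFact q n := fun n => by
    set P : ℂ → ℂ := fun x => (∏ i ∈ Finset.range (n + 1), (1 - q ^ (i + 1) * Complex.exp x)) *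
      ∏ i ∈ Finset.range n, (1 - q ^ (i + 1) * (Complex.exp x)⁻¹) with hP
    have hPd : DifferentiableAt ℂ P 0 := by
      refine DifferentiableAt.mul ?_ ?_
      · fun_prop
      · refine DifferentiableAt.fun_finsetProd fun i _ => ?_
        exact (((Complex.differentiableAt_exp).inv (Complex.exp_ne_zero _)).const_mul _).const_sub _
    have d1 : HasDerivAt (fun x => (1 - (Complex.exp x)⁻¹) * P x) (1 * P 0 + (1 - (Complex.exp 0)⁻¹) * deriv P 0) 0 := by
      refine HasDerivAt.mul ?_ hPd.hasDerivAt
      simpa using ((Complex.hasDerivAt_exp (0 : ℂ)).inv (Complex.exp_ne_zero _)).const_sub 1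
    have e1 : (fun x => (1 - (Complex.exp x)⁻¹) * P x) = fun x =>
        ∑ j ∈ Finset.Icc (-(n + 1 : ℕ) : ℤ) (n + 1 : ℕ), (-1) ^ j *
        q ^ thetaExp 1 0 j * qBinom q (2 * (n + 1)) (j + (n + 1 : ℕ)).toNat * Complex.exp (j * x) := by
      ext x
      simp only [Complex.exp_int_mul]
      rw [← prod_mul_prod_eq_sum hq0 (Complex.exp_ne_zero x) (n + 1),
        Finset.prod_range_succ' (fun i => 1 - q ^ i * (Complex.exp x)⁻¹)]
      simp only [hP, pow_zero, one_mul]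
      ring
    rw [e1] at d1
    have d2 : HasDerivAt (fun x => ∑ j ∈ Finset.Icc (-(n + 1 : ℕ) : ℤ) (n + 1 : ℕ), (-1) ^ j *
        q ^ thetaExp 1 0 j * qBinom q (2 * (n + 1)) (j + (n + 1 : ℕ)).toNat * Complex.exp (j * x))
        (∑ j ∈ Finset.Icc (-(n + 1 : ℕ) : ℤ) (n + 1 : ℕ), (-1) ^ j *
        q ^ thetaExp 1 0 j * qBinom q (2 * (n + 1)) (j + (n + 1 : ℕ)).toNat * j) 0 := by
      refine HasDerivAt.fun_sum fun j _ => HasDerivAt.const_mul _ ?_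
      simpa using ((hasDerivAt_id (0 : ℂ)).const_mul (j : ℂ)).cexp
    have e2 := d1.unique d2
    simp only [one_zpow, pow_one, mul_one]
    refine Eq.trans (Finset.sum_congr rfl fun j _ => by ring) (e2.symm.trans ?_)
    simp [hP, qFact]
  have h3 := (h1.comp (Filter.tendsto_add_atTop_nat 1)).congr h2
  have h4 := tendsto_nhds_unique h3 ((h.comp (Filter.tendsto_add_atTop_nat 1)).mul h)
  intro h0
  rw [h0, zero_mul] at h4
  exact mul_ne_zero hL hL h4.symm

end TripleProduct

/-! ### Taylor series -/

section Jet

/-- The Taylor series at `0` of an analytic function. -/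
def jet (f : ℂ → ℂ) : PowerSeries ℂ := PowerSeries.mk fun n =>
  iteratedDeriv n f 0 / (n.factorial : ℂ)

theorem coeff_jet (f : ℂ → ℂ) (n : ℕ) :
    PowerSeries.coeff n (jet f) = iteratedDeriv n f 0 / (n.factorial : ℂ) := PowerSeries.coeff_mk _ _

theorem jet_congr {f g : ℂ → ℂ} (h : f =ᶠ[𝓝 0] g) : jet f = jet g := by
  ext n
  rw [coeff_jet, coeff_jet, h.iteratedDeriv_eq]

theorem constantCoeff_jet (f : ℂ → ℂ) : PowerSeries.constantCoeff (jet f) = f 0 := by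
  rw [← PowerSeries.coeff_zero_eq_constantCoeff_apply, coeff_jet]
  simp

theorem jet_mul {f g : ℂ → ℂ} (hf : AnalyticAt ℂ f 0) (hg : AnalyticAt ℂ g 0) :
    jet (f * g) = jet f * jet g := by
  ext n
  rw [coeff_jet, iteratedDeriv_mul hf.contDiffAt hg.contDiffAt, PowerSeries.coeff_mul,
    Finset.Nat.sum_antidiagonal_eq_sum_range_succ_mk, Finset.sum_div]
  refine Finset.sum_congr rfl fun i hi => ?_
  have hi : i ≤ n := Nat.lt_succ_iff.1 (Finset.mem_range.1 hi)
  rw [coeff_jet, coeff_jet, Nat.cast_choose ℂ hi]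
  have h1 : (n.factorial : ℂ) ≠ 0 := Nat.cast_ne_zero.2 n.factorial_ne_zero
  have h2 : (i.factorial : ℂ) ≠ 0 := Nat.cast_ne_zero.2 i.factorial_ne_zero
  have h3 : ((n - i).factorial : ℂ) ≠ 0 := Nat.cast_ne_zero.2 (n - i).factorial_ne_zero
  field_simp

theorem jet_const (c : ℂ) : jet (fun _ => c) = PowerSeries.C c := by
  ext n
  rw [coeff_jet, iteratedDeriv_const, PowerSeries.coeff_C]
  cases n <;> simp

theorem jet_id : jet (fun x => x) = PowerSeries.X := by
  ext n
  rw [coeff_jet, PowerSeries.coeff_X]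
  rcases n with _ | _ | n
  · simp
  · simp
  · rw [iteratedDeriv_succ', iteratedDeriv_succ']
    have : deriv (deriv fun x : ℂ => x) = fun _ => 0 := by ext x; simp
    rw [this, iteratedDeriv_const]
    simp

theorem jet_cexp (a : ℂ) : jet (fun x => Complex.exp (a * x)) = expSeries a := by
  ext n
  rw [coeff_jet, iteratedDeriv_cexp_const_mul, expSeries, PowerSeries.coeff_rescale]
  simp [div_eq_mul_inv]

theorem jet_inv {f : ℂ → ℂ} (hf : AnalyticAt ℂ f 0) (h0 : f 0 ≠ 0) : jet f⁻¹ = (jet f)⁻¹ := by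
  rw [PowerSeries.eq_inv_iff_mul_eq_one (by rwa [constantCoeff_jet]),
    ← jet_mul (hf.inv h0) hf, ← map_one PowerSeries.C, ← jet_const]
  refine jet_congr ?_
  filter_upwards [hf.continuousAt.eventually_ne h0] with x hx
  exact inv_mul_cancel₀ hx

theorem analyticAt_iteratedDeriv {f : ℂ → ℂ} {x : ℂ} (hf : AnalyticAt ℂ f x) (n : ℕ) :
    AnalyticAt ℂ (iteratedDeriv n f) x := by
  rw [iteratedDeriv_eq_iterate]
  exact hf.iterated_deriv n

theorem jet_comp_mul {f : ℂ → ℂ} (hf : AnalyticAt ℂ f 0) (c : ℂ) :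
    jet (fun x => f (c * x)) = PowerSeries.rescale c (jet f) := by
  have h : ∀ n, ∀ᶠ x in 𝓝 (0 : ℂ), iteratedDeriv n (fun x => f (c * x)) x =
      c ^ n * iteratedDeriv n f (c * x) := by
    intro n
    have ht : Filter.Tendsto (fun x : ℂ => c * x) (𝓝 0) (𝓝 0) := by
      have : Continuous fun x : ℂ => c * x := by fun_prop
      simpa using this.tendsto 0
    induction n with
    | zero => simp
    | succ n ih =>
      have h1 := ih.eventually_nhds
      filter_upwards [h1, ht.eventually hf.eventually_analyticAt] with x hx hx'
      rw [iteratedDeriv_succ, Filter.EventuallyEq.deriv_eq hx, iteratedDeriv_succ]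
      have h2 : HasDerivAt (iteratedDeriv n f) (deriv (iteratedDeriv n f) (c * x)) (c * x) :=
        (analyticAt_iteratedDeriv hx' n).differentiableAt.hasDerivAt
      have h3 : HasDerivAt (fun x => c * x) (c * 1) x := (hasDerivAt_id x).const_mul c
      refine ((HasDerivAt.comp (h₂ := iteratedDeriv n f) x h2 h3).const_mul (c ^ n)).deriv.trans ?_
      ring
  ext n
  rw [coeff_jet, (h n).self_of_nhds, PowerSeries.coeff_rescale, coeff_jet, mul_zero, mul_div_assoc]

theorem analyticAt_dslope {f : ℂ → ℂ} (hf : AnalyticAt ℂ f 0) : AnalyticAt ℂ (dslope f 0) 0 :=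
  (hf.choose_spec.has_fpower_series_dslope_fslope).analyticAt

theorem jet_dslope {f : ℂ → ℂ} (hf : AnalyticAt ℂ f 0) : jet (dslope f 0) = tail (jet f) := by
  have h : jet f = PowerSeries.C (f 0) + PowerSeries.X * jet (dslope f 0) := by
    rw [← jet_id, ← jet_const]
    change _ = jet _ + jet id * _
    rw [← jet_mul analyticAt_id (analyticAt_dslope hf)]
    ext n
    rw [map_add, coeff_jet, coeff_jet, coeff_jet, ← add_div, ← iteratedDeriv_add]
    · congr 2
      ext x
      have := sub_smul_dslope f 0 x
      simp only [sub_zero, smul_eq_mul] at this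
      simp [this]
    · exact contDiffAt_const
    · exact (analyticAt_id.mul (analyticAt_dslope hf)).contDiffAt
  rw [h, tail_C_add_X_mul]

theorem taylorSeries_eq {f φ : ℂ → ℂ} {a : ℂ} (hφ : AnalyticAt ℂ φ 0)
    (h : ∀ᶠ x in 𝓝[≠] (0 : ℂ), f x = a * φ x / x - a * φ 0 / x) :
    taylorSeries f = a • tail (jet φ) := by
  have h1 : f =ᶠ[𝓝[≠] 0] fun x => a * dslope φ 0 x := by
    filter_upwards [h, self_mem_nhdsWithin] with x hx hx0
    rw [hx, dslope_of_ne _ hx0, slope_def_field]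
    have hx0 : x ≠ 0 := hx0
    field_simp
    ring
  have hd := (analyticAt_dslope hφ)
  have h2 : Filter.Tendsto f (𝓝[≠] 0) (𝓝 (a * dslope φ 0 0)) :=
    ((hd.continuousAt.tendsto.mono_left nhdsWithin_le_nhds).const_mul a).congr' h1.symm
  have h3 : Function.update f 0 (Filter.limUnder (𝓝[≠] (0 : ℂ)) f) =ᶠ[𝓝 0]
      fun x => a * dslope φ 0 x := by
    rw [h2.limUnder_eq]
    filter_upwards [eventually_nhdsWithin_iff.1 h1] with x hx
    rcases eq_or_ne x 0 with rfl | hx0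
    · simp
    · rw [Function.update_of_ne hx0, hx hx0]
  change jet (Function.update f 0 (Filter.limUnder (𝓝[≠] (0 : ℂ)) f)) = _
  rw [jet_congr h3, ← jet_dslope hφ]
  have h4 := jet_mul (f := fun _ => a) analyticAt_const hd
  rw [jet_const, ← PowerSeries.smul_eq_C_mul] at h4
  exact h4

end Jet

/-! ### Expansion of the Jacobi form -/

section Expansion

open Complex
open scoped UpperHalfPlane

/-- The Taylor series of `x ↦ ∑ (-1)ⁿ p^(M n(n+1)/2 - a n) (w eˣ)ⁿ`. -/
def thetaJet (M a : ℕ) (p w : ℂ) : PowerSeries ℂ :=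
  PowerSeries.mk fun k => thetaSer M a k p w / (k.factorial : ℂ)

theorem analyticAt_thetaSer_exp {M a : ℕ} (h : a < M) (k : ℕ) {p w : ℂ} (hp : ‖p‖ < 1)
    (hw : w ≠ 0) (x : ℂ) : AnalyticAt ℂ (fun x => thetaSer M a k p (w * cexp x)) x :=
  Complex.analyticAt_iff_eventually_differentiableAt.2
    (.of_forall fun y => (hasDerivAt_thetaSer_exp h k hp hw y).differentiableAt)

theorem iteratedDeriv_thetaSer_exp {M a : ℕ} (h : a < M) {p w : ℂ} (hp : ‖p‖ < 1) (hw : w ≠ 0)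
    (n : ℕ) : iteratedDeriv n (fun x => thetaSer M a 0 p (w * cexp x)) =
      fun x => thetaSer M a n p (w * cexp x) := by
  induction n with
  | zero => simp
  | succ n ih =>
    rw [iteratedDeriv_succ, ih]
    exact funext fun x => (hasDerivAt_thetaSer_exp h n hp hw x).deriv

theorem jet_thetaSer_exp {M a : ℕ} (h : a < M) {p w : ℂ} (hp : ‖p‖ < 1) (hw : w ≠ 0) :
    jet (fun x => thetaSer M a 0 p (w * cexp x)) = thetaJet M a p w := by
  ext n
  rw [coeff_jet, iteratedDeriv_thetaSer_exp h hp hw, thetaJet, PowerSeries.coeff_mk]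
  simp

theorem thetaSer_at_one (q : ℂ) : thetaSer 1 0 0 q 1 = 0 := by
  have h : thetaSer 1 0 0 q 1 = -thetaSer 1 0 0 q 1 := by
    unfold thetaSer
    rw [← tsum_neg]
    refine ((Equiv.subLeft (-1 : ℤ)).tsum_eq _).symm.trans ?_
    refine tsum_congr fun n => ?_
    have e : thetaExp 1 0 (-1 - n) = thetaExp 1 0 n := by
      rw [thetaExp, thetaExp]
      congr 1
      rw [show (-1 - n) * (-1 - n + 1) = n * (n + 1) by ring]
      simp
    rw [Equiv.subLeft_apply, e, zpow_sub₀ (by norm_num), zpow_neg_one]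
    have : ((-1 : ℂ) ^ n)⁻¹ = (-1) ^ n := by rw [← inv_zpow]; norm_num
    rw [div_eq_mul_inv, this]
    simp
  linear_combination h / 2

theorem theta_eq (v : ℂ) (τ : ℍ) : theta v τ =
    cexp (Real.pi * I * τ / 4 + v / 2) * thetaSer 1 0 0 (cexp (2 * Real.pi * I * τ)) (cexp v) := by
  rw [theta, thetaSer, ← tsum_mul_left]
  refine tsum_congr fun n => ?_
  rw [pow_zero, mul_one, ← Complex.exp_nat_mul, ← Complex.exp_int_mul, mul_assoc, mul_assoc,
    mul_assoc ((-1 : ℂ) ^ n), mul_left_comm (cexp (Real.pi * I * τ / 4 + v / 2)), ← Complex.exp_add, ← Complex.exp_add, ← Complex.exp_add]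
  congr 2
  have h : (2 : ℂ) * (thetaExp 1 0 n : ℂ) = n * (n + 1) := by
    have h1 := coe_thetaExp one_pos (a := 0) (M := 1) n
    have h2 := two_mul_tri n
    have h3 : 2 * (thetaExp 1 0 n : ℤ) = n * (n + 1) := by rw [h1]; simpa using h2
    exact_mod_cast h3
  linear_combination -(Real.pi * I * τ) * h

/-- The Taylor series of the function `x exp(-yx) F(x, u, τ) / 2πi`, where `pᴹ = exp(2πiτ)` and
`exp(2πiu) = w p⁻ᵃ`. -/
def jacobiJet (M a : ℕ) (y p w : ℂ) : PowerSeries ℂ :=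
  expSeries (-y) * (PowerSeries.C (thetaSer 1 0 1 (p ^ M) 1) * (tail (thetaJet 1 0 (p ^ M) 1))⁻¹ *
    thetaJet M a p w * PowerSeries.C (thetaSer M a 0 p w)⁻¹)

theorem exists_jacobiJet {M a : ℕ} (h : a < M) (y : ℂ) {p w u : ℂ} {τ : ℍ} (hp0 : p ≠ 0)
    (hp : ‖p‖ < 1) (hpτ : p ^ M = cexp (2 * Real.pi * I * τ))
    (hu : cexp (2 * Real.pi * I * u) = w * (p ^ a)⁻¹) (hA : thetaSer M a 0 p w ≠ 0) :
    ∃ φ : ℂ → ℂ, AnalyticAt ℂ φ 0 ∧ φ 0 = 1 ∧ jet φ = jacobiJet M a y p w ∧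
      ∀ᶠ x in 𝓝[≠] (0 : ℂ), cexp (-(y * x)) * jacobiF x u τ = 2 * Real.pi * I * φ x / x := by
  set q := p ^ M with hq
  have hM : M ≠ 0 := by omega
  have hq1 : ‖q‖ < 1 := by rw [hq, norm_pow]; exact pow_lt_one₀ (norm_nonneg p) hp hM
  have hw : w ≠ 0 := by
    rintro rfl
    rw [zero_mul] at hu
    exact Complex.exp_ne_zero _ hu
  set θ : ℂ → ℂ := fun x => thetaSer 1 0 0 q (1 * cexp x) with hθ
  set b : ℂ → ℂ := fun x => thetaSer M a 0 p (w * cexp x) with hb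
  set A₁ := thetaSer 1 0 1 q 1 with hA₁
  have hθa : AnalyticAt ℂ θ 0 := analyticAt_thetaSer_exp one_pos 0 hq1 one_ne_zero 0
  have hba : AnalyticAt ℂ b 0 := analyticAt_thetaSer_exp h 0 hp hw 0
  have hθ0 : θ 0 = 0 := by simp [hθ, thetaSer_at_one]
  have hb0 : b 0 = thetaSer M a 0 p w := by simp [hb]
  have hθd : HasDerivAt θ A₁ 0 := by
    have := hasDerivAt_thetaSer_exp one_pos 0 hq1 one_ne_zero (a := 0) (M := 1) 0
    rwa [Complex.exp_zero, one_mul] at this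
  have hda := analyticAt_dslope hθa
  have hd0 : dslope θ 0 0 = A₁ := by rw [dslope_same, hθd.deriv]
  have hd0' : dslope θ 0 0 ≠ 0 := by rw [hd0]; exact thetaSer_one_ne_zero hq1
  have hexp : AnalyticAt ℂ (fun x => cexp (-y * x)) 0 := by fun_prop
  have a1 := (analyticAt_const (v := A₁) (x := (0 : ℂ)) (𝕜 := ℂ)).mul (hda.inv hd0')
  have a2 := (a1.mul hba).mul (analyticAt_const (v := (b 0)⁻¹) (x := (0 : ℂ)) (𝕜 := ℂ))
  refine ⟨(fun x => cexp (-y * x)) * ((fun _ => A₁) * (dslope θ 0)⁻¹ * b * fun _ => (b 0)⁻¹),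
    hexp.mul a2, ?_, ?_, ?_⟩
  · simp only [Pi.mul_apply, Pi.inv_apply, hd0]
    rw [mul_inv_cancel₀ (thetaSer_one_ne_zero hq1), hb0, one_mul, mul_inv_cancel₀ hA]
    simp
  · rw [jet_mul hexp a2, jet_mul (a1.mul hba) analyticAt_const, jet_mul a1 hba,
      jet_mul analyticAt_const (hda.inv hd0'), jet_cexp, jet_const, jet_const,
      jet_inv hda hd0', jet_dslope hθa, jet_thetaSer_exp one_pos hq1 one_ne_zero,
      jet_thetaSer_exp h hp hw, hb0, jacobiJet]
  · have hth : ∀ v, theta v τ = cexp (Real.pi * I * τ / 4 + v / 2) * θ v := fun v => by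
      rw [theta_eq, hθ, hpτ]
      simp only [one_mul]
    have hder : deriv (fun s => theta s τ) 0 = cexp (Real.pi * I * τ / 4) * A₁ := by
      have e1 : HasDerivAt (fun v : ℂ => cexp (Real.pi * I * τ / 4 + v / 2))
          (cexp (Real.pi * I * τ / 4 + 0 / 2) * (1 / 2)) 0 :=
        (((hasDerivAt_id (0 : ℂ)).div_const 2).const_add _).cexp
      have e2 := e1.mul hθd
      simp only [hth]
      refine e2.deriv.trans ?_
      rw [hθ0]
      simp
    have hbx : ∀ x, θ (x + 2 * Real.pi * I * u) = b x := fun x => by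
      rw [hθ, hb]
      dsimp only
      rw [thetaSer_eq_base h hp0, one_mul, Complex.exp_add, hu]
      congr 1
      ring
    have hbv : θ (2 * Real.pi * I * u) = b 0 := by rw [← hbx 0, zero_add]
    filter_upwards [(hda.continuousAt.eventually_ne hd0').filter_mono nhdsWithin_le_nhds,
      self_mem_nhdsWithin] with x hx hx0
    have hx0 : x ≠ 0 := hx0
    have hθx : θ x = x * dslope θ 0 x := by
      have := sub_smul_dslope θ 0 x
      rw [hθ0, sub_zero, sub_zero, smul_eq_mul] at this
      exact this.symm
    rw [jacobiF, zagierF, hder, hth, hth x, hth (2 * Real.pi * I * u), hbx, hbv, hθx]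
    simp only [Pi.mul_apply, Pi.inv_apply]
    have hb0' : b 0 ≠ 0 := by rwa [hb0]
    have e3 : cexp (Real.pi * I * τ / 4 + (x + 2 * Real.pi * I * u) / 2) *
        cexp (Real.pi * I * τ / 4) = cexp (Real.pi * I * τ / 4 + x / 2) *
        cexp (Real.pi * I * τ / 4 + 2 * Real.pi * I * u / 2) := by
      rw [← Complex.exp_add, ← Complex.exp_add]
      congr 1
      ring
    have n1 := Complex.exp_ne_zero (Real.pi * I * τ / 4 + x / 2)
    have n2 := Complex.exp_ne_zero (Real.pi * I * τ / 4 + 2 * Real.pi * I * u / 2)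
    rw [neg_mul]
    generalize cexp (Real.pi * I * τ / 4 + (x + 2 * Real.pi * I * u) / 2) = E1 at *
    generalize cexp (Real.pi * I * τ / 4 + x / 2) = E2 at *
    generalize cexp (Real.pi * I * τ / 4 + 2 * Real.pi * I * u / 2) = E3 at *
    field_simp
    linear_combination A₁ * b x * e3

end Expansion

/-! ### Holomorphic families of power series -/

section Holomorphic

variable {E : Type*} [NormedAddCommGroup E] [NormedSpace ℂ E] {U : Set E}

/-- A family of power series with holomorphic coefficients. -/
def HolSeriesOn (P : E → PowerSeries ℂ) (U : Set E) : Prop :=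
  ∀ n, DifferentiableOn ℂ (fun x => PowerSeries.coeff n (P x)) U

theorem holSeriesOn_const (p : PowerSeries ℂ) : HolSeriesOn (fun _ : E => p) U :=
  fun _ => differentiableOn_const _

theorem holSeriesOn_C {f : E → ℂ} (hf : DifferentiableOn ℂ f U) :
    HolSeriesOn (fun x => PowerSeries.C (f x)) U := fun n => by
  simp only [PowerSeries.coeff_C]
  split_ifs
  · exact hf
  · exact differentiableOn_const _

theorem HolSeriesOn.mul {P Q : E → PowerSeries ℂ} (hP : HolSeriesOn P U) (hQ : HolSeriesOn Q U) :
    HolSeriesOn (fun x => P x * Q x) U := fun n => by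
  simp only [PowerSeries.coeff_mul]
  exact DifferentiableOn.fun_sum fun i _ => (hP _).mul (hQ _)

theorem HolSeriesOn.tail {P : E → PowerSeries ℂ} (hP : HolSeriesOn P U) :
    HolSeriesOn (fun x => tail (P x)) U := fun n => by
  simpa only [KZB.tail, PowerSeries.coeff_mk] using hP (n + 1)

theorem HolSeriesOn.smul {P : E → PowerSeries ℂ} (hP : HolSeriesOn P U) (c : ℂ) :
    HolSeriesOn (fun x => c • P x) U := fun n => by
  simpa using (hP n).const_mul c

theorem HolSeriesOn.derivative {P : E → PowerSeries ℂ} (hP : HolSeriesOn P U) :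
    HolSeriesOn (fun x => PowerSeries.derivative ℂ (P x)) U := fun n => by
  simp only [PowerSeries.coeff_derivative]
  exact (hP (n + 1)).mul_const _

theorem HolSeriesOn.inv {P : E → PowerSeries ℂ} (hP : HolSeriesOn P U)
    (h0 : ∀ x ∈ U, PowerSeries.constantCoeff (P x) ≠ 0) : HolSeriesOn (fun x => (P x)⁻¹) U := by
  intro n
  induction n using Nat.strong_induction_on with
  | _ n ih =>
  have hc : DifferentiableOn ℂ (fun x => (PowerSeries.constantCoeff (P x))⁻¹) U := by
    have := hP 0
    simp only [PowerSeries.coeff_zero_eq_constantCoeff_apply] at this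
    exact this.inv h0
  rw [show (fun x => PowerSeries.coeff n (P x)⁻¹) = _ from
    funext fun x => PowerSeries.coeff_inv n (P x)]
  split_ifs
  · exact hc
  · refine hc.neg.mul (DifferentiableOn.fun_sum fun i _ => ?_)
    split_ifs with h
    · exact (hP _).mul (ih _ h)
    · exact differentiableOn_const _

theorem HolSeriesOn.comp {F : Type*} [NormedAddCommGroup F] [NormedSpace ℂ F] {V : Set F}
    {P : E → PowerSeries ℂ} (hP : HolSeriesOn P U) {g : F → E} (hg : DifferentiableOn ℂ g V)
    (h : Set.MapsTo g V U) : HolSeriesOn (fun x => P (g x)) V := fun n => (hP n).comp hg h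

theorem HolSeriesOn.mono {P : E → PowerSeries ℂ} (hP : HolSeriesOn P U) {V : Set E} (h : V ⊆ U) :
    HolSeriesOn P V := fun n => (hP n).mono h

end Holomorphic

section JacobiJet

theorem holSeriesOn_thetaJet {M a : ℕ} (h : a < M) :
    HolSeriesOn (fun x : ℂ × ℂ => thetaJet M a x.1 x.2) {x : ℂ × ℂ | ‖x.1‖ < 1 ∧ x.2 ≠ 0} :=
  fun n => by
    simp only [thetaJet, PowerSeries.coeff_mk]
    simpa only [div_eq_mul_inv] using (differentiableOn_thetaSer h n).mul_const _

theorem constantCoeff_thetaJet (M a : ℕ) (p w : ℂ) :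
    PowerSeries.constantCoeff (thetaJet M a p w) = thetaSer M a 0 p w := by
  rw [← PowerSeries.coeff_zero_eq_constantCoeff_apply, thetaJet, PowerSeries.coeff_mk]
  simp

theorem constantCoeff_tail_thetaJet (M a : ℕ) (p w : ℂ) :
    PowerSeries.constantCoeff (tail (thetaJet M a p w)) = thetaSer M a 1 p w := by
  rw [← PowerSeries.coeff_zero_eq_constantCoeff_apply, tail, PowerSeries.coeff_mk, thetaJet,
    PowerSeries.coeff_mk]
  simp

theorem norm_pow_lt_one {M : ℕ} (hM : M ≠ 0) {p : ℂ} (hp : ‖p‖ < 1) : ‖p ^ M‖ < 1 := by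
  rw [norm_pow]; exact pow_lt_one₀ (norm_nonneg p) hp hM

theorem constantCoeff_jacobiJet {M a : ℕ} (h : a < M) (y : ℂ) {p w : ℂ} (hp : ‖p‖ < 1)
    (hA : thetaSer M a 0 p w ≠ 0) : PowerSeries.constantCoeff (jacobiJet M a y p w) = 1 := by
  have h1 := thetaSer_one_ne_zero (norm_pow_lt_one (show M ≠ 0 by omega) hp)
  simp only [jacobiJet, map_mul, PowerSeries.constantCoeff_inv, constantCoeff_tail_thetaJet,
    constantCoeff_thetaJet, PowerSeries.constantCoeff_C, constantCoeff_expSeries]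
  rw [mul_inv_cancel₀ h1, one_mul, one_mul, mul_inv_cancel₀ hA]

theorem holSeriesOn_baseJet {M : ℕ} (hM : M ≠ 0) :
    HolSeriesOn (fun p : ℂ => thetaJet 1 0 (p ^ M) 1) {p : ℂ | ‖p‖ < 1} := by
  refine (holSeriesOn_thetaJet one_pos).comp (g := fun p : ℂ => (p ^ M, (1 : ℂ)))
    (DifferentiableOn.prodMk (by fun_prop) (differentiableOn_const _)) fun p hp =>
      ⟨norm_pow_lt_one hM hp, one_ne_zero⟩

theorem holSeriesOn_baseJet_tail_inv {M : ℕ} (hM : M ≠ 0) :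
    HolSeriesOn (fun p : ℂ => (tail (thetaJet 1 0 (p ^ M) 1))⁻¹) {p : ℂ | ‖p‖ < 1} :=
  (holSeriesOn_baseJet hM).tail.inv fun p hp => by
    rw [constantCoeff_tail_thetaJet]; exact thetaSer_one_ne_zero (norm_pow_lt_one hM hp)

theorem holSeriesOn_jacobiJet {M a : ℕ} (h : a < M) (y : ℂ) :
    HolSeriesOn (fun x : ℂ × ℂ => jacobiJet M a y x.1 x.2)
      {x : ℂ × ℂ | ‖x.1‖ < 1 ∧ x.2 ≠ 0 ∧ thetaSer M a 0 x.1 x.2 ≠ 0} := by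
  have hM : M ≠ 0 := by omega
  have hfst : Set.MapsTo (Prod.fst : ℂ × ℂ → ℂ)
    {x : ℂ × ℂ | ‖x.1‖ < 1 ∧ x.2 ≠ 0 ∧ thetaSer M a 0 x.1 x.2 ≠ 0} {p : ℂ | ‖p‖ < 1} :=
    fun x hx => hx.1
  refine (holSeriesOn_const _).mul (((HolSeriesOn.mul ?_ ?_).mul ?_).mul ?_)
  · refine holSeriesOn_C ?_
    exact (differentiableOn_thetaSer one_pos 1).comp (f := fun x : ℂ × ℂ => (x.1 ^ M, (1 : ℂ)))
      (DifferentiableOn.prodMk (by fun_prop) (differentiableOn_const _)) fun p hp =>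
      ⟨norm_pow_lt_one hM hp.1, one_ne_zero⟩
  · exact (holSeriesOn_baseJet_tail_inv hM).comp (g := Prod.fst) differentiableOn_fst hfst
  · exact (holSeriesOn_thetaJet h).mono fun x hx => ⟨hx.1, hx.2.1⟩
  · exact holSeriesOn_C (((differentiableOn_thetaSer h 0).mono fun x hx => ⟨hx.1, hx.2.1⟩).inv
      fun x hx => hx.2.2)

theorem thetaSer_ne_zero {M a : ℕ} (h : a < M) {p w : ℂ} (h1 : ‖p‖ < ‖w‖) (h2 : ‖p‖ * ‖w‖ < 1)
    (h3 : a = 0 → w ≠ 1) : thetaSer M a 0 p w ≠ 0 := by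
  have hw0 : 0 < ‖w‖ := (norm_nonneg p).trans_lt h1
  have hw : w ≠ 0 := norm_pos_iff.1 hw0
  rcases eq_or_ne p 0 with rfl | hp
  · rcases eq_or_ne a 0 with rfl | ha
    · rw [thetaSer_zero h]
      intro h0
      refine h3 rfl (inv_eq_one.1 ?_)
      linear_combination -h0
    · rw [thetaSer_zero_of_pos h ha]; simp
  · intro h0
    have hp0 : 0 < ‖p‖ := norm_pos_iff.2 hp
    have hp1 : ‖p‖ < 1 := by nlinarith
    rw [thetaSer_eq_base h hp] at h0
    obtain ⟨k, hk⟩ := exists_eq_zpow_of_thetaSer_eq_zero (pow_ne_zero M hp)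
      (norm_pow_lt_one (by omega) hp1) (mul_ne_zero hw (inv_ne_zero (pow_ne_zero a hp))) h0
    have h4 : w = p ^ (M * k + a : ℤ) := by
      rw [zpow_add₀ hp, zpow_mul, zpow_natCast, zpow_natCast, ← hk, inv_mul_cancel_right₀]
      exact pow_ne_zero a hp
    have h5 : ‖w‖ = ‖p‖ ^ (M * k + a : ℤ) := by rw [h4, norm_zpow]
    rw [h5] at h1 h2
    have h6 : (M * k + a : ℤ) < 1 := by
      by_contra hc
      have := zpow_le_zpow_right_of_le_one₀ hp0 hp1.le (not_lt.1 hc)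
      rw [zpow_one] at this
      exact absurd h1 (not_lt.2 this)
    have h7 : (0 : ℤ) < M * k + a + 1 := by
      by_contra hc
      have := zpow_le_zpow_right_of_le_one₀ hp0 hp1.le (not_lt.1 hc)
      rw [zpow_zero, zpow_add_one₀ hp0.ne', mul_comm] at this
      exact absurd h2 (not_lt.2 this)
    have h8 : (M * k + a : ℤ) = 0 := by omega
    have h9 : k = 0 := by
      have ha : (a : ℤ) + 1 ≤ M := by exact_mod_cast h
      rcases lt_trichotomy k 0 with h | h | h
      · nlinarith
      · exact h
      · nlinarith
    subst h9
    rw [h8, zpow_zero] at h4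
    exact h3 (by omega) h4

theorem jacobiJet_zero {M a : ℕ} (h : a < M) (y : ℂ) {w : ℂ} (hw : a = 0 → w ≠ 1) :
    jacobiJet M a y 0 w = expSeries (-y) * (expSubOneDiv⁻¹ +
      PowerSeries.C (if a = 0 then (1 - w⁻¹)⁻¹ else 1) * PowerSeries.X) := by
  have hM : M ≠ 0 := by omega
  have h1 : ∀ (M : ℕ), 0 < M → ∀ w, thetaJet M 0 0 w = 1 - PowerSeries.C w⁻¹ * expSeries (-1) :=
      fun M hM w => by
    ext n
    rw [thetaJet, PowerSeries.coeff_mk, thetaSer_zero hM, map_sub, PowerSeries.coeff_C_mul, expSeries,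
      PowerSeries.coeff_rescale, PowerSeries.coeff_one, PowerSeries.coeff_exp]
    cases n with
    | zero => simp
    | succ n => simp; ring
  have h2 : expSeries 1 * expSeries (-1) = 1 := by
    rw [← expSeries_add, add_neg_cancel, expSeries_zero]
  have h3 := one_add_X_mul_expSubOneDiv
  have h4 : tail (thetaJet 1 0 0 1) = expSeries (-1) * expSubOneDiv := by
    have h5 : PowerSeries.C (0 : ℂ) + PowerSeries.X * (expSeries (-1) * expSubOneDiv) =
        thetaJet 1 0 0 1 := by
      rw [h1 1 one_pos, inv_one, map_one, map_zero]
      linear_combination expSeries (-1) * h3 + h2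
    rw [← h5, tail_C_add_X_mul]
  have h5 : (tail (thetaJet 1 0 0 1))⁻¹ = expSeries 1 * expSubOneDiv⁻¹ := by
    rw [PowerSeries.inv_eq_iff_mul_eq_one (by rw [h4, map_mul, constantCoeff_expSeries, constantCoeff_expSubOneDiv]; norm_num), h4]
    have := expSubOneDiv_mul_inv
    linear_combination expSubOneDiv * expSubOneDiv⁻¹ * h2 + this
  have h6 : thetaSer 1 0 1 0 1 = 1 := by rw [thetaSer_zero one_pos]; norm_num
  have h7 := expSubOneDiv_mul_inv
  rw [jacobiJet, zero_pow hM, h5, h6, map_one]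
  congr 1
  split_ifs with ha
  · subst ha
    have hw' : 1 - w⁻¹ ≠ 0 := fun h0 => hw rfl (inv_eq_one.1 (by linear_combination -h0))
    have h8 : PowerSeries.C (1 - w⁻¹)⁻¹ * (1 - PowerSeries.C w⁻¹) = 1 := by
      rw [← map_one PowerSeries.C, ← map_sub, ← map_mul, inv_mul_cancel₀ hw']
    rw [h1 M h, thetaSer_zero h]
    simp only [pow_zero, one_mul]
    linear_combination (-PowerSeries.C (1 - w⁻¹)⁻¹ * expSubOneDiv⁻¹ * PowerSeries.C w⁻¹) * h2
      - PowerSeries.C (1 - w⁻¹)⁻¹ * expSubOneDiv⁻¹ * h3 + expSubOneDiv⁻¹ * h8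
      + PowerSeries.C (1 - w⁻¹)⁻¹ * PowerSeries.X * h7
  · have h8 : thetaJet M a 0 w = 1 := by
      ext n
      rw [thetaJet, PowerSeries.coeff_mk, thetaSer_zero_of_pos h ha, PowerSeries.coeff_one]
      cases n <;> simp
    rw [h8, thetaSer_zero_of_pos h ha]
    simp only [pow_zero, inv_one, map_one]
    linear_combination (-expSubOneDiv⁻¹) * h3 + PowerSeries.X * h7

end JacobiJet

section Expansions

open Complex
open scoped UpperHalfPlane

variable {N : ℕ} [NeZero N]

theorem rootOf_ne_zero (k : ZMod N) : rootOf k ≠ 0 := Complex.exp_ne_zero _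

theorem rootOf_pow (k : ZMod N) : rootOf k ^ N = 1 := by
  have hN : (N : ℂ) ≠ 0 := Nat.cast_ne_zero.2 (NeZero.ne N)
  rw [rootOf, ← Complex.exp_nat_mul, Complex.exp_eq_one_iff]
  exact ⟨k.val, by push_cast; field_simp⟩

theorem norm_rootOf (k : ZMod N) : ‖rootOf k‖ = 1 :=
  Complex.norm_eq_one_of_pow_eq_one (rootOf_pow k) (NeZero.ne N)

theorem jacobiJet_zero_eq_kzPower {M a : ℕ} (h : a < M) (j : ℤ) (α : Tors N)
    (ha : a = 0 ↔ α.2 = (j : ZMod N)) {w : ℂ} (hw : w ≠ 0) (hw' : w ^ N ≠ 1) :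
    jacobiJet M a (yLift j α) 0 (w * (rootOf α.1)⁻¹) = kzPower j w α := by
  have h1 : w ≠ rootOf α.1 := fun h0 => hw' (by rw [h0, rootOf_pow])
  have h2 : w * (rootOf α.1)⁻¹ ≠ 1 := fun h0 => h1 (by
    rwa [← div_eq_mul_inv, div_eq_one_iff_eq (rootOf_ne_zero _)] at h0)
  rw [jacobiJet_zero h _ fun _ => h2, kzPower]
  congr 4
  rw [if_congr ha rfl rfl]
  congr 1
  have h3 := rootOf_ne_zero α.1
  have h4 := sub_ne_zero.2 h1
  rw [mul_inv, inv_inv, eq_div_iff h4, inv_mul_eq_iff_eq_mul₀]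
  · field_simp
  · rw [← div_eq_inv_mul, one_sub_div hw]
    exact div_ne_zero h4 hw

theorem thetaSer_ne_zero_of_mem_fiberChart {M a : ℕ} (h : a < M) {p : ℂ × ℂ}
    (hp : p ∈ fiberChart N) (k : ZMod N) : thetaSer M a 0 p.1 (p.2 * (rootOf k)⁻¹) ≠ 0 := by
  obtain ⟨h1, h2, h3⟩ := hp
  have h4 : ‖p.2 * (rootOf k)⁻¹‖ = ‖p.2‖ := by rw [norm_mul, norm_inv, norm_rootOf, inv_one, mul_one]
  refine thetaSer_ne_zero h (by rwa [h4]) (by rwa [h4]) fun _ h0 => h3 ?_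
  rw [← div_eq_mul_inv, div_eq_one_iff_eq (rootOf_ne_zero _)] at h0
  rw [h0, rootOf_pow]

theorem norm_lt_one_of_mem_fiberChart {p : ℂ × ℂ} (hp : p ∈ fiberChart N) : ‖p.1‖ < 1 := by
  obtain ⟨h1, h2, -⟩ := hp
  have := norm_nonneg p.1
  nlinarith

theorem ne_zero_of_mem_fiberChart {p : ℂ × ℂ} (hp : p ∈ fiberChart N) : p.2 ≠ 0 :=
  norm_pos_iff.1 ((norm_nonneg _).trans_lt hp.1)

theorem holSeriesOn_fiberChart {M a : ℕ} (h : a < M) (y : ℂ) (k : ZMod N) :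
    HolSeriesOn (fun x : ℂ × ℂ => jacobiJet M a y x.1 (x.2 * (rootOf k)⁻¹)) (fiberChart N) := by
  refine (holSeriesOn_jacobiJet h y).comp (g := fun x : ℂ × ℂ => (x.1, x.2 * (rootOf k)⁻¹))
    (by fun_prop) fun x hx => ⟨show ‖x.1‖ < 1 from norm_lt_one_of_mem_fiberChart hx,
      mul_ne_zero (ne_zero_of_mem_fiberChart hx) (inv_ne_zero (rootOf_ne_zero k)),
      thetaSer_ne_zero_of_mem_fiberChart h hx k⟩

theorem norm_qPar_lt_one {M : ℕ} (hM : M ≠ 0) (τ : ℍ) : ‖qPar M τ‖ < 1 := by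
  rw [qPar, Complex.norm_exp, Real.exp_lt_one_iff]
  have hM' : (0 : ℝ) < M := by exact_mod_cast Nat.pos_of_ne_zero hM
  have h1 : (2 * Real.pi * I * τ / M : ℂ) = ((2 * Real.pi / M : ℝ) : ℂ) * (I * τ) := by
    push_cast; ring
  have h2 : 0 < τ.im := τ.im_pos
  rw [h1, Complex.re_ofReal_mul, Complex.I_mul_re]
  have : 0 < 2 * Real.pi / M * τ.im := by positivity
  rw [mul_neg]
  simpa using this

theorem qPar_pow {M : ℕ} (hM : M ≠ 0) (τ : ℍ) : qPar M τ ^ M = cexp (2 * Real.pi * I * τ) := by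
  have : (M : ℂ) ≠ 0 := Nat.cast_ne_zero.2 hM
  rw [qPar, ← Complex.exp_nat_mul]
  congr 1
  field_simp

theorem wPar_sub_torsPoint {M a : ℕ} (hM : M ≠ 0) (α : Tors N) (ha : (a : ℂ) / M = yCoord α)
    (τ : ℍ) (z : ℂ) : cexp (2 * Real.pi * I * (z - torsPoint α τ)) =
      wPar z * (rootOf α.1)⁻¹ * (qPar M τ ^ a)⁻¹ := by
  have : (M : ℂ) ≠ 0 := Nat.cast_ne_zero.2 hM
  rw [wPar, rootOf, qPar, ← Complex.exp_nat_mul, ← Complex.exp_neg, ← Complex.exp_neg,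
    ← Complex.exp_add, ← Complex.exp_add, torsPoint, ← ha, xCoord]
  congr 1
  field_simp
  ring

theorem hSeries_eq {M a : ℕ} (h : a < M) {α : Tors N} (ha : (a : ℂ) / M = yCoord α)
    (τ : ℍ) (z : ℂ) (hA : thetaSer M a 0 (qPar M τ) (wPar z * (rootOf α.1)⁻¹) ≠ 0) :
    hSeries α z τ = (2 * Real.pi * I : ℂ) •
      tail (jacobiJet M a (yCoord α) (qPar M τ) (wPar z * (rootOf α.1)⁻¹)) := by
  have hM : M ≠ 0 := by omega
  obtain ⟨φ, h1, h2, h3, h4⟩ := exists_jacobiJet (p := qPar M τ) h (yCoord α) (Complex.exp_ne_zero _)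
    (norm_qPar_lt_one hM τ) (qPar_pow hM τ) (wPar_sub_torsPoint hM α ha τ z) hA
  rw [hSeries, ← h3]
  refine taylorSeries_eq h1 ?_
  filter_upwards [h4] with x hx
  rw [hFun, hx, h2, mul_one]

end Expansions

section CoeffA

open Complex
open scoped UpperHalfPlane

variable {N : ℕ} [NeZero N]

theorem isOpen_jacobiDomain {M a : ℕ} (h : a < M) :
    IsOpen {x : ℂ × ℂ | ‖x.1‖ < 1 ∧ x.2 ≠ 0 ∧ thetaSer M a 0 x.1 x.2 ≠ 0} := by
  have := (differentiableOn_thetaSer h 0).continuousOn.isOpen_inter_preimage isOpen_thetaDomain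
    (isOpen_compl_singleton (x := (0 : ℂ)))
  convert this using 1
  ext x
  simp [and_assoc]

/-- The holomorphic extension to `q = 0` of the coefficient `A_{m,α}`. -/
def coeffExt (M a m : ℕ) (α : Tors N) (p : ℂ) : ℂ :=
  2 * Real.pi * I * PowerSeries.coeff (m + 2) (if α = 0 then
    (tail (thetaJet 1 0 (p ^ M) 1))⁻¹ * PowerSeries.derivative ℂ (thetaJet 1 0 (p ^ M) 1)
    else jacobiJet M a (yCoord α) p (rootOf α.1)⁻¹) * (m + 1)

theorem rootOf_ne_one {k : ZMod N} (hk : k ≠ 0) : rootOf k ≠ 1 := fun h => by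
  rw [rootOf, Complex.exp_eq_one_iff] at h
  obtain ⟨n, hn⟩ := h
  have hN : (N : ℂ) ≠ 0 := Nat.cast_ne_zero.2 (NeZero.ne N)
  have h1 : (k.val : ℂ) = n * N := by
    have h2 := Complex.two_pi_I_ne_zero
    field_simp at hn
    linear_combination hn
  have h2 : (k.val : ℤ) = n * N := by exact_mod_cast h1
  have h3 := ZMod.val_lt k
  have h4 : k.val ≠ 0 := (ZMod.val_ne_zero k).2 hk
  have h5 : (0 : ℤ) < N := by omega
  have h6 : (k.val : ℤ) < N := by exact_mod_cast h3
  have h7 : 0 < (k.val : ℤ) := by omega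
  rw [h2] at h6 h7
  have h8 : n < 1 := by nlinarith
  have h9 : 0 < n := by nlinarith
  omega

theorem rootOf_zero : rootOf (0 : ZMod N) = 1 := by simp [rootOf]

theorem eq_zero_iff_of_yCoord {M a : ℕ} (h : a < M) {α : Tors N} (ha : (a : ℂ) / M = yCoord α) :
    a = 0 ↔ α.2 = 0 := by
  have hN : (N : ℂ) ≠ 0 := Nat.cast_ne_zero.2 (NeZero.ne N)
  have hM : (M : ℂ) ≠ 0 := Nat.cast_ne_zero.2 (by omega)
  rw [yCoord, div_eq_div_iff hM hN] at ha
  constructor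
  · rintro rfl
    have : (α.2.val : ℂ) = 0 := by
      rw [Nat.cast_zero, zero_mul, eq_comm, mul_eq_zero] at ha
      exact ha.resolve_right hM
    exact (ZMod.val_eq_zero _).1 (by exact_mod_cast this)
  · intro h0
    rw [h0, ZMod.val_zero, Nat.cast_zero, zero_mul, mul_eq_zero] at ha
    exact_mod_cast ha.resolve_right hN

theorem thetaSer_ne_zero_of_ne_zero {M a : ℕ} (h : a < M) {α : Tors N}
    (ha : (a : ℂ) / M = yCoord α) (hα : α ≠ 0) {p : ℂ} (hp : ‖p‖ < 1) :
    thetaSer M a 0 p (rootOf α.1)⁻¹ ≠ 0 := by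
  have h1 : ‖(rootOf α.1)⁻¹‖ = 1 := by rw [norm_inv, norm_rootOf, inv_one]
  refine thetaSer_ne_zero h (by rwa [h1]) (by rwa [h1, mul_one]) fun h0 h2 => ?_
  have h3 := (eq_zero_iff_of_yCoord h ha).1 h0
  exact rootOf_ne_one (fun h4 => hα (Prod.ext h4 h3)) (inv_eq_one.1 h2)

theorem differentiableOn_coeffExt {M a : ℕ} (h : a < M) {α : Tors N}
    (ha : (a : ℂ) / M = yCoord α) (m : ℕ) :
    DifferentiableOn ℂ (coeffExt M a m α) {p | ‖p‖ < 1} := by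
  have hM : M ≠ 0 := by omega
  refine DifferentiableOn.mul_const (DifferentiableOn.const_mul ?_ _) _
  split_ifs with h0
  · exact ((holSeriesOn_baseJet_tail_inv hM).mul (holSeriesOn_baseJet hM).derivative) _
  · exact ((holSeriesOn_jacobiJet h (yCoord α)).comp (g := fun p : ℂ => (p, (rootOf α.1)⁻¹))
      (by fun_prop) fun p (hp : ‖p‖ < 1) => ⟨hp, inv_ne_zero (rootOf_ne_zero _),
        thetaSer_ne_zero_of_ne_zero h ha h0 hp⟩) _

theorem thetaSer_zero_pow (M k : ℕ) (p w : ℂ) :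
    thetaSer M 0 k p w = thetaSer 1 0 k (p ^ M) w := by
  rw [thetaSer, thetaSer]
  refine tsum_congr fun n => ?_
  rw [← pow_mul]
  congr 3
  have h1 : (0 : ℤ) ≤ n * (n + 1) / 2 := by
    have := coe_thetaExp one_pos (M := 1) (a := 0) n
    simp at this
    omega
  rw [thetaExp, thetaExp]
  simp only [Nat.cast_zero, zero_mul, sub_zero, Nat.cast_one, one_mul]
  rw [Int.toNat_mul (by positivity) h1, Int.toNat_natCast]

theorem thetaJet_zero_pow (M : ℕ) (p w : ℂ) : thetaJet M 0 p w = thetaJet 1 0 (p ^ M) w := by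
  ext k
  rw [thetaJet, thetaJet, PowerSeries.coeff_mk, PowerSeries.coeff_mk, thetaSer_zero_pow M]

theorem tendsto_coeff_jacobiJet_zero {q : ℂ} (hq : ‖q‖ < 1) (n : ℕ) :
    Filter.Tendsto (fun z : ℂ => PowerSeries.coeff (n + 2) (PowerSeries.C (thetaSer 1 0 1 q 1) *
        (tail (thetaJet 1 0 q 1))⁻¹ * thetaJet 1 0 q (cexp z) *
        PowerSeries.C (thetaSer 1 0 0 q (cexp z))⁻¹)) (𝓝[≠] 0)
      (𝓝 (PowerSeries.coeff (n + 2)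
        ((tail (thetaJet 1 0 q 1))⁻¹ * PowerSeries.derivative ℂ (thetaJet 1 0 q 1)))) := by
  set D := tail (thetaJet 1 0 q 1) with hD
  set A₁ := thetaSer 1 0 1 q 1
  have hA₁ : A₁ ≠ 0 := thetaSer_one_ne_zero hq
  have hder : ∀ k, HasDerivAt (fun z => thetaSer 1 0 k q (cexp z)) (thetaSer 1 0 (k + 1) q 1) 0 :=
    fun k => by
      have := hasDerivAt_thetaSer_exp one_pos k hq one_ne_zero (a := 0) (M := 1) 0
      simpa only [one_mul, Complex.exp_zero] using this
  set G : ℂ → ℂ := fun z => PowerSeries.coeff (n + 2) (D⁻¹ * thetaJet 1 0 q (cexp z)) with hG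
  have hG' : HasDerivAt G (PowerSeries.coeff (n + 2)
      (D⁻¹ * PowerSeries.derivative ℂ (thetaJet 1 0 q 1))) 0 := by
    simp only [hG, PowerSeries.coeff_mul]
    refine HasDerivAt.fun_sum fun i _ => HasDerivAt.const_mul _ ?_
    simp only [thetaJet, PowerSeries.coeff_mk, PowerSeries.coeff_derivative]
    refine ((hder i.2).div_const _).congr_deriv ?_
    have h1 : (i.2.factorial : ℂ) ≠ 0 := Nat.cast_ne_zero.2 i.2.factorial_ne_zero
    have h2 : (i.2 + 1 : ℂ) ≠ 0 := by exact_mod_cast Nat.succ_ne_zero i.2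
    rw [Nat.factorial_succ]
    push_cast
    field_simp
  have hG0 : G 0 = 0 := by
    have h1 := C_add_X_mul_tail (thetaJet 1 0 q 1)
    rw [constantCoeff_thetaJet, thetaSer_at_one, map_zero, zero_add, ← hD] at h1
    have h2 : D⁻¹ * D = 1 := PowerSeries.inv_mul_cancel _ (by
      rw [hD, constantCoeff_tail_thetaJet]; exact hA₁)
    simp only [hG, Complex.exp_zero]
    rw [← h1, mul_left_comm, h2, mul_one, PowerSeries.coeff_X, if_neg (by omega)]
  have t1 := hasDerivAt_iff_tendsto_slope.1 hG'
  have t2 := hasDerivAt_iff_tendsto_slope.1 (hder 0)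
  have t3 := (t1.div t2 hA₁).const_mul A₁
  rw [mul_div_cancel₀ _ hA₁] at t3
  refine t3.congr' ?_
  filter_upwards [self_mem_nhdsWithin] with z hz
  have hz : z ≠ 0 := hz
  simp only [Pi.div_apply, slope_def_field, Complex.exp_zero, thetaSer_at_one, hG0, sub_zero]
  rw [div_div_div_cancel_right₀ hz, PowerSeries.coeff_mul_C, mul_assoc (PowerSeries.C A₁),
    PowerSeries.coeff_C_mul, ← div_eq_mul_inv, mul_div_assoc]

theorem coeffA_eq {M a : ℕ} (h : a < M) {α : Tors N} (ha : (a : ℂ) / M = yCoord α) (m : ℕ)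
    (τ : ℍ) : coeffA m α τ = coeffExt M a m α (qPar M τ) := by
  have hM : M ≠ 0 := by omega
  have hq := norm_qPar_lt_one hM τ
  refine Filter.Tendsto.limUnder_eq ?_
  have hw0 : wPar 0 = 1 := by simp [wPar]
  have hwc : Continuous wPar := by unfold wPar; fun_prop
  have key : ∀ z, thetaSer M a 0 (qPar M τ) (wPar z * (rootOf α.1)⁻¹) ≠ 0 →
      PowerSeries.coeff m (gSeries α z τ) = 2 * Real.pi * I * PowerSeries.coeff (m + 2)
        (jacobiJet M a (yCoord α) (qPar M τ) (wPar z * (rootOf α.1)⁻¹)) * (m + 1) := fun z hz => by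
    rw [gSeries, PowerSeries.coeff_derivative, hSeries_eq h ha τ z hz]
    simp [tail]
  unfold coeffExt
  by_cases hα : α = 0
  · subst hα
    obtain rfl : a = 0 := (eq_zero_iff_of_yCoord h ha).2 rfl
    rw [if_pos rfl]
    have hy : yCoord (0 : Tors N) = 0 := by simp [yCoord]
    have hq' := norm_pow_lt_one hM hq
    have t0 : Filter.Tendsto (fun z : ℂ => 2 * Real.pi * I * z) (𝓝[≠] 0) (𝓝[≠] 0) := by
      refine tendsto_nhdsWithin_iff.2 ⟨?_, ?_⟩
      · have : Continuous fun z : ℂ => 2 * Real.pi * I * z := by fun_prop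
        simpa using (this.tendsto 0).mono_left nhdsWithin_le_nhds
      · filter_upwards [self_mem_nhdsWithin] with z hz
        exact mul_ne_zero Complex.two_pi_I_ne_zero hz
    have t1 := ((tendsto_coeff_jacobiJet_zero hq' m).comp t0).const_mul (2 * Real.pi * I : ℂ)
      |>.mul_const (m + 1 : ℂ)
    refine t1.congr' ?_
    have hd : HasDerivAt (fun z => thetaSer 1 0 0 (qPar M τ ^ M) (cexp z))
        (thetaSer 1 0 1 (qPar M τ ^ M) 1) 0 := by
      have := hasDerivAt_thetaSer_exp one_pos 0 hq' one_ne_zero (a := 0) (M := 1) 0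
      simpa only [one_mul, Complex.exp_zero] using this
    filter_upwards [t0.eventually (hd.eventually_ne (thetaSer_one_ne_zero hq') (c := 0))] with z hz
    rw [key z]
    · simp only [Function.comp_apply]
      congr 3
      rw [jacobiJet, hy, neg_zero, expSeries_zero, one_mul, Prod.fst_zero, rootOf_zero, inv_one, mul_one,
        thetaSer_zero_pow M, thetaJet_zero_pow M, wPar]
    · rw [Prod.fst_zero, rootOf_zero, inv_one, mul_one, thetaSer_zero_pow M, wPar]
      exact hz
  · rw [if_neg hα]
    have hne := thetaSer_ne_zero_of_ne_zero h ha hα hq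
    have hmem : (qPar M τ, wPar 0 * (rootOf α.1)⁻¹) ∈
        {x : ℂ × ℂ | ‖x.1‖ < 1 ∧ x.2 ≠ 0 ∧ thetaSer M a 0 x.1 x.2 ≠ 0} := by
      rw [hw0, one_mul]
      exact ⟨hq, inv_ne_zero (rootOf_ne_zero _), hne⟩
    have hc : ContinuousAt (fun z : ℂ => (qPar M τ, wPar z * (rootOf α.1)⁻¹)) 0 := by fun_prop
    have hn := (isOpen_jacobiDomain h).mem_nhds hmem
    have h1 := (((holSeriesOn_jacobiJet h (yCoord α)) (m + 2)).differentiableAt hn).continuousAt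
    have h2 : ContinuousAt (fun z : ℂ => PowerSeries.coeff (m + 2)
        (jacobiJet M a (yCoord α) (qPar M τ) (wPar z * (rootOf α.1)⁻¹))) 0 :=
      ContinuousAt.comp (f := fun z : ℂ => (qPar M τ, wPar z * (rootOf α.1)⁻¹)) h1 hc
    have h3 := ((h2.tendsto.mono_left nhdsWithin_le_nhds).const_mul (2 * Real.pi * I : ℂ)).mul_const
      (m + 1 : ℂ) (x := 𝓝[≠] 0)
    rw [hw0, one_mul] at h3
    refine h3.congr' ?_
    filter_upwards [(hc.eventually hn).filter_mono nhdsWithin_le_nhds] with z hz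
    exact (key z hz.2.2).symm

end CoeffA

/-! ### The connection near the identity component -/

section LogForm

open Complex NCSeries
open scoped UpperHalfPlane

variable {N : ℕ} [NeZero N] {S : AddSubgroup (Tors N)}

theorem der_eq_zero {σ : Type} [Fintype σ] {c : σ → NCSeries σ} (h : ∀ x, c x = 0) : der c = 0 := by
  refine LinearMap.ext fun f => funext fun w => ?_
  change ∑ i ∈ Finset.range (w.length + 1), ∑ k ∈ Finset.range (w.length - i + 1), ∑ x : σ,
      f (w.take i ++ x :: w.drop (i + k)) * c x ((w.drop i).take k) = 0
  exact Finset.sum_eq_zero fun i _ => Finset.sum_eq_zero fun k _ => Finset.sum_eq_zero fun x _ => by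
    rw [h, NCSeries.zero_apply, mul_zero]

theorem delta_of_not_mem (m : ℕ) {α : Tors N} (h : α ∉ S) : delta S m α = 0 := by
  have h0 : ∀ k β, β ∉ S → adXT S k β = 0 := fun k β hβ => by
    rw [adXT, genT_of_not_mem S hβ, map_zero]
  have hY : ∑ j ∈ Finset.range m, ∑ β : Tors N,
      (-1 : ℂ) ^ j • ⁅adXT S j β, adXT S (m - 1 - j) (α + β)⁆ = 0 :=
    Finset.sum_eq_zero fun j _ => Finset.sum_eq_zero fun β _ => by
      by_cases hβ : β ∈ S
      · rw [h0 _ (α + β) fun h' => h ((S.add_mem_cancel_right hβ).1 h'), lie_zero, smul_zero]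
      · rw [h0 _ β hβ, zero_lie, smul_zero]
  have hT : ∀ β ∈ S, ⁅genT S β, adXT S m (β + α) + (-1 : ℂ) ^ m • adXT S m (β - α)⁆ = 0 :=
    fun β hβ => by
      rw [h0 _ (β + α) fun h' => h ((S.add_mem_cancel_left hβ).1 h'),
        h0 _ (β - α) fun h' => h (by simpa using S.sub_mem hβ h'), smul_zero, add_zero, lie_zero]
  refine der_eq_zero fun x => ?_
  cases x with
  | X => rfl
  | Y => exact hY
  | t β hβ => exact hT β hβ.1

theorem differentiableOn_lie {E : Type*} [NormedAddCommGroup E] [NormedSpace ℂ E] {U : Set E}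
    {σ : Type} {f : E → NCSeries σ} (hf : ∀ l, DifferentiableOn ℂ (fun x => f x l) U)
    (v : NCSeries σ) (l : List σ) : DifferentiableOn ℂ (fun x => ⁅f x, v⁆ l) U := by
  simp only [Ring.lie_def, sub_apply, mul_apply]
  exact (DifferentiableOn.fun_sum fun i _ => (hf _).mul_const _).sub
    (DifferentiableOn.fun_sum fun i _ => (hf _).const_mul _)

theorem differentiableOn_actX {E : Type*} [NormedAddCommGroup E] [NormedSpace ℂ E] {U : Set E}
    {P : E → PowerSeries ℂ} (hP : HolSeriesOn P U) (v : NCSeries (Gen N S)) (l : List (Gen N S)) :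
    DifferentiableOn ℂ (fun x => actX S (P x) v l) U := by
  simp only [actX, adSeries_def]
  exact DifferentiableOn.fun_sum fun i _ => (hP _).mul_const _

theorem differentiableOn_conn {E : Type*} [NormedAddCommGroup E] [NormedSpace ℂ E] {U : Set E}
    {P : E → Tors N → PowerSeries ℂ} (hP : ∀ α, HolSeriesOn (fun x => P x α) U)
    (T : Tors N → NCSeries (Gen N S)) (l : List (Gen N S)) :
    DifferentiableOn ℂ (fun x => conn S T (P x) l) U := by
  simp only [conn, add_apply, NCSeries.sum_apply]
  exact (differentiableOn_const _).add
    (DifferentiableOn.fun_sum fun α _ => differentiableOn_actX (hP α).tail _ _)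

/-- The exponent of `p` in the expansion of `h_α` at a cusp of width `M`. -/
def torsExp (M : ℕ) (α : Tors N) : ℕ := α.2.val * M / N

theorem torsExp_lt {M : ℕ} (hM : M ≠ 0) (α : Tors N) : torsExp M α < M := by
  rw [torsExp, Nat.div_lt_iff_lt_mul (NeZero.pos N), mul_comm]
  exact Nat.mul_lt_mul_of_pos_left (ZMod.val_lt _) (Nat.pos_of_ne_zero hM)

/-- The condition on the width that the torsion sections in `S` are defined over the local
parameter. -/
def IsWidth (S : AddSubgroup (Tors N)) (M : ℕ) : Prop :=
  M ≠ 0 ∧ ∀ α ∈ S, (torsExp M α : ℂ) / M = yCoord α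

theorem isWidth_self (S : AddSubgroup (Tors N)) : IsWidth S N := by
  refine ⟨NeZero.ne N, fun α _ => ?_⟩
  rw [torsExp, Nat.mul_div_cancel _ (NeZero.pos N), yCoord]

theorem isWidth_realTors : IsWidth (realTors N) 1 := by
  refine ⟨one_ne_zero, fun α hα => ?_⟩
  have : α.2 = 0 := hα.2
  simp [torsExp, yCoord, this]

/-- The power series of the connection near the identity component. -/
def idJet (M : ℕ) (x : ℂ × ℂ) (α : Tors N) : PowerSeries ℂ :=
  jacobiJet M (torsExp M α) (yCoord α) x.1 (x.2 * (rootOf α.1)⁻¹)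

theorem holSeriesOn_idJet {M : ℕ} (hM : M ≠ 0) (α : Tors N) :
    HolSeriesOn (fun x => idJet M x α) (fiberChart N) :=
  holSeriesOn_fiberChart (torsExp_lt hM α) _ _

theorem conn_congr {Φ Ψ : Tors N → PowerSeries ℂ} (h : ∀ α ∈ S, Φ α = Ψ α) :
    conn S (genT S) Φ = conn S (genT S) Ψ := by
  rw [conn, conn]
  congr 1
  refine Finset.sum_congr rfl fun α _ => ?_
  by_cases hα : α ∈ S
  · rw [h α hα]
  · rw [genT_of_not_mem S hα, actX, actX, adSeries_zero, adSeries_zero]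

theorem yLift_zero (α : Tors N) : yLift 0 α = yCoord α := by simp [yLift, yCoord]

theorem conn_idJet_zero {M : ℕ} (hM : IsWidth S M) {w : ℂ} (hw : w ≠ 0) (hw' : w ^ N ≠ 1) :
    conn S (genT S) (idJet M (0, w)) = conn S (genT S) (kzPower 0 w) := by
  refine conn_congr fun α hα => ?_
  have := jacobiJet_zero_eq_kzPower (torsExp_lt hM.1 α) 0 α (by
    rw [eq_zero_iff_of_yCoord (torsExp_lt hM.1 α) (hM.2 α hα), Int.cast_zero]) hw hw'
  rw [yLift_zero] at this
  exact this

theorem hSeries_eq_idJet {M : ℕ} (hM : IsWidth S M) {α : Tors N} (hα : α ∈ S) {τ : ℍ} {z : ℂ}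
    (h : (qPar M τ, wPar z) ∈ fiberChart N) :
    hSeries α z τ = (2 * Real.pi * I : ℂ) • tail (idJet M (qPar M τ, wPar z) α) :=
  hSeries_eq (torsExp_lt hM.1 α) (hM.2 α hα) τ z
    (thetaSer_ne_zero_of_mem_fiberChart (torsExp_lt hM.1 α) h α.1)

theorem sum_actX_genT_congr {P Q : Tors N → PowerSeries ℂ} (h : ∀ α ∈ S, P α = Q α) :
    ∑ α, actX S (P α) (genT S α) = ∑ α, actX S (Q α) (genT S α) := by
  refine Finset.sum_congr rfl fun α _ => ?_
  by_cases hα : α ∈ S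
  · rw [h α hα]
  · rw [genT_of_not_mem S hα, actX, actX, adSeries_zero, adSeries_zero]

theorem nu2_eq {M : ℕ} (hM : IsWidth S M) {τ : ℍ} {z : ℂ}
    (h : (qPar M τ, wPar z) ∈ fiberChart N) : nu2 S τ z =
      (2 * Real.pi * I : ℂ) • conn S (genT S) (idJet M (qPar M τ, wPar z)) := by
  rw [nu2, sum_actX_genT_congr fun α hα => hSeries_eq_idJet hM hα h, conn, smul_add,
    Finset.smul_sum]
  simp only [actX_smul]

/-- The extension of `ν₁` over the singular fiber. -/
def nu1Ext (S : AddSubgroup (Tors N)) (M : ℕ) (x : ℂ × ℂ) : NCSeries (Gen N S) :=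
  ∑ α, actX S (PowerSeries.derivative ℂ ((2 * Real.pi * I : ℂ) • tail (idJet M x α))) (genT S α)

theorem nu1_eq {M : ℕ} (hM : IsWidth S M) {τ : ℍ} {z : ℂ}
    (h : (qPar M τ, wPar z) ∈ fiberChart N) : nu1 S τ z = nu1Ext S M (qPar M τ, wPar z) := by
  refine sum_actX_genT_congr fun α hα => ?_
  rw [gSeries, hSeries_eq_idJet hM hα h]

/-- The extension of `ψ` over the singular fiber. -/
def psiExt (S : AddSubgroup (Tors N)) (M : ℕ) (p : ℂ) :
    NCSeries (Gen N S) →ₗ[ℂ] NCSeries (Gen N S) where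
  toFun f := fun w => (1 / 2) * ∑ m ∈ Finset.range (w.length + 1), ∑ α : Tors N,
    coeffExt M (torsExp M α) m α p * (delta S m α f) w
  map_add' f g := by
    refine funext fun w => Eq.trans ?_ (NCSeries.add_apply _ _ w).symm
    simp only [map_add, NCSeries.add_apply, mul_add, Finset.sum_add_distrib]
  map_smul' a f := by
    refine funext fun w => Eq.trans ?_ (NCSeries.smul_apply _ _ w).symm
    simp only [map_smul, NCSeries.smul_apply, RingHom.id_apply, Finset.mul_sum]
    exact Finset.sum_congr rfl fun m _ => Finset.sum_congr rfl fun α _ => by ring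

theorem exists_isLogForm {M : ℕ} (hM : IsWidth S M) :
    ∃ G H : ℂ × ℂ → NCSeries (Gen N S) →ₗ[ℂ] NCSeries (Gen N S), IsLogForm S M G H ∧
      ∀ w : ℂ, w ≠ 0 → w ^ N ≠ 1 → H (0, w) = LieAlgebra.ad ℂ (NCSeries (Gen N S))
        (kzHom 0 (hasOrder_genT S) (kzForm w)) := by
  have hMC : (M : ℂ) ≠ 0 := Nat.cast_ne_zero.2 hM.1
  have hpi := Complex.two_pi_I_ne_zero
  refine ⟨fun x => (M / (2 * Real.pi * I) : ℂ) • ((2 * Real.pi * I : ℂ) • derYX S + psiExt S M x.1 +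
      LieAlgebra.ad ℂ (NCSeries (Gen N S)) (nu1Ext S M x)),
    fun x => LieAlgebra.ad ℂ (NCSeries (Gen N S)) (x.2⁻¹ • conn S (genT S) (idJet M x)),
    ⟨fun v l => ?_, fun v l => ?_, fun τ z h => ⟨?_, ?_⟩⟩, fun w hw hw' => ?_⟩
  · simp only [LinearMap.smul_apply, LinearMap.add_apply, LieAlgebra.ad_apply, NCSeries.smul_apply,
      NCSeries.add_apply]
    refine DifferentiableOn.const_mul (((differentiableOn_const _).add ?_).add ?_) _
    · refine DifferentiableOn.const_mul (DifferentiableOn.fun_sum fun m _ =>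
        DifferentiableOn.fun_sum fun α _ => ?_) _
      by_cases hα : α ∈ S
      · exact ((differentiableOn_coeffExt (torsExp_lt hM.1 α) (hM.2 α hα) m).comp
          differentiableOn_fst fun x hx => norm_lt_one_of_mem_fiberChart hx).mul_const _
      · simp only [delta_of_not_mem m hα, LinearMap.zero_apply, NCSeries.zero_apply, mul_zero]
        exact differentiableOn_const _
    · refine differentiableOn_lie (fun l => ?_) v l
      simp only [nu1Ext, NCSeries.sum_apply]
      exact DifferentiableOn.fun_sum fun α _ => differentiableOn_actX
        (((holSeriesOn_idJet hM.1 α).tail.smul _).derivative) _ _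
  · simp only [LieAlgebra.ad_apply]
    refine differentiableOn_lie (fun l => ?_) v l
    simp only [NCSeries.smul_apply]
    exact (differentiableOn_snd.inv fun x hx => ne_zero_of_mem_fiberChart hx).mul
      (differentiableOn_conn (fun α => holSeriesOn_idJet hM.1 α) _ _)
  · rw [smul_smul, show (2 * Real.pi * I / M * (M / (2 * Real.pi * I)) : ℂ) = 1 by field_simp,
      one_smul, omegaTau]
    congr 2
    · refine LinearMap.ext fun f => funext fun l => ?_
      change (1 / 2) * ∑ m ∈ Finset.range (l.length + 1), ∑ α : Tors N,
        coeffA m α τ * (delta S m α f) l = (1 / 2) * ∑ m ∈ Finset.range (l.length + 1),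
          ∑ α : Tors N, coeffExt M (torsExp M α) m α (qPar M τ) * (delta S m α f) l
      congr 1
      refine Finset.sum_congr rfl fun m _ => Finset.sum_congr rfl fun α _ => ?_
      by_cases hα : α ∈ S
      · rw [coeffA_eq (torsExp_lt hM.1 α) (hM.2 α hα)]
      · rw [delta_of_not_mem m hα]; simp
    · rw [nu1_eq hM h]
  · have hw : wPar z ≠ 0 := Complex.exp_ne_zero _
    dsimp only
    rw [omegaZ, nu2_eq hM h, map_smul, map_smul, smul_smul]
    congr 1
    field_simp
  · dsimp only
    rw [kzHom_kzForm 0 _ hw, conn_idJet_zero hM hw hw']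

end LogForm

/-! ### Modular transformations -/

section Modular

open Complex NCSeries
open scoped UpperHalfPlane MatrixGroups

theorem coe_smul_eq (γ : SL(2, ℤ)) (τ : ℍ) : ((γ • τ : ℍ) : ℂ) =
    (((γ 0 0 : ℤ) : ℂ) * τ + ((γ 0 1 : ℤ) : ℂ)) / autFactor γ τ := by
  rw [UpperHalfPlane.coe_specialLinearGroup_apply]
  simp [autFactor]

theorem det_eq (γ : SL(2, ℤ)) : (((γ 0 0 : ℤ) : ℂ)) * ((γ 1 1 : ℤ) : ℂ) -
    ((γ 0 1 : ℤ) : ℂ) * ((γ 1 0 : ℤ) : ℂ) = 1 := by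
  have := γ.det_coe
  rw [Matrix.det_fin_two] at this
  exact_mod_cast this

theorem autFactor_mul (γ δ : SL(2, ℤ)) (τ : ℍ) :
    autFactor (γ * δ) τ = autFactor γ (δ • τ) * autFactor δ τ := by
  have h := autFactor_ne_zero δ τ
  rw [autFactor, autFactor, coe_smul_eq, add_mul, mul_div_assoc', div_mul_cancel₀ _ h, autFactor]
  simp [Matrix.mul_apply, Fin.sum_univ_two]
  ring

theorem theta_eq_jacobiTheta₂ (v : ℂ) (τ : ℍ) : theta v τ = cexp (Real.pi * I * τ / 4 + v / 2) *
    jacobiTheta₂ (v / (2 * Real.pi * I) + (1 + τ) / 2) τ := by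
  rw [theta, jacobiTheta₂, ← tsum_mul_left]
  refine tsum_congr fun n => ?_
  have h1 : (-1 : ℂ) ^ n = cexp (n * (Real.pi * I)) := by
    rw [Complex.exp_int_mul, Complex.exp_pi_mul_I]
  rw [jacobiTheta₂_term, h1, ← Complex.exp_add, ← Complex.exp_add, ← Complex.exp_add]
  congr 1
  have := Complex.two_pi_I_ne_zero
  field_simp
  ring

/-- The transformation law of `θ` under `γ`. -/
def ThetaLaw (γ : SL(2, ℤ)) : Prop := ∀ τ : ℍ, ∃ χ : ℂ, χ ≠ 0 ∧ ∀ v : ℂ,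
  theta (v / autFactor γ τ) (γ • τ) =
    χ * cexp (((γ 1 0 : ℤ) : ℂ) * v ^ 2 / (4 * Real.pi * I * autFactor γ τ)) * theta v τ

theorem ThetaLaw.mul {γ δ : SL(2, ℤ)} (hγ : ThetaLaw γ) (hδ : ThetaLaw δ) : ThetaLaw (γ * δ) := by
  intro τ
  obtain ⟨χ, h0, h⟩ := hγ (δ • τ)
  obtain ⟨χ', h0', h'⟩ := hδ τ
  refine ⟨χ * χ', mul_ne_zero h0 h0', fun v => ?_⟩
  have hJ := autFactor_ne_zero δ τ
  have hJ' := autFactor_ne_zero γ (δ • τ)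
  have hd := det_eq δ
  have hpi := Complex.two_pi_I_ne_zero
  have e1 : v / autFactor (γ * δ) τ = v / autFactor δ τ / autFactor γ (δ • τ) := by
    rw [autFactor_mul, div_div, mul_comm]
  have e2 : (((γ * δ) 1 0 : ℤ) : ℂ) = ((γ 1 0 : ℤ) : ℂ) * ((δ 0 0 : ℤ) : ℂ) +
      ((γ 1 1 : ℤ) : ℂ) * ((δ 1 0 : ℤ) : ℂ) := by
    simp [Matrix.mul_apply, Fin.sum_univ_two]
  have e3 : (((γ * δ) 1 0 : ℤ) : ℂ) * autFactor δ τ = ((γ 1 0 : ℤ) : ℂ) +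
      ((δ 1 0 : ℤ) : ℂ) * (autFactor γ (δ • τ) * autFactor δ τ) := by
    rw [← autFactor_mul, e2]
    simp only [autFactor]
    simp [Matrix.mul_apply, Fin.sum_univ_two]
    linear_combination ((γ 1 0 : ℤ) : ℂ) * hd
  have e4 : cexp (((γ 1 0 : ℤ) : ℂ) * (v / autFactor δ τ) ^ 2 /
      (4 * Real.pi * I * autFactor γ (δ • τ))) *
      cexp (((δ 1 0 : ℤ) : ℂ) * v ^ 2 / (4 * Real.pi * I * autFactor δ τ)) =
      cexp ((((γ * δ) 1 0 : ℤ) : ℂ) * v ^ 2 / (4 * Real.pi * I * autFactor (γ * δ) τ)) := by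
    rw [← Complex.exp_add, autFactor_mul]
    congr 1
    field_simp
    linear_combination -(v ^ 2) * e3
  rw [e1, mul_smul, h, h', ← e4]
  ring

theorem ThetaLaw.inv {γ : SL(2, ℤ)} (hγ : ThetaLaw γ) : ThetaLaw γ⁻¹ := by
  intro τ
  obtain ⟨χ, h0, h⟩ := hγ (γ⁻¹ • τ)
  have e1 : autFactor γ (γ⁻¹ • τ) * autFactor γ⁻¹ τ = 1 := by
    rw [← autFactor_mul, mul_inv_cancel]; simp [autFactor]
  have hJ := autFactor_ne_zero γ⁻¹ τ
  refine ⟨χ⁻¹, inv_ne_zero h0, fun v => ?_⟩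
  have e2 : autFactor γ (γ⁻¹ • τ) = (autFactor γ⁻¹ τ)⁻¹ := eq_inv_of_mul_eq_one_left e1
  have h1 := h (v / autFactor γ⁻¹ τ)
  rw [smul_inv_smul, e2, div_div, mul_inv_cancel₀ hJ, div_one] at h1
  have e3 : ((γ⁻¹ 1 0 : ℤ) : ℂ) = -((γ 1 0 : ℤ) : ℂ) := by
    rw [Matrix.SpecialLinearGroup.SL2_inv_expl]
    simp
  rw [h1, e3, ← mul_assoc, mul_mul_mul_comm, inv_mul_cancel₀ h0, one_mul, ← Complex.exp_add]
  have e4 : -((γ 1 0 : ℤ) : ℂ) * v ^ 2 / (4 * Real.pi * I * autFactor γ⁻¹ τ) +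
      ((γ 1 0 : ℤ) : ℂ) * (v / autFactor γ⁻¹ τ) ^ 2 / (4 * Real.pi * I * (autFactor γ⁻¹ τ)⁻¹) = 0 := by
    have hpi := Complex.two_pi_I_ne_zero
    field_simp
    ring
  rw [e4, Complex.exp_zero, one_mul]

theorem thetaLaw_S : ThetaLaw ModularGroup.S := by
  intro τ
  have hτ : (τ : ℂ) ≠ 0 := UpperHalfPlane.ne_zero τ
  have hS : ((ModularGroup.S • τ : ℍ) : ℂ) = -1 / τ := by
    rw [coe_smul_eq]; simp [autFactor, ModularGroup.S]
  have hJ : autFactor ModularGroup.S τ = τ := by simp [autFactor, ModularGroup.S]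
  have hc : ((ModularGroup.S 1 0 : ℤ) : ℂ) = 1 := by simp [ModularGroup.S]
  have hs : (-I * (τ : ℂ)) ^ (1 / 2 : ℂ) ≠ 0 := by
    rw [Complex.cpow_ne_zero_iff]
    exact .inl (mul_ne_zero (neg_ne_zero.2 I_ne_zero) hτ)
  refine ⟨(-I * (τ : ℂ)) ^ (1 / 2 : ℂ) * cexp (-Real.pi * I / 2), mul_ne_zero hs (Complex.exp_ne_zero _),
    fun v => ?_⟩
  have hpi := Complex.two_pi_I_ne_zero
  set z : ℂ := v / (2 * Real.pi * I) + (1 + τ) / 2 with hz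
  have h1 : v / τ / (2 * Real.pi * I) + (1 + -1 / (τ : ℂ)) / 2 = z / τ + -1 / τ := by
    rw [hz]; field_simp; ring
  have h2 := jacobiTheta₂_functional_equation z τ
  rw [theta_eq_jacobiTheta₂, theta_eq_jacobiTheta₂, hS, hJ, hc, h1, jacobiTheta₂_add_left', ← hz, h2]
  have h3 : cexp (Real.pi * I * (-1 / (τ : ℂ)) / 4 + v / τ / 2) *
      cexp (-Real.pi * I * (-1 / (τ : ℂ) + 2 * (z / τ))) = cexp (-Real.pi * I / 2) *
      cexp (1 * v ^ 2 / (4 * Real.pi * I * τ)) * cexp (Real.pi * I * τ / 4 + v / 2) *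
      cexp (-Real.pi * I * z ^ 2 / τ) := by
    rw [← Complex.exp_add, ← Complex.exp_add, ← Complex.exp_add, ← Complex.exp_add]
    congr 1
    rw [hz]
    field_simp
    ring_nf
  have hss := mul_inv_cancel₀ hs
  obtain ⟨s, hs'⟩ : ∃ s, s = (-I * (τ : ℂ)) ^ (1 / 2 : ℂ) := ⟨_, rfl⟩
  rw [← hs'] at hss ⊢
  rw [one_div]
  clear hs' h2
  generalize cexp (-Real.pi * I / 2) = E1 at *
  generalize cexp (1 * v ^ 2 / (4 * Real.pi * I * τ)) = E2 at *
  generalize cexp (Real.pi * I * τ / 4 + v / 2) = E3 at *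
  generalize cexp (-Real.pi * I * z ^ 2 / τ) = E4 at *
  linear_combination jacobiTheta₂ (z / τ) (-1 / τ) * h3 -
    E1 * E2 * E3 * E4 * jacobiTheta₂ (z / τ) (-1 / τ) * hss

theorem thetaLaw_T : ThetaLaw ModularGroup.T := by
  intro τ
  have hT : ((ModularGroup.T • τ : ℍ) : ℂ) = τ + 1 := by
    rw [coe_smul_eq]; simp [autFactor, ModularGroup.T]
  have hJ : autFactor ModularGroup.T τ = 1 := by simp [autFactor, ModularGroup.T]
  have hc : ((ModularGroup.T 1 0 : ℤ) : ℂ) = 0 := by simp [ModularGroup.T]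
  refine ⟨cexp (Real.pi * I / 4), Complex.exp_ne_zero _, fun v => ?_⟩
  rw [theta_eq, theta_eq, hT, hJ, hc]
  have h1 : cexp (2 * Real.pi * I * (τ + 1)) = cexp (2 * Real.pi * I * τ) := by
    rw [mul_add, mul_one, Complex.exp_periodic]
  rw [h1, zero_mul, zero_div, Complex.exp_zero, mul_one, div_one, ← mul_assoc, ← Complex.exp_add]
  congr 2
  ring

theorem thetaLaw (γ : SL(2, ℤ)) : ThetaLaw γ := by
  have h : γ ∈ Subgroup.closure {ModularGroup.S, ModularGroup.T} := by
    rw [SpecialLinearGroup.SL2Z_generators]; trivial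
  induction h using Subgroup.closure_induction with
  | mem x hx =>
    rcases hx with rfl | rfl
    · exact thetaLaw_S
    · exact thetaLaw_T
  | one =>
    have h := thetaLaw_T.mul thetaLaw_T.inv
    rwa [mul_inv_cancel] at h
  | mul x y _ _ hx hy => exact hx.mul hy
  | inv x _ hx => exact hx.inv

theorem hasDerivAt_theta (τ : ℍ) (v : ℂ) : DifferentiableAt ℂ (fun v => theta v τ) v := by
  have hq : ‖cexp (2 * Real.pi * I * τ)‖ < 1 := by
    have := norm_qPar_lt_one one_ne_zero τ
    simpa [qPar] using this
  simp only [theta_eq]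
  refine DifferentiableAt.mul (by fun_prop) ?_
  have := (hasDerivAt_thetaSer_exp one_pos 0 hq one_ne_zero (a := 0) (M := 1) v).differentiableAt
  simpa only [one_mul] using this

theorem theta_zero (τ : ℍ) : theta 0 τ = 0 := by
  rw [theta_eq, Complex.exp_zero, thetaSer_at_one, mul_zero]

theorem zagierF_smul (γ : SL(2, ℤ)) (τ : ℍ) (u v : ℂ) :
    zagierF (u / autFactor γ τ) (v / autFactor γ τ) (γ • τ) = autFactor γ τ *
      cexp (((γ 1 0 : ℤ) : ℂ) * u * v / (2 * Real.pi * I * autFactor γ τ)) * zagierF u v τ := by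
  obtain ⟨χ, h0, h⟩ := thetaLaw γ τ
  set J := autFactor γ τ with hJ'
  have hJ : J ≠ 0 := autFactor_ne_zero γ τ
  have hpi := Complex.two_pi_I_ne_zero
  have hder : deriv (fun s => theta s (γ • τ)) 0 = J * χ * deriv (fun s => theta s τ) 0 := by
    have d1 : HasDerivAt (fun s => theta s (γ • τ)) (deriv (fun s => theta s (γ • τ)) 0) (0 / J) := by
      rw [zero_div]; exact (hasDerivAt_theta _ 0).hasDerivAt
    have d2 : HasDerivAt (fun s => theta (s / J) (γ • τ))
        (deriv (fun s => theta s (γ • τ)) 0 * (1 / J)) 0 :=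
      HasDerivAt.comp (h₂ := fun s => theta s (γ • τ)) 0 d1 ((hasDerivAt_id (0 : ℂ)).div_const J)
    simp only [h] at d2
    have d3 : DifferentiableAt ℂ (fun s => χ * cexp (((γ 1 0 : ℤ) : ℂ) * s ^ 2 /
        (4 * Real.pi * I * J))) 0 := by fun_prop
    have d4 := d3.hasDerivAt.mul (hasDerivAt_theta τ 0).hasDerivAt
    have e := d2.unique d4
    rw [theta_zero, mul_zero, zero_add] at e
    rw [zero_pow two_ne_zero, mul_zero, zero_div, Complex.exp_zero, mul_one, mul_one_div,
      div_eq_iff hJ] at e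
    rw [e]
    ring
  rw [zagierF, zagierF, hder, ← add_div, h, h, h]
  have e2 : cexp (((γ 1 0 : ℤ) : ℂ) * (u + v) ^ 2 / (4 * Real.pi * I * J)) =
      cexp (((γ 1 0 : ℤ) : ℂ) * u * v / (2 * Real.pi * I * J)) *
      (cexp (((γ 1 0 : ℤ) : ℂ) * u ^ 2 / (4 * Real.pi * I * J)) *
        cexp (((γ 1 0 : ℤ) : ℂ) * v ^ 2 / (4 * Real.pi * I * J))) := by
    rw [← Complex.exp_add, ← Complex.exp_add]
    congr 1
    field_simp
    ring
  rw [e2]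
  have n1 := Complex.exp_ne_zero (((γ 1 0 : ℤ) : ℂ) * u ^ 2 / (4 * Real.pi * I * J))
  have n2 := Complex.exp_ne_zero (((γ 1 0 : ℤ) : ℂ) * v ^ 2 / (4 * Real.pi * I * J))
  generalize cexp (((γ 1 0 : ℤ) : ℂ) * u ^ 2 / (4 * Real.pi * I * J)) = E1 at *
  generalize cexp (((γ 1 0 : ℤ) : ℂ) * v ^ 2 / (4 * Real.pi * I * J)) = E2 at *
  rw [show χ * E1 * theta u τ * (χ * E2 * theta v τ) =
    (χ * χ * (E1 * E2)) * (theta u τ * theta v τ) by ring]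
  have n3 : χ * χ * (E1 * E2) ≠ 0 := by positivity
  rw [mul_div_assoc', ← mul_div_mul_left _ (theta u τ * theta v τ) n3]
  congr 1
  ring

/-- The function `exp(-yx) F(x, z - x' - yτ, τ)`. -/
def shiftedF (x' y x z : ℂ) (τ : ℍ) : ℂ := cexp (-(y * x)) * jacobiF x (z - x' - y * τ) τ

theorem theta_add_two_pi_I (v : ℂ) (τ : ℍ) : theta (v + 2 * Real.pi * I) τ = -theta v τ := by
  rw [theta_eq, theta_eq, Complex.exp_periodic, add_div, ← add_assoc, Complex.exp_add,
    show (2 * Real.pi * I / 2 : ℂ) = Real.pi * I by ring, Complex.exp_pi_mul_I]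
  ring

theorem theta_add_period (v : ℂ) (τ : ℍ) : theta (v + 2 * Real.pi * I * τ) τ =
    -cexp (-v - Real.pi * I * τ) * theta v τ := by
  have h1 : (v + 2 * Real.pi * I * τ) / (2 * Real.pi * I) + (1 + τ) / 2 =
      v / (2 * Real.pi * I) + (1 + τ) / 2 + τ := by
    have hpi := Complex.two_pi_I_ne_zero
    field_simp
    ring
  have h2 : -(1 : ℂ) = cexp (-(Real.pi * I)) := by
    rw [Complex.exp_neg, Complex.exp_pi_mul_I]; norm_num
  rw [theta_eq_jacobiTheta₂, theta_eq_jacobiTheta₂, h1, jacobiTheta₂_add_left', ← mul_assoc,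
    ← mul_assoc, ← neg_one_mul (cexp _), h2, ← Complex.exp_add, ← Complex.exp_add, ← Complex.exp_add]
  congr 2
  have hpi := Complex.two_pi_I_ne_zero
  field_simp
  ring

theorem jacobiF_add_one (x z : ℂ) (τ : ℍ) : jacobiF x (z + 1) τ = jacobiF x z τ := by
  have h : ∀ v, theta (v + 2 * Real.pi * I) τ = -theta v τ := fun v => theta_add_two_pi_I v τ
  rw [jacobiF, jacobiF, zagierF, zagierF, mul_add, mul_one, ← add_assoc, h, h, mul_neg, mul_neg,
    neg_div_neg_eq]

theorem jacobiF_add_period (x z : ℂ) (τ : ℍ) :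
    jacobiF x (z + τ) τ = cexp (-x) * jacobiF x z τ := by
  rw [jacobiF, jacobiF, zagierF, zagierF, mul_add, ← add_assoc, theta_add_period, theta_add_period]
  have e : cexp (-(x + 2 * Real.pi * I * z) - Real.pi * I * τ) =
      cexp (-x) * cexp (-(2 * Real.pi * I * z) - Real.pi * I * τ) := by
    rw [← Complex.exp_add]; congr 1; ring
  rw [e]
  have n1 := neg_ne_zero.2 (Complex.exp_ne_zero (-(2 * Real.pi * I * z) - Real.pi * I * τ))
  generalize cexp (-(2 * Real.pi * I * z) - Real.pi * I * τ) = E at *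
  rw [mul_left_comm (cexp (-x)), mul_left_comm (theta x τ), mul_div_assoc', ← mul_div_mul_left _ (theta x τ * theta _ τ) n1]
  ring

theorem shiftedF_add_int (x' y x z : ℂ) (τ : ℍ) (m n : ℤ) :
    shiftedF (x' + n) (y + m) x z τ = shiftedF x' y x z τ := by
  have h1 : ∀ x' y, shiftedF (x' + 1) y x z τ = shiftedF x' y x z τ := fun x' y => by
    rw [shiftedF, shiftedF, ← jacobiF_add_one]
    congr 2
    ring
  have h2 : ∀ x' y, shiftedF x' (y + 1) x z τ = shiftedF x' y x z τ := fun x' y => by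
    rw [shiftedF, shiftedF, show z - x' - y * τ = (z - x' - (y + 1) * τ) + τ by ring,
      jacobiF_add_period, ← mul_assoc, ← Complex.exp_add]
    congr 2
    ring
  have h3 : ∀ (n : ℤ) x' y, shiftedF (x' + n) y x z τ = shiftedF x' y x z τ := fun n => by
    induction n with
    | zero => simp
    | succ n ih => intro x' y; rw [← ih x' y, ← h1 (x' + ((n : ℤ) : ℂ)) y]; congr 1; push_cast; ring
    | pred n ih => intro x' y; rw [← ih x' y, ← h1 (x' + _)]; congr 1; push_cast; ring
  have h4 : ∀ (m : ℤ) x' y, shiftedF x' (y + m) x z τ = shiftedF x' y x z τ := fun m => by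
    induction m with
    | zero => simp
    | succ n ih => intro x' y; rw [← ih x' y, ← h2 x' (y + ((n : ℤ) : ℂ))]; congr 1; push_cast; ring
    | pred n ih => intro x' y; rw [← ih x' y, ← h2 x' (y + _)]; congr 1; push_cast; ring
  rw [h3, h4]

theorem shiftedF_smul (γ : SL(2, ℤ)) (τ : ℍ) (x' y x z : ℂ) :
    shiftedF x' y x (z / autFactor γ τ) (γ • τ) =
      autFactor γ τ * cexp (((γ 1 0 : ℤ) : ℂ) * z * x) * shiftedF
        (((γ 0 1 : ℤ) : ℂ) * y + ((γ 1 1 : ℤ) : ℂ) * x')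
        (((γ 0 0 : ℤ) : ℂ) * y + ((γ 1 0 : ℤ) : ℂ) * x') (autFactor γ τ * x) z τ := by
  have hJ := autFactor_ne_zero γ τ
  have hd := det_eq γ
  have hpi := Complex.two_pi_I_ne_zero
  set v := 2 * Real.pi * I * (z - (((γ 0 1 : ℤ) : ℂ) * y + ((γ 1 1 : ℤ) : ℂ) * x') -
    (((γ 0 0 : ℤ) : ℂ) * y + ((γ 1 0 : ℤ) : ℂ) * x') * τ) with hv
  have h1 : 2 * Real.pi * I * (z / autFactor γ τ - x' - y * ((γ • τ : ℍ) : ℂ)) =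
      v / autFactor γ τ := by
    rw [coe_smul_eq, hv]
    field_simp
    rw [autFactor]
    ring
  have h2 := zagierF_smul γ τ (autFactor γ τ * x) v
  rw [mul_div_cancel_left₀ _ hJ] at h2
  rw [shiftedF, shiftedF, jacobiF, jacobiF, h1, h2]
  have h3 : cexp (-(y * x)) * cexp (((γ 1 0 : ℤ) : ℂ) * (autFactor γ τ * x) * v /
      (2 * Real.pi * I * autFactor γ τ)) = cexp (((γ 1 0 : ℤ) : ℂ) * z * x) *
      cexp (-((((γ 0 0 : ℤ) : ℂ) * y + ((γ 1 0 : ℤ) : ℂ) * x') * (autFactor γ τ * x))) := by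
    rw [← Complex.exp_add, ← Complex.exp_add]
    congr 1
    rw [hv]
    field_simp
    rw [autFactor]
    linear_combination x * y * hd
  linear_combination (2 * Real.pi * I * autFactor γ τ * zagierF (autFactor γ τ * x) v τ) * h3

variable {N : ℕ} [NeZero N]

/-- The power series of the connection near the `j`-th component over a cusp. -/
def cuspJet (j : ℤ) (x : ℂ × ℂ) (α : Tors N) : PowerSeries ℂ :=
  jacobiJet N (α.2 - (j : ZMod N)).val (yLift j α) x.1 (x.2 * (rootOf α.1)⁻¹)

theorem holSeriesOn_cuspJet (j : ℤ) (α : Tors N) :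
    HolSeriesOn (fun x => cuspJet j x α) (fiberChart N) :=
  holSeriesOn_fiberChart (ZMod.val_lt _) _ _

theorem cuspJet_zero (j : ℤ) (α : Tors N) {w : ℂ} (hw : w ≠ 0) (hw' : w ^ N ≠ 1) :
    cuspJet j (0, w) α = kzPower j w α :=
  jacobiJet_zero_eq_kzPower (ZMod.val_lt _) j α (by rw [ZMod.val_eq_zero, sub_eq_zero]) hw hw'

theorem constantCoeff_cuspJet (j : ℤ) {x : ℂ × ℂ} (hx : x ∈ fiberChart N) (α : Tors N) :
    PowerSeries.constantCoeff (cuspJet j x α) = 1 :=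
  constantCoeff_jacobiJet (ZMod.val_lt _) _ (norm_lt_one_of_mem_fiberChart hx)
    (thetaSer_ne_zero_of_mem_fiberChart (ZMod.val_lt _) hx α.1)

theorem exists_shiftedF_jet (j : ℤ) (α : Tors N) (τ : ℍ) (z : ℂ)
    (h : (qPar N τ, wPar (z - (j / N : ℂ) * τ)) ∈ fiberChart N) :
    ∃ φ : ℂ → ℂ, AnalyticAt ℂ φ 0 ∧ φ 0 = 1 ∧
      jet φ = cuspJet j (qPar N τ, wPar (z - (j / N : ℂ) * τ)) α ∧
      ∀ᶠ x in 𝓝[≠] (0 : ℂ), shiftedF (xCoord α) (yLift j α) x z τ =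
        2 * Real.pi * I * φ x / x := by
  have hN : (N : ℂ) ≠ 0 := Nat.cast_ne_zero.2 (NeZero.ne N)
  have ha := ZMod.val_lt (α.2 - (j : ZMod N))
  refine exists_jacobiJet ha (yLift j α) (Complex.exp_ne_zero _)
    (norm_qPar_lt_one (NeZero.ne N) τ) (qPar_pow (NeZero.ne N) τ) ?_
    (thetaSer_ne_zero_of_mem_fiberChart ha h α.1)
  rw [wPar, rootOf, ← Complex.exp_neg, qPar, ← Complex.exp_nat_mul, ← Complex.exp_neg,
    ← Complex.exp_add, ← Complex.exp_add, yLift, xCoord]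
  congr 1
  field_simp
  ring

theorem exists_int_of_cast_eq {a b : ℤ} (h : (a : ZMod N) = b) :
    ∃ n : ℤ, (a : ℂ) / N = b / N + n := by
  have hN : (N : ℂ) ≠ 0 := Nat.cast_ne_zero.2 (NeZero.ne N)
  obtain ⟨n, hn⟩ := (ZMod.intCast_eq_intCast_iff_dvd_sub b a N).1 h.symm
  refine ⟨n, ?_⟩
  have : (a : ℂ) = b + N * n := by rw [← sub_eq_iff_eq_add']; exact_mod_cast hn
  rw [this]
  field_simp

theorem hSeries_smul (γ : SL(2, ℤ)) (j : ℤ) (β : Tors N) (τ : ℍ) (z : ℂ)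
    (h : (qPar N τ, wPar (z - (j / N : ℂ) * τ)) ∈ fiberChart N) :
    hSeries β (z / autFactor γ τ) (γ • τ) = (2 * Real.pi * I : ℂ) • tail
      (expSeries (((γ 1 0 : ℤ) : ℂ) * z) * PowerSeries.rescale (autFactor γ τ)
        (cuspJet j (qPar N τ, wPar (z - (j / N : ℂ) * τ)) (torsAct β γ))) := by
  obtain ⟨φ, h1, h2, h3, h4⟩ := exists_shiftedF_jet j (torsAct β γ) τ z h
  have hJ := autFactor_ne_zero γ τ
  set J := autFactor γ τ with hJ'
  have a1 : AnalyticAt ℂ (fun x => cexp (((γ 1 0 : ℤ) : ℂ) * z * x)) 0 := by fun_prop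
  have a2 : AnalyticAt ℂ (fun x => φ (J * x)) 0 := by
    refine AnalyticAt.fun_comp (g := φ) (f := fun x => J * x) ?_ (by fun_prop)
    rwa [mul_zero]
  rw [← jet_cexp, ← h3, ← jet_comp_mul h1, ← jet_mul a1 a2]
  refine taylorSeries_eq (a1.mul a2) ?_
  have t0 : Filter.Tendsto (fun x : ℂ => J * x) (𝓝[≠] 0) (𝓝[≠] 0) := by
    refine tendsto_nhdsWithin_iff.2 ⟨?_, ?_⟩
    · have : Continuous fun x : ℂ => J * x := by fun_prop
      simpa using (this.tendsto 0).mono_left nhdsWithin_le_nhds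
    · filter_upwards [self_mem_nhdsWithin] with x hx
      exact mul_ne_zero hJ hx
  obtain ⟨m, hm⟩ : ∃ m : ℤ, ((γ 0 0 : ℤ) : ℂ) * yCoord β + ((γ 1 0 : ℤ) : ℂ) * xCoord β =
      yLift j (torsAct β γ) + m := by
    obtain ⟨m, hm⟩ := exists_int_of_cast_eq (N := N) (a := γ 0 0 * β.2.val + γ 1 0 * β.1.val)
      (b := j + ((torsAct β γ).2 - (j : ZMod N)).val) (by
        push_cast
        simp [torsAct])
    refine ⟨m, ?_⟩
    rw [yLift, yCoord, xCoord]
    push_cast at hm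
    rw [← hm]
    ring
  obtain ⟨n, hn⟩ : ∃ n : ℤ, ((γ 0 1 : ℤ) : ℂ) * yCoord β + ((γ 1 1 : ℤ) : ℂ) * xCoord β =
      xCoord (torsAct β γ) + n := by
    obtain ⟨n, hn⟩ := exists_int_of_cast_eq (N := N) (a := γ 0 1 * β.2.val + γ 1 1 * β.1.val)
      (b := (torsAct β γ).1.val) (by
        push_cast
        simp [torsAct])
    refine ⟨n, ?_⟩
    rw [yCoord, xCoord, xCoord]
    push_cast at hn
    rw [← hn]
    ring
  filter_upwards [t0.eventually h4, self_mem_nhdsWithin] with x hx hx0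
  have hx0 : x ≠ 0 := hx0
  have h5 := shiftedF_smul γ τ (xCoord β) (yCoord β) x z
  rw [hm, hn, shiftedF_add_int, ← hJ', hx, shiftedF] at h5
  have h6 : z / J - torsPoint β (γ • τ) = z / J - xCoord β - yCoord β * ((γ • τ : ℍ) : ℂ) := by
    rw [torsPoint]; ring
  rw [hFun, h6, h5]
  simp only [Pi.mul_apply, mul_zero, h2, Complex.exp_zero, mul_one]
  field_simp

theorem torsAct_torsAct (α : Tors N) (γ δ : SL(2, ℤ)) :
    torsAct (torsAct α γ) δ = torsAct α (γ * δ) := by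
  simp only [torsAct]
  ext <;> simp [Matrix.mul_apply, Fin.sum_univ_two] <;> ring

theorem torsAct_one (α : Tors N) : torsAct α 1 = α := by
  ext <;> simp [torsAct]

/-- The action of `γ` on torsion sections as a permutation. -/
def torsEquiv (γ : SL(2, ℤ)) : Tors N ≃ Tors N where
  toFun α := torsAct α γ⁻¹
  invFun α := torsAct α γ
  left_inv α := by dsimp only; rw [torsAct_torsAct, inv_mul_cancel, torsAct_one]
  right_inv α := by dsimp only; rw [torsAct_torsAct, mul_inv_cancel, torsAct_one]

theorem exists_isCuspForm (γ : SL(2, ℤ)) (j : ℤ) :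
    ∃ H : ℂ × ℂ → NCSeries (Gen N (⊤ : AddSubgroup (Tors N))) →ₗ[ℂ]
      NCSeries (Gen N (⊤ : AddSubgroup (Tors N))), IsCuspForm ⊤ γ j H ∧
      ∀ w : ℂ, w ≠ 0 → w ^ N ≠ 1 →
        H (0, w) = LieAlgebra.ad ℂ (NCSeries (Gen N (⊤ : AddSubgroup (Tors N))))
          (kzHom j (fun α => hasOrder_genT ⊤ (torsAct α γ⁻¹)) (kzForm w)) := by
  set T : Tors N → NCSeries (Gen N (⊤ : AddSubgroup (Tors N))) :=
    fun α => genT ⊤ (torsAct α γ⁻¹) with hT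
  have hsum : ∑ α, T α = ⁅genX (⊤ : AddSubgroup (Tors N)), genY ⊤⁆ :=
    ((torsEquiv γ).sum_comp (genT ⊤)).trans (sum_genT ⊤)
  refine ⟨fun x => LieAlgebra.ad ℂ _ (x.2⁻¹ • conn ⊤ T (cuspJet j x)), ⟨fun v l => ?_,
    fun τ z h v l => ?_⟩, fun w hw hw' => ?_⟩
  · simp only [LieAlgebra.ad_apply]
    refine differentiableOn_lie (fun l => ?_) v l
    simp only [NCSeries.smul_apply]
    exact (differentiableOn_snd.inv fun x hx => ne_zero_of_mem_fiberChart hx).mul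
      (differentiableOn_conn (fun α => holSeriesOn_cuspJet j α) _ _)
  · have hJ := autFactor_ne_zero γ τ
    have hpi := Complex.two_pi_I_ne_zero
    have hw : wPar (z - (j / N : ℂ) * τ) ≠ 0 := Complex.exp_ne_zero _
    set Φ := cuspJet j (qPar N τ, wPar (z - (j / N : ℂ) * τ)) with hΦ
    have h1 : nu2 ⊤ (γ • τ) (z / autFactor γ τ) = (2 * Real.pi * I : ℂ) • conn ⊤ T fun α =>
        expSeries (((γ 1 0 : ℤ) : ℂ) * z) * PowerSeries.rescale (autFactor γ τ) (Φ α) := by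
      rw [nu2, conn, smul_add, Finset.smul_sum, ← (torsEquiv γ).sum_comp]
      congr 1
      refine Finset.sum_congr rfl fun α _ => ?_
      rw [hSeries_smul γ j _ τ z h, actX_smul, torsEquiv, Equiv.coe_fn_mk, torsAct_torsAct,
        inv_mul_cancel, torsAct_one]
    have h2 : autFrame ⊤ γ τ z (conn ⊤ T Φ) = (((γ 1 0 : ℤ) : ℂ) / (2 * Real.pi * I)) • genX ⊤ +
        (autFactor γ τ)⁻¹ • conn ⊤ T fun α =>
        expSeries (((γ 1 0 : ℤ) : ℂ) * z) * PowerSeries.rescale (autFactor γ τ) (Φ α) := by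
      rw [autFrame_eq, actX_conn hsum (constantCoeff_cuspJet j h) (constantCoeff_expSeries _),
        modHom_conn]
      congr 3
      ext1 α
      rw [map_mul, rescale_expSeries, mul_div_cancel₀ _ hJ]
    have h3 : (2 * Real.pi * I : ℂ) • autFrame ⊤ γ τ z (conn ⊤ T Φ) =
        ((γ 1 0 : ℤ) : ℂ) • genX ⊤ + (autFactor γ τ)⁻¹ • nu2 ⊤ (γ • τ) (z / autFactor γ τ) := by
      rw [h2, h1, smul_add, smul_smul, mul_div_cancel₀ _ hpi, smul_comm]
    have h4 : (2 * Real.pi * I * wPar (z - (j / N : ℂ) * τ) : ℂ) •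
        (LieAlgebra.ad ℂ (NCSeries (Gen N (⊤ : AddSubgroup (Tors N))))
          ((wPar (z - (j / N : ℂ) * τ))⁻¹ • conn ⊤ T Φ)) v =
        (2 * Real.pi * I : ℂ) • ⁅conn ⊤ T Φ, v⁆ := by
      rw [map_smul, LinearMap.smul_apply, smul_smul, mul_inv_cancel_right₀ hw]; rfl
    dsimp only
    rw [h4, deriv_autFrame, autFrame_smul, autFrame_lie, ← smul_lie, h3, add_lie, NCSeries.add_apply,
      smul_lie, NCSeries.smul_apply, smul_lie, NCSeries.smul_apply]
    rfl
  · have h1 : cuspJet j (0, w) = kzPower j w := funext fun α => cuspJet_zero j α hw hw'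
    dsimp only
    rw [kzHom_kzForm j _ hw, h1]

end Modular

/-! ### Extension to the completed group algebra -/

section Extension

variable {σ : Type} {Γ Γ' : Type} [Group Γ] [Group Γ']

theorem eq_one_of_mul_self {e : NCSeries σ} (h : e * e = e) (h1 : e [] = 1) : e = 1 := by
  have h2 : HasOrder 1 (e - 1) := by
    rw [hasOrder_one_iff, sub_apply, h1, one_apply]; simp
  have h3 : (e - 1) * (e - 1) = -(e - 1) := by rw [mul_sub, sub_mul, h]; simp
  have h4 : ∀ n, HasOrder n (e - 1) := fun n => by
    induction n with
    | zero => exact hasOrder_zero _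
    | succ n ih =>
      have := (ih.mul h2).smul (-1)
      rwa [h3, neg_one_smul, neg_neg] at this
  rw [← sub_eq_zero]
  exact NCSeries.ext fun w => h4 (w.length + 1) w (Nat.lt_succ_self _)

/-- The linear extension of a group homomorphism to the series with constant term `1`. -/
def linExtend (Θ : Γ →* NCSeries σ) : MonoidAlgebra ℂ Γ →ₐ[ℂ] NCSeries σ :=
  MonoidAlgebra.lift ℂ (NCSeries σ) Γ Θ

theorem linExtend_eq (Θ : Γ →* NCSeries σ) (y : MonoidAlgebra ℂ Γ) :
    linExtend Θ y = y.coeff.sum fun g a => a • Θ g := MonoidAlgebra.lift_apply _ _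

theorem linExtend_nil {Θ : Γ →* NCSeries σ} (hΘ : ∀ g, Θ g [] = 1) (y : MonoidAlgebra ℂ Γ) :
    linExtend Θ y [] = Bialgebra.counitAlgHom ℂ (MonoidAlgebra ℂ Γ) y := by
  let ε : NCSeries σ →ₗ[ℂ] ℂ :=
    { toFun := fun f => f [], map_add' := fun _ _ => rfl, map_smul' := fun _ _ => rfl }
  have : ε ∘ₗ (linExtend Θ).toLinearMap =
      (Bialgebra.counitAlgHom ℂ (MonoidAlgebra ℂ Γ)).toLinearMap := by
    refine MonoidAlgebra.lhom_ext' fun g => LinearMap.ext_ring ?_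
    simp only [ε, linExtend]
    simp
    exact hΘ g
  exact LinearMap.congr_fun this y

theorem hasOrder_linExtend {Θ : Γ →* NCSeries σ} (hΘ : ∀ g, Θ g [] = 1) (n : ℕ)
    {y : MonoidAlgebra ℂ Γ} (hy : y ∈ augIdeal Γ ^ n) : HasOrder n (linExtend Θ y) := by
  induction n generalizing y with
  | zero => exact hasOrder_zero _
  | succ n ih =>
    rw [Submodule.pow_succ] at hy
    refine Submodule.mul_induction_on hy (fun a ha b hb => ?_) fun a b ha hb => ?_
    · rw [map_mul]
      refine (ih ha).mul (hasOrder_one_iff.2 ?_)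
      rw [linExtend_nil hΘ]
      exact hb
    · rw [map_add]; exact ha.add hb

theorem extendToCompletion_apply {Θ : Γ →* NCSeries σ} (hΘ : ∀ g, Θ g [] = 1)
    (u : completedGroupAlgebra Γ) {n : ℕ} {y : MonoidAlgebra ℂ Γ}
    (hy : Ideal.Quotient.mk (augIdeal Γ ^ n) y = u.1 n) {w : List σ} (hw : w.length < n) :
    extendToCompletion Θ u w = linExtend Θ y w := by
  have h1 := Function.surjInv_eq Ideal.Quotient.mk_surjective (u.1 (w.length + 1))
  rw [extendToCompletion, ← linExtend_eq]
  set x := Function.surjInv Ideal.Quotient.mk_surjective (u.1 (w.length + 1))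
  have h2 : Ideal.Quotient.mk (augIdeal Γ ^ (w.length + 1)) y = u.1 (w.length + 1) := by
    have := u.2 (w.length + 1) n hw
    rw [← hy] at this
    exact this
  rw [← h1, Ideal.Quotient.mk_eq_mk_iff_sub_mem] at h2
  have h3 := hasOrder_linExtend hΘ _ h2 w (Nat.lt_succ_self _)
  rw [map_sub, sub_apply, sub_eq_zero] at h3
  exact h3.symm

theorem linExtend_mapDomain (Θ : Γ' →* NCSeries σ) (f : Γ →* Γ') (y : MonoidAlgebra ℂ Γ) :
    linExtend Θ (MonoidAlgebra.mapDomainAlgHom ℂ ℂ f y) = linExtend (Θ.comp f) y := by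
  have : (linExtend Θ).comp (MonoidAlgebra.mapDomainAlgHom ℂ ℂ f) = linExtend (Θ.comp f) := by
    ext g; simp [linExtend]
  exact AlgHom.congr_fun this y

theorem extendToCompletion_completedMap {Θ : Γ' → NCSeries σ} (hmul : ∀ g h, Θ (g * h) = Θ g * Θ h)
    (hΘ : ∀ g, Θ g [] = 1) (f : Γ →* Γ') (u : completedGroupAlgebra Γ) {n : ℕ}
    {y : MonoidAlgebra ℂ Γ} (hy : Ideal.Quotient.mk (augIdeal Γ ^ n) y = u.1 n) {w : List σ}
    (hw : w.length < n) : extendToCompletion Θ (completedMap f u) w =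
      (y.coeff.sum fun g a => a • Θ (f g)) w := by
  let Θ' : Γ' →* NCSeries σ :=
    { toFun := Θ
      map_one' := eq_one_of_mul_self (by rw [← hmul, mul_one]) (hΘ 1)
      map_mul' := hmul }
  have h1 : Ideal.Quotient.mk (augIdeal Γ' ^ n) (MonoidAlgebra.mapDomainAlgHom ℂ ℂ f y) =
      (completedMap f u).1 n := by
    change _ = Ideal.quotientMapₐ _ _ _ (u.1 n)
    rw [← hy]; rfl
  rw [show Θ = ⇑Θ' from rfl, extendToCompletion_apply (Θ := Θ') hΘ _ h1 hw, linExtend_mapDomain,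
    linExtend_eq]
  rfl

end Extension

/-! ### The monodromy of the cyclotomic KZ connection -/

section KZMonodromy

open Complex

variable {N : ℕ} [NeZero N]

theorem isConnForm_kzForm : IsConnForm (kzForm (N := N)) {w : ℂ | w ≠ 0 ∧ w ^ N ≠ 1} where
  isOpen := isOpen_ne.inter (isOpen_ne.preimage (continuous_pow N))
  nil w := by
    simp [kzForm, sum_apply, letter]
  diff l := by
    simp only [kzForm, NCSeries.add_apply, NCSeries.smul_apply, NCSeries.sum_apply]
    refine (DifferentiableOn.mul_const (differentiableOn_id.inv fun w hw => hw.1) _).add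
      (DifferentiableOn.fun_sum fun k _ => DifferentiableOn.mul_const
        (DifferentiableOn.inv (by fun_prop) fun w hw h => hw.2 ?_) _)
    rw [sub_eq_zero.1 h, rootOf_pow]

theorem kzMonodromy_eq {x : PuncturedLine N} {g : PiOne (PuncturedLine N) x} (β : Path x x)
    (hβ : Path.Homotopic.Quotient.mk β = FundamentalGroup.toPath g.unop)
    {T : unitInterval → NCSeries (KZLetter N)} (hT : IsTransport kzForm (fun t => (β t).1) T) :
    kzMonodromy x g = T 1 := by
  have h := Classical.epsilon_spec (p := fun a => ∃ (β : Path x x)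
    (T : unitInterval → NCSeries (KZLetter N)),
    Path.Homotopic.Quotient.mk β = FundamentalGroup.toPath g.unop ∧
    IsTransport kzForm (fun t => (β t).1) T ∧ a = T 1) ⟨T 1, β, T, hβ, hT, rfl⟩
  obtain ⟨β', T', h1, h2, h3⟩ := h
  refine h3.trans (IsTransport.eq_of_homotopicRel isConnForm_kzForm
    (γ := β'.toContinuousMap) (γ' := β.toContinuousMap) ?_ h2 hT)
  exact Path.Homotopic.Quotient.exact (h1.trans hβ.symm)

theorem exists_kzTransport {x : PuncturedLine N} (β : Path x x) :
    ∃ T : unitInterval → NCSeries (KZLetter N), IsTransport kzForm (fun t => (β t).1) T :=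
  exists_isTransport isConnForm_kzForm β.toContinuousMap

theorem kzMonodromy_nil (x : PuncturedLine N) (g : PiOne (PuncturedLine N) x) :
    kzMonodromy x g [] = 1 := by
  obtain ⟨β, hβ⟩ := Path.Homotopic.Quotient.mk_surjective (FundamentalGroup.toPath g.unop)
  obtain ⟨T, hT⟩ := exists_kzTransport β
  rw [kzMonodromy_eq β hβ hT]
  exact IsLocSol.apply_nil isConnForm_kzForm.nil (by fun_prop) hT.2 (t₀ := 0)
    (by rw [hT.1]; simp [one_apply]) 1

theorem kzMonodromy_mul (x : PuncturedLine N) (g h : PiOne (PuncturedLine N) x) :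
    kzMonodromy x (g * h) = kzMonodromy x g * kzMonodromy x h := by
  obtain ⟨β, hβ⟩ := Path.Homotopic.Quotient.mk_surjective (FundamentalGroup.toPath g.unop)
  obtain ⟨T, hT⟩ := exists_kzTransport β
  obtain ⟨β', hβ'⟩ := Path.Homotopic.Quotient.mk_surjective (FundamentalGroup.toPath h.unop)
  obtain ⟨T', hT'⟩ := exists_kzTransport β'
  obtain ⟨T'', hT''⟩ := exists_kzTransport (β.trans β')
  rw [kzMonodromy_eq β hβ hT, kzMonodromy_eq β' hβ' hT', kzMonodromy_eq (β.trans β') ?_ hT'']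
  · refine IsTransport.trans isConnForm_kzForm.nil (β.map continuous_subtype_val)
      (β'.map continuous_subtype_val) hT hT' ?_
    rw [← Path.map_trans]
    exact hT''
  · rw [Path.Homotopic.Quotient.mk_trans, hβ, hβ']
    rfl

end KZMonodromy

/-! ### The KZB connection on a fixed curve -/

section Curve

open Complex
open scoped UpperHalfPlane

variable {N : ℕ} [NeZero N] {S : AddSubgroup (Tors N)} {τ : ℍ}

/-- The complement of the lifts of the torsion points in `S`. -/
def curveDomain (S : AddSubgroup (Tors N)) (τ : ℍ) : Set ℂ :=
  {z | ∀ α ∈ S, (QuotientAddGroup.mk z : ℂ ⧸ lattice τ) ≠ QuotientAddGroup.mk (torsPoint α τ)}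

theorem thetaSer_ne_zero_of_mem_curveDomain {z : ℂ} {α : Tors N}
    (h : (QuotientAddGroup.mk z : ℂ ⧸ lattice τ) ≠ QuotientAddGroup.mk (torsPoint α τ)) :
    thetaSer N α.2.val 0 (qPar N τ) (wPar z * (rootOf α.1)⁻¹) ≠ 0 := fun h0 => h <| by
  have hN := NeZero.ne N
  have hq0 : qPar N τ ≠ 0 := Complex.exp_ne_zero _
  have hpi := Complex.two_pi_I_ne_zero
  rw [thetaSer_eq_base (ZMod.val_lt _) hq0, ← wPar_sub_torsPoint hN α rfl τ z] at h0
  obtain ⟨m, hm⟩ := exists_eq_zpow_of_thetaSer_eq_zero (pow_ne_zero _ hq0)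
    (norm_pow_lt_one hN (norm_qPar_lt_one hN τ)) (Complex.exp_ne_zero _) h0
  rw [qPar_pow hN, ← Complex.exp_int_mul, Complex.exp_eq_exp_iff_exists_int] at hm
  obtain ⟨n, hn⟩ := hm
  rw [eq_comm, QuotientAddGroup.eq, mem_lattice]
  refine ⟨m, n, mul_left_cancel₀ hpi ?_⟩
  linear_combination hn

theorem hSeries_eq_idJet_self {z : ℂ} {α : Tors N}
    (h : (QuotientAddGroup.mk z : ℂ ⧸ lattice τ) ≠ QuotientAddGroup.mk (torsPoint α τ)) :
    hSeries α z τ = (2 * Real.pi * I : ℂ) • tail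
      (jacobiJet N α.2.val (yCoord α) (qPar N τ) (wPar z * (rootOf α.1)⁻¹)) :=
  hSeries_eq (ZMod.val_lt _) rfl τ z (thetaSer_ne_zero_of_mem_curveDomain h)

theorem nu2_nil (τ : ℍ) (z : ℂ) : nu2 S τ z [] = 0 := by
  refine hasOrder_one_iff.1 (((hasOrder_genY S).smul _).add
    (HasOrder.sum fun α _ => HasOrder.actX S _ (hasOrder_genT S α)))

instance discreteTopology_lattice : DiscreteTopology (lattice τ) := by
  refine discreteTopology_of_isOpen_singleton_zero ?_
  rw [Metric.isOpen_singleton_iff]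
  refine ⟨min 1 τ.im, lt_min one_pos τ.im_pos, ?_⟩
  rintro ⟨z, hz⟩ h
  rw [Subtype.dist_eq, ZeroMemClass.coe_zero, dist_zero_right, lt_min_iff] at h
  obtain ⟨m, n, rfl⟩ := mem_lattice.1 hz
  have h1 := (Complex.abs_im_le_norm _).trans_lt h.2
  have h2 : ((m * τ + n : ℂ)).im = m * τ.im := by simp
  rw [h2, abs_mul, abs_of_pos τ.im_pos, mul_lt_iff_lt_one_left τ.im_pos] at h1
  have hm : m = 0 := Int.abs_lt_one_iff.1 (by exact_mod_cast h1)
  subst hm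
  have h3 : ‖((0 : ℤ) * τ + n : ℂ)‖ < 1 := h.1
  rw [Int.cast_zero, zero_mul, zero_add, Complex.norm_intCast] at h3
  have hn : n = 0 := Int.abs_lt_one_iff.1 (by exact_mod_cast h3)
  subst hn
  ext
  simp

theorem isOpen_curveDomain : IsOpen (curveDomain S τ) := by
  have hc : IsClosed (lattice τ : Set ℂ) := AddSubgroup.isClosed_of_discrete
  have : curveDomain S τ = ⋂ α : Tors N, ⋂ _ : α ∈ S,
      (fun z => -z + torsPoint α τ) ⁻¹' (lattice τ : Set ℂ)ᶜ := by
    ext z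
    simp only [curveDomain, ne_eq, QuotientAddGroup.eq, Set.mem_ofPred_eq, Set.mem_iInter,
      Set.mem_preimage, Set.mem_compl_iff, SetLike.mem_coe]
  rw [this]
  exact isOpen_iInter_of_finite fun α => isOpen_iInter_of_finite fun _ =>
    hc.isOpen_compl.preimage (by fun_prop)

theorem isConnForm_nu2 : IsConnForm (nu2 S τ) (curveDomain S τ) where
  isOpen := isOpen_curveDomain
  nil := nu2_nil τ
  diff l := by
    simp only [nu2, NCSeries.add_apply, NCSeries.sum_apply]
    refine (differentiableOn_const _).add (DifferentiableOn.fun_sum fun α _ => ?_)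
    by_cases hα : α ∈ S
    · have hP : HolSeriesOn (fun z => hSeries α z τ) (curveDomain S τ) := by
        have := (((holSeriesOn_jacobiJet (ZMod.val_lt α.2) (yCoord α)).comp
          (g := fun z : ℂ => (qPar N τ, wPar z * (rootOf α.1)⁻¹)) (V := curveDomain S τ)
          (by unfold wPar; fun_prop) fun z hz => ⟨norm_qPar_lt_one (NeZero.ne N) τ,
            mul_ne_zero (Complex.exp_ne_zero _) (inv_ne_zero (rootOf_ne_zero _)),
            thetaSer_ne_zero_of_mem_curveDomain (hz α hα)⟩).tail).smul (2 * Real.pi * I)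
        intro n
        refine (this n).congr fun z hz => ?_
        simp only [hSeries_eq_idJet_self (hz α hα)]
      exact differentiableOn_actX hP _ l
    · simp only [genT_of_not_mem S hα, actX, adSeries_zero]
      exact differentiableOn_const _

theorem exists_hSeries_jet {z : ℂ} {α : Tors N}
    (h : (QuotientAddGroup.mk z : ℂ ⧸ lattice τ) ≠ QuotientAddGroup.mk (torsPoint α τ)) :
    ∃ P : PowerSeries ℂ, PowerSeries.constantCoeff P = 1 ∧ ∀ m n : ℤ,
      hSeries α (z + (m * τ + n)) τ = (2 * Real.pi * I : ℂ) • tail (expSeries (-(m : ℂ)) * P) := by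
  have hN := NeZero.ne N
  obtain ⟨φ, h1, h2, h3, h4⟩ := exists_jacobiJet (p := qPar N τ) (ZMod.val_lt α.2) (yCoord α)
    (Complex.exp_ne_zero _) (norm_qPar_lt_one hN τ) (qPar_pow hN τ)
    (wPar_sub_torsPoint hN α rfl τ z) (thetaSer_ne_zero_of_mem_curveDomain h)
  refine ⟨jet φ, by rw [constantCoeff_jet, h2], fun m n => ?_⟩
  have a1 : AnalyticAt ℂ (fun x => cexp (-(m : ℂ) * x)) 0 := by fun_prop
  rw [← jet_cexp, ← jet_mul a1 h1]
  refine taylorSeries_eq (a1.mul h1) ?_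
  filter_upwards [h4, self_mem_nhdsWithin] with x hx hx0
  have h5 := shiftedF_add_int (xCoord α) (yCoord α) x (z + (m * τ + n)) τ (m := m) (n := n)
  have h6 : z + (m * τ + n) - (xCoord α + n) - (yCoord α + m) * τ = z - torsPoint α τ := by
    rw [torsPoint]; ring
  have h7 : z + (m * τ + n) - torsPoint α τ = z + (m * τ + n) - xCoord α - yCoord α * τ := by
    rw [torsPoint]; ring
  have h8 : cexp (-((yCoord α + m) * x)) = cexp (-(m : ℂ) * x) * cexp (-(yCoord α * x)) := by
    rw [← Complex.exp_add]; congr 1; ring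
  rw [shiftedF, shiftedF, h6, h8, mul_assoc, hx] at h5
  rw [hFun, h7, ← h5]
  simp only [Pi.mul_apply, mul_zero, h2, Complex.exp_zero, mul_one]
  ring

/-- The quasi-periodicity of the connection. -/
theorem nu2_add_period {z : ℂ} (hz : z ∈ curveDomain S τ) (m n : ℤ) :
    nu2 S τ z * expX S m = expX S m * nu2 S τ (z + (m * τ + n)) := by
  classical
  have h : ∀ α : Tors N, ∃ P : PowerSeries ℂ, PowerSeries.constantCoeff P = 1 ∧ (α ∈ S → ∀ m n : ℤ,
      hSeries α (z + (m * τ + n)) τ =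
        (2 * Real.pi * I : ℂ) • tail (expSeries (-(m : ℂ)) * P)) := fun α => by
    by_cases hα : α ∈ S
    · obtain ⟨P, h1, h2⟩ := exists_hSeries_jet (hz α hα)
      exact ⟨P, h1, fun _ => h2⟩
    · exact ⟨1, map_one _, fun h => absurd h hα⟩
  choose P h1 h2 using h
  have key : ∀ m n : ℤ, nu2 S τ (z + (m * τ + n)) = (2 * Real.pi * I : ℂ) •
      conn S (genT S) fun α => expSeries (-(m : ℂ)) * P α := fun m n => by
    rw [nu2, sum_actX_genT_congr fun α hα => h2 α hα m n, conn, smul_add, Finset.smul_sum]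
    simp only [actX_smul]
  have k0 : nu2 S τ z = (2 * Real.pi * I : ℂ) • conn S (genT S) P := by
    have := key 0 0
    simpa [expSeries_zero] using this
  have k1 : expX S (-(m : ℂ)) * nu2 S τ z * expX S m = nu2 S τ (z + (m * τ + n)) := by
    have := evalSeries_rescale_exp_mul (-(m : ℂ)) (hasOrder_genX S) (nu2 S τ z)
    rw [neg_neg] at this
    refine this.trans ?_
    rw [key, ← actX_conn (sum_genT S) h1 (constantCoeff_expSeries _), k0, adSeries_smul]
    rfl
  rw [← k1, ← mul_assoc, ← mul_assoc, expX_mul, add_neg_cancel, expX_zero, one_mul]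

theorem isDiscrete_lattice : IsDiscrete (lattice τ : Set ℂ) := ⟨discreteTopology_lattice⟩

theorem isCoveringMap_mk : IsCoveringMap (fun z : ℂ => (QuotientAddGroup.mk z : ℂ ⧸ lattice τ)) :=
  (AddSubgroup.isAddQuotientCoveringMap_of_comm (lattice τ) isDiscrete_lattice).isCoveringMap

theorem lattice_ext {m n m' n' : ℤ} (h : (m * τ + n : ℂ) = m' * τ + n') : m = m' ∧ n = n' := by
  have h1 := congrArg Complex.im h
  simp at h1
  have h2 : m = m' := by
    rcases h1 with h1 | h1
    · exact_mod_cast h1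
    · exact absurd h1 τ.im_pos.ne'
  subst h2
  exact ⟨rfl, by exact_mod_cast add_left_cancel h⟩

/-- The covering of the punctured curve. -/
def curveCover (S : AddSubgroup (Tors N)) (τ : ℍ) : curveDomain S τ → PuncturedCurve S τ :=
  Set.restrictPreimage {P : ℂ ⧸ lattice τ | ∀ α ∈ S, P ≠ QuotientAddGroup.mk (torsPoint α τ)}
    QuotientAddGroup.mk

theorem isCoveringMap_curveCover : IsCoveringMap (curveCover S τ) :=
  isCoveringMap_mk.restrictPreimage _

end Curve

section CurveMonodromy

open Complex
open scoped UpperHalfPlane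

variable {N : ℕ} [NeZero N] {S : AddSubgroup (Tors N)} {τ : ℍ} {z₀ : ℂ} {x : PuncturedCurve S τ}

theorem IsLocSol.translate {σ X : Type} [TopologicalSpace X] {f : ℂ → NCSeries σ} {γ : X → ℂ}
    {T : X → NCSeries σ} (h : IsLocSol f γ T) {v : ℂ} {a : NCSeries σ}
    (hf : ∀ t, ∀ᶠ z in 𝓝 (γ t), f z * a = a * f (z + v)) :
    IsLocSol f (fun t => γ t + v) (fun t => T t * a) := fun t => by
  obtain ⟨Φ, h1, h2⟩ := h t
  refine ⟨fun z => Φ (z - v) * a, ?_, h2.mono fun s hs => ?_⟩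
  · have hc : Filter.Tendsto (fun z : ℂ => z - v) (𝓝 (γ t + v)) (𝓝 (γ t)) := by
      have : Continuous fun z : ℂ => z - v := by fun_prop
      simpa using this.tendsto (γ t + v)
    filter_upwards [hc.eventually h1, hc.eventually (hf t)] with z h3 h4
    refine IsSol.comp (g := fun z => z - v) (g' := 1) (Φ := fun z => Φ z * a)
      ((hasDerivAt_id z).sub_const v) (h3.mul_const (g := fun s => f (s + v)) h4) ?_
    simp
  · simp [hs]

/-- A lift of a loop on the punctured curve, with the transport of the connection along it. -/
structure IsLoopLift (S : AddSubgroup (Tors N)) (τ : ℍ) (z₀ : ℂ) {x : PuncturedCurve S τ}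
    (g : PiOne (PuncturedCurve S τ) x) (β : Path x x) (γ : C(unitInterval, ℂ))
    (T : unitInterval → NCSeries (Gen N S)) (m n : ℤ) : Prop where
  class_eq : Path.Homotopic.Quotient.mk β = FundamentalGroup.toPath g.unop
  zero : γ 0 = z₀
  lifts : ∀ t, (QuotientAddGroup.mk (γ t) : ℂ ⧸ lattice τ) = (β t).1
  one : γ 1 = z₀ + m * τ + n
  transport : IsTransport (nu2 S τ) γ T

theorem IsLoopLift.mem {g : PiOne (PuncturedCurve S τ) x} {β : Path x x} {γ : C(unitInterval, ℂ)}
    {T : unitInterval → NCSeries (Gen N S)} {m n : ℤ} (h : IsLoopLift S τ z₀ g β γ T m n)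
    (t : unitInterval) : γ t ∈ curveDomain S τ := fun α hα => by
  rw [h.lifts]; exact (β t).2 α hα

theorem IsLoopLift.unique {g : PiOne (PuncturedCurve S τ) x} {β β' : Path x x}
    {γ γ' : C(unitInterval, ℂ)} {T T' : unitInterval → NCSeries (Gen N S)} {m n m' n' : ℤ}
    (h : IsLoopLift S τ z₀ g β γ T m n) (h' : IsLoopLift S τ z₀ g β' γ' T' m' n') :
    T 1 = T' 1 ∧ m = m' := by
  let Γ : C(unitInterval, curveDomain S τ) := ⟨fun t => ⟨γ t, h.mem t⟩, by fun_prop⟩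
  let Γ' : C(unitInterval, curveDomain S τ) := ⟨fun t => ⟨γ' t, h'.mem t⟩, by fun_prop⟩
  have h0 : Γ 0 = Γ' 0 := Subtype.ext (h.zero.trans h'.zero.symm)
  have e1 : (ContinuousMap.comp ⟨curveCover S τ, isCoveringMap_curveCover.continuous⟩ Γ) =
      β.toContinuousMap := by ext1 t; exact Subtype.ext (h.lifts t)
  have e2 : (ContinuousMap.comp ⟨curveCover S τ, isCoveringMap_curveCover.continuous⟩ Γ') =
      β'.toContinuousMap := by ext1 t; exact Subtype.ext (h'.lifts t)
  have hom : Γ.HomotopicRel Γ' {0, 1} := by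
    refine (isCoveringMap_curveCover.homotopicRel_iff_comp (f₀ := Γ) (f₁ := Γ') (S := {0, 1})
      ⟨0, Or.inl rfl, h0⟩).2 ?_
    rw [e1, e2]
    exact Path.Homotopic.Quotient.exact (h.class_eq.trans h'.class_eq.symm)
  refine ⟨IsTransport.eq_of_homotopicRel isConnForm_nu2 hom h.transport h'.transport, ?_⟩
  have h1 : γ 1 = γ' 1 := congrArg Subtype.val (hom.some.fst_eq_snd (x := 1) (Or.inr rfl))
  rw [h.one, h'.one, add_assoc, add_assoc] at h1
  exact (lattice_ext (add_left_cancel h1)).1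

theorem curveMonodromy_eq {g : PiOne (PuncturedCurve S τ) x} {β : Path x x}
    {γ : C(unitInterval, ℂ)} {T : unitInterval → NCSeries (Gen N S)} {m n : ℤ}
    (h : IsLoopLift S τ z₀ g β γ T m n) :
    curveMonodromy S τ z₀ x g = T 1 * expX S (-(m : ℂ)) := by
  have h' := Classical.epsilon_spec (p := fun a => ∃ (β : Path x x) (γ : C(unitInterval, ℂ))
    (T : unitInterval → NCSeries (Gen N S)) (m n : ℤ),
    Path.Homotopic.Quotient.mk β = FundamentalGroup.toPath g.unop ∧
    γ 0 = z₀ ∧ (∀ t, (QuotientAddGroup.mk (γ t) : ℂ ⧸ lattice τ) = (β t).1) ∧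
    γ 1 = z₀ + m * τ + n ∧ IsTransport (nu2 S τ) γ T ∧ a = T 1 * expX S (-(m : ℂ)))
    ⟨_, β, γ, T, m, n, h.class_eq, h.zero, h.lifts, h.one, h.transport, rfl⟩
  obtain ⟨β', γ', T', m', n', h1, h2, h3, h4, h5, h6⟩ := h'
  obtain ⟨h7, h8⟩ := h.unique ⟨h1, h2, h3, h4, h5⟩
  rw [h7, h8]
  exact h6

theorem exists_isLoopLift (hx : (QuotientAddGroup.mk z₀ : ℂ ⧸ lattice τ) = x.1)
    (g : PiOne (PuncturedCurve S τ) x) : ∃ (β : Path x x) (γ : C(unitInterval, ℂ))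
      (T : unitInterval → NCSeries (Gen N S)) (m n : ℤ), IsLoopLift S τ z₀ g β γ T m n := by
  obtain ⟨β, hβ⟩ := Path.Homotopic.Quotient.mk_surjective (FundamentalGroup.toPath g.unop)
  have hz₀ : z₀ ∈ curveDomain S τ := fun α hα => by rw [hx]; exact x.2 α hα
  obtain ⟨Γ, h1, h2⟩ := isCoveringMap_curveCover.exists_path_lifts β.toContinuousMap
    (⟨z₀, hz₀⟩ : curveDomain S τ) (β.source.trans (Subtype.ext hx.symm))
  obtain ⟨T, hT⟩ := exists_isTransport isConnForm_nu2 Γ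
  have h3 : ∀ t, (QuotientAddGroup.mk (Γ t : ℂ) : ℂ ⧸ lattice τ) = (β t).1 :=
    fun t => congrArg Subtype.val (congrFun h1 t)
  have h4 : (QuotientAddGroup.mk z₀ : ℂ ⧸ lattice τ) = QuotientAddGroup.mk (Γ 1 : ℂ) := by
    rw [h3, β.target, hx]
  rw [QuotientAddGroup.eq, mem_lattice] at h4
  obtain ⟨m, n, h5⟩ := h4
  exact ⟨β, ⟨fun t => Γ t, by fun_prop⟩, T, m, n, hβ, congrArg Subtype.val h2, h3,
    by rw [add_assoc, ← h5]; simp, hT⟩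

theorem curveMonodromy_nil (hx : (QuotientAddGroup.mk z₀ : ℂ ⧸ lattice τ) = x.1)
    (g : PiOne (PuncturedCurve S τ) x) : curveMonodromy S τ z₀ x g [] = 1 := by
  obtain ⟨β, γ, T, m, n, h⟩ := exists_isLoopLift hx g
  rw [curveMonodromy_eq h, mul_nil, expX_nil, mul_one]
  exact IsLocSol.apply_nil (nu2_nil τ) γ.continuous h.transport.2 (t₀ := 0)
    (by rw [h.transport.1]; simp [one_apply]) 1

theorem curveMonodromy_mul (hx : (QuotientAddGroup.mk z₀ : ℂ ⧸ lattice τ) = x.1)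
    (g h : PiOne (PuncturedCurve S τ) x) : curveMonodromy S τ z₀ x (g * h) =
      curveMonodromy S τ z₀ x g * curveMonodromy S τ z₀ x h := by
  obtain ⟨β, γ, T, m, n, hg⟩ := exists_isLoopLift hx g
  obtain ⟨β', γ', T', m', n', hh⟩ := exists_isLoopLift hx h
  have hmem : (m * τ + n : ℂ) ∈ lattice τ := mem_lattice.2 ⟨m, n, rfl⟩
  let p : Path z₀ (z₀ + (m * τ + n)) := ⟨γ, hg.zero, by rw [← add_assoc]; exact hg.one⟩
  let p' : Path (z₀ + (m * τ + n)) (z₀ + (m' * τ + n') + (m * τ + n)) :=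
    ⟨⟨fun t => γ' t + (m * τ + n), by fun_prop⟩, by simp [hh.zero], by
      simp only [hh.one, add_assoc]⟩
  have hT' : IsTransport (nu2 S τ) p' fun t => expX S (-(m : ℂ)) * (T' t * expX S m) := by
    refine ⟨?_, IsLocSol.const_mul (IsLocSol.translate hh.transport.2 fun t => ?_) _⟩
    · dsimp only
      rw [hh.transport.1, one_mul, expX_mul, neg_add_cancel, expX_zero]
    · filter_upwards [isOpen_curveDomain.mem_nhds (hh.mem t)] with z hz
      exact nu2_add_period hz m n
  have hp : ∀ t, p.trans p' t ∈ curveDomain S τ ∧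
      (QuotientAddGroup.mk (p.trans p' t) : ℂ ⧸ lattice τ) = (β.trans β' t).1 := by
    have : ∀ t, (QuotientAddGroup.mk (p.trans p' t) : ℂ ⧸ lattice τ) = (β.trans β' t).1 := by
      intro t
      rw [Path.trans_apply, Path.trans_apply]
      split_ifs
      · exact hg.lifts _
      · exact (QuotientAddGroup.mk_add_of_mem _ hmem).trans (hh.lifts _)
    exact fun t => ⟨fun α hα => by rw [this]; exact (β.trans β' t).2 α hα, this t⟩
  obtain ⟨T'', hT''⟩ := exists_isTransport (isConnForm_nu2 (S := S) (τ := τ))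
    ⟨fun t => ⟨p.trans p' t, (hp t).1⟩, by fun_prop⟩
  have hgh : IsLoopLift S τ z₀ (g * h) (β.trans β') (p.trans p').toContinuousMap T'' (m + m')
      (n + n') := by
    refine ⟨?_, (p.trans p').source, fun t => (hp t).2, ?_, hT''⟩
    · rw [Path.Homotopic.Quotient.mk_trans, hg.class_eq, hh.class_eq]
      rfl
    · refine (p.trans p').target.trans ?_
      push_cast
      ring
  rw [curveMonodromy_eq hgh, curveMonodromy_eq hg, curveMonodromy_eq hh,
    IsTransport.trans (nu2_nil τ) p p' hg.transport hT' hT'']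
  have e : expX S (m : ℂ) * expX S (-((m + m' : ℤ) : ℂ)) = expX S (-(m' : ℂ)) := by
    rw [expX_mul]; congr 1; push_cast; ring
  rw [mul_assoc, mul_assoc, mul_assoc, e]
  simp only [mul_assoc]

end CurveMonodromy

/-! ### The limit of the monodromy -/

section Limit

open Complex
open scoped UpperHalfPlane

variable {N : ℕ} [NeZero N] {S : AddSubgroup (Tors N)} {r : ℝ}

theorem tendsto_qPar : Filter.Tendsto (qPar N) UpperHalfPlane.atImInfty (𝓝 0) := by
  have h : (0 : ℝ) < N := by exact_mod_cast NeZero.pos N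
  refine (UpperHalfPlane.qParam_tendsto_atImInfty h).congr fun τ => ?_
  simp [Function.Periodic.qParam, qPar]

theorem eventually_norm_qPar_lt (hr : 0 < r) :
    ∀ᶠ τ in UpperHalfPlane.atImInfty, ‖qPar N τ‖ < r := by
  have := tendsto_qPar (N := N).norm
  rw [norm_zero] at this
  exact this.eventually_lt_const hr

/-- The preimage of the punctured annulus under `z ↦ exp(2πiz)`. -/
def strip (N : ℕ) (r : ℝ) : Set ℂ := {z | r < ‖wPar z‖ ∧ ‖wPar z‖ < r⁻¹ ∧ wPar z ^ N ≠ 1}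

theorem continuous_wPar : Continuous wPar := by unfold wPar; fun_prop

theorem isOpen_strip : IsOpen (strip N r) :=
  (isOpen_lt continuous_const continuous_wPar.norm).inter
    ((isOpen_lt continuous_wPar.norm continuous_const).inter
      (isOpen_ne.preimage (continuous_wPar.pow N)))

theorem mem_fiberChart_of_mem_strip {p z : ℂ} (hp : ‖p‖ < r) (hz : z ∈ strip N r) :
    (p, wPar z) ∈ fiberChart N := by
  obtain ⟨h1, h2, h3⟩ := hz
  have hr : 0 < r := (norm_nonneg p).trans_lt hp
  refine ⟨hp.trans h1, ?_, h3⟩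
  calc ‖p‖ * ‖wPar z‖ ≤ r * ‖wPar z‖ := by gcongr
    _ < r * r⁻¹ := by gcongr
    _ = 1 := mul_inv_cancel₀ hr.ne'

theorem isOpen_fiberChart : IsOpen (fiberChart N) := by
  have h1 : IsOpen {x : ℂ × ℂ | ‖x.1‖ < ‖x.2‖} := isOpen_lt (by fun_prop) (by fun_prop)
  have h2 : IsOpen {x : ℂ × ℂ | ‖x.1‖ * ‖x.2‖ < 1} := isOpen_lt (by fun_prop) (by fun_prop)
  have h3 : IsOpen {x : ℂ × ℂ | x.2 ^ N ≠ 1} := isOpen_ne_fun (by fun_prop) (by fun_prop)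
  exact h1.inter (h2.inter h3)

/-- The limit of the connection form `ν₂` for `Im τ → ∞`. -/
def nu2Limit (S : AddSubgroup (Tors N)) (z : ℂ) : NCSeries (Gen N S) :=
  (2 * Real.pi * I * wPar z : ℂ) • kzHom 0 (hasOrder_genT S) (kzForm (wPar z))

theorem nu2Limit_eq {z : ℂ} (hz : wPar z ^ N ≠ 1) :
    nu2Limit S z = (2 * Real.pi * I : ℂ) • conn S (genT S) (idJet N (0, wPar z)) := by
  have hw : wPar z ≠ 0 := Complex.exp_ne_zero _
  rw [nu2Limit, kzHom_kzForm 0 _ hw, conn_idJet_zero (isWidth_self S) hw hz, smul_smul,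
    mul_inv_cancel_right₀ hw]

theorem differentiableOn_connForm {p : ℂ} (hp : ‖p‖ < r) (l : List (Gen N S)) :
    DifferentiableOn ℂ (fun z => conn S (genT S) (idJet N (p, wPar z)) l) (strip N r) :=
  (differentiableOn_conn (fun α => holSeriesOn_idJet (NeZero.ne N) α) (genT S) l).comp
    (f := fun z : ℂ => (p, wPar z)) (by unfold wPar; fun_prop)
    fun _ hz => mem_fiberChart_of_mem_strip hp hz

theorem isConnForm_nu2Limit (hr : 0 < r) : IsConnForm (nu2Limit S) (strip N r) where
  isOpen := isOpen_strip
  nil z := hasOrder_one_iff.1 <|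
    ((hasOrder_one_iff.2 (isConnForm_kzForm.nil _)).substₐ (hasOrder_kzGen 0 (hasOrder_genT S))).smul _
  diff l := by
    refine ((differentiableOn_connForm (S := S) (p := 0) (by rwa [norm_zero]) l).const_mul
      (2 * Real.pi * I : ℂ)).congr fun z hz => ?_
    rw [nu2Limit_eq hz.2.2]; rfl

theorem differentiableOn_nu2 {τ : ℍ} (hτ : ‖qPar N τ‖ < r) (l : List (Gen N S)) :
    DifferentiableOn ℂ (fun z => nu2 S τ z l) (strip N r) := by
  refine ((differentiableOn_connForm (S := S) hτ l).const_mul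
    (2 * Real.pi * I : ℂ)).congr fun z hz => ?_
  rw [nu2_eq (isWidth_self S) (mem_fiberChart_of_mem_strip hτ hz)]; rfl

theorem tendstoLocallyUniformlyOn_nu2 (hr : 0 < r) (l : List (Gen N S)) :
    TendstoLocallyUniformlyOn (fun τ z => nu2 S τ z l) (fun z => nu2Limit S z l)
      UpperHalfPlane.atImInfty (strip N r) := by
  rw [Metric.tendstoLocallyUniformlyOn_iff]
  intro ε hε z hz
  set F : ℂ × ℂ → ℂ := fun x => (2 * Real.pi * I : ℂ) * conn S (genT S) (idJet N x) l with hF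
  have hFd : DifferentiableOn ℂ F (fiberChart N) :=
    (differentiableOn_conn (fun α => holSeriesOn_idJet (NeZero.ne N) α) (genT S) l).const_mul _
  have h0 : ((0 : ℂ), wPar z) ∈ fiberChart N :=
    mem_fiberChart_of_mem_strip (by rwa [norm_zero]) hz
  have hc : ContinuousAt (fun x : ℂ × ℂ => F (x.1, wPar x.2)) (0, z) :=
    ContinuousAt.comp (f := fun x : ℂ × ℂ => (x.1, wPar x.2)) (g := F)
      ((hFd.differentiableAt (isOpen_fiberChart.mem_nhds h0)).continuousAt)
      (continuous_fst.prodMk (continuous_wPar.comp continuous_snd)).continuousAt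
  have h1 := Metric.tendsto_nhds.1 hc (ε / 2) (by positivity)
  rw [nhds_prod_eq, Filter.eventually_prod_iff] at h1
  obtain ⟨pa, ha, pb, hb, h2⟩ := h1
  refine ⟨{z' | pb z'} ∩ strip N r, Filter.inter_mem (nhdsWithin_le_nhds hb) self_mem_nhdsWithin, ?_⟩
  filter_upwards [(tendsto_qPar (N := N)).eventually ha, eventually_norm_qPar_lt (N := N) hr] with τ h3 h4 y hy
  have e1 : nu2 S τ y l = F (qPar N τ, wPar y) := by
    rw [nu2_eq (isWidth_self S) (mem_fiberChart_of_mem_strip h4 hy.2)]; rfl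
  have e2 : nu2Limit S y l = F (0, wPar y) := by rw [nu2Limit_eq hy.2.2.2]; rfl
  rw [e1, e2]
  have h5 := h2 h3 hy.1
  have h6 := h2 ha.self_of_nhds hy.1
  dsimp only at h5 h6
  calc dist (F (0, wPar y)) (F (qPar N τ, wPar y))
      ≤ dist (F (0, wPar y)) (F (0, wPar z)) + dist (F (qPar N τ, wPar y)) (F (0, wPar z)) :=
        dist_triangle_right _ _ _
    _ < ε / 2 + ε / 2 := add_lt_add h6 h5
    _ = ε := add_halves ε

theorem pos_of_puncturedAnnulus (w : PuncturedAnnulus N r) : 0 < r := by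
  obtain ⟨h1, h2, -⟩ := w.2
  exact inv_pos.1 ((norm_nonneg _).trans_lt h2)

theorem hasDerivAt_wPar (z : ℂ) : HasDerivAt wPar (2 * Real.pi * I * wPar z) z := by
  have := ((hasDerivAt_id z).const_mul (2 * Real.pi * I : ℂ)).cexp
  rw [mul_one, mul_comm (cexp _)] at this
  exact this

theorem exists_log_lift {w₀ : PuncturedAnnulus N r} (β : Path w₀ w₀) :
    ∃ γ : C(unitInterval, ℂ), (∀ t, wPar (γ t) = (β t).1) ∧ γ 0 = logCoord w₀.1 ∧
      ∃ n : ℤ, γ 1 = logCoord w₀.1 + n := by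
  have hpi := Complex.two_pi_I_ne_zero
  let β' : C(unitInterval, {z : ℂ // z ≠ 0}) := ⟨fun t => ⟨(β t).1, (β t).ne_zero⟩, by fun_prop⟩
  obtain ⟨Γ, h1, h2⟩ := Complex.isCoveringMap_exp.exists_path_lifts β' (Complex.log w₀.1)
    (Subtype.ext (by simp [β', Complex.exp_log w₀.ne_zero]))
  have h3 : ∀ t, wPar (Γ t / (2 * Real.pi * I)) = (β t).1 := fun t => by
    rw [wPar, mul_div_cancel₀ _ hpi]
    exact congrArg Subtype.val (congrFun h1 t)
  refine ⟨⟨fun t => Γ t / (2 * Real.pi * I), by fun_prop⟩, h3, by simp [h2, logCoord], ?_⟩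
  have h4 := h3 1
  rw [β.target, wPar, ← exp_logCoord w₀.ne_zero, Complex.exp_eq_exp_iff_exists_int] at h4
  obtain ⟨n, hn⟩ := h4
  exact ⟨n, mul_left_cancel₀ hpi (by rw [mul_add, mul_comm _ (n : ℂ)]; exact hn)⟩

theorem mk_eq_mk_logCoord (τ : ℍ) {z w : ℂ} (h : wPar z = w) :
    (QuotientAddGroup.mk z : ℂ ⧸ lattice τ) = QuotientAddGroup.mk (logCoord w) := by
  have hw : w ≠ 0 := h ▸ Complex.exp_ne_zero _
  rw [← exp_logCoord hw, wPar, Complex.exp_eq_exp_iff_exists_int] at h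
  obtain ⟨n, hn⟩ := h
  rw [eq_comm, QuotientAddGroup.eq, mem_lattice]
  refine ⟨0, n, mul_left_cancel₀ Complex.two_pi_I_ne_zero ?_⟩
  linear_combination hn

open Classical in
/-- The inverse monodromy of the KZB connection along a loop in the annulus. -/
def annulusMonodromy (S : AddSubgroup (Tors N)) (w₀ : PuncturedAnnulus N r)
    (g : PiOne (PuncturedAnnulus N r) w₀) (τ : ℍ) : NCSeries (Gen N S) :=
  if hr : ‖qPar N τ‖ < r then curveMonodromy S τ (logCoord w₀.1) (annulusToCurve S τ hr w₀)
    (piOneMap (annulusToCurve S τ hr) w₀ g) else 0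

theorem tendsto_annulusMonodromy (w₀ : PuncturedAnnulus N r)
    (g : PiOne (PuncturedAnnulus N r) w₀) :
    Filter.Tendsto (annulusMonodromy S w₀ g) UpperHalfPlane.atImInfty
      (𝓝 (kzHom 0 (hasOrder_genT S)
        (kzMonodromy (annulusIncl N r w₀) (piOneMap (annulusIncl N r) w₀ g)))) := by
  have hr := pos_of_puncturedAnnulus w₀
  obtain ⟨β, hβ⟩ := Path.Homotopic.Quotient.mk_surjective (FundamentalGroup.toPath g.unop)
  obtain ⟨γ, h1, h2, n, h3⟩ := exists_log_lift β
  have hmem : ∀ t, γ t ∈ strip N r := fun t => by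
    rw [strip, Set.mem_ofPred_eq, h1]; exact (β t).2
  obtain ⟨R, hR⟩ := exists_kzTransport (β.map (annulusIncl N r).continuous)
  have hmap : ∀ {Y : Type} [TopologicalSpace Y] (f : C(PuncturedAnnulus N r, Y)),
      Path.Homotopic.Quotient.mk (β.map f.continuous) =
        FundamentalGroup.toPath (piOneMap f w₀ g).unop := fun f => by
    rw [Path.Homotopic.Quotient.mk_map, hβ]
    rfl
  rw [kzMonodromy_eq _ (hmap (annulusIncl N r)) hR]
  have hR' : IsTransport (nu2Limit S) γ fun t => kzHom 0 (hasOrder_genT S) (R t) := by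
    refine ⟨?_, ?_⟩
    · dsimp only
      rw [hR.1, map_one]
    · refine IsLocSol.of_comp (f := fun w => kzHom 0 (hasOrder_genT S) (kzForm w)) hasDerivAt_wPar ?_
      have := IsLocSol.subst (hasOrder_kzGen 0 (hasOrder_genT S)) hR.2
      simp only [h1]
      exact this
  have hT : ∀ τ : ℍ, ∃ T : unitInterval → NCSeries (Gen N S),
      ‖qPar N τ‖ < r → IsTransport (nu2 S τ) γ T := fun τ => by
    by_cases hτ : ‖qPar N τ‖ < r
    · obtain ⟨T, hT⟩ := exists_isTransport (f := nu2 S τ) (U := strip N r)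
        ⟨isOpen_strip, nu2_nil τ, differentiableOn_nu2 hτ⟩ ⟨fun t => ⟨γ t, hmem t⟩, by fun_prop⟩
      exact ⟨T, fun _ => hT⟩
    · exact ⟨0, fun h => absurd h hτ⟩
  choose T hT using hT
  have hev := eventually_norm_qPar_lt (N := N) hr
  refine (tendsto_transport (T := T) nu2_nil (isConnForm_nu2Limit hr) (fun z hz => ?_)
    (tendstoLocallyUniformlyOn_nu2 hr) γ.continuous hmem (hev.mono hT) hR').congr' ?_
  · obtain ⟨ρ, hρ, hρ'⟩ := Metric.isOpen_iff.1 isOpen_strip z hz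
    exact ⟨ρ, hρ, hρ', hev.mono fun τ hτ l => (differentiableOn_nu2 hτ l).mono hρ'⟩
  · filter_upwards [hev] with τ hτ
    have hl : IsLoopLift S τ (logCoord w₀.1) (piOneMap (annulusToCurve S τ hτ) w₀ g)
        (β.map (annulusToCurve S τ hτ).continuous) γ (T τ) 0 n :=
      ⟨hmap _, h2, fun t => mk_eq_mk_logCoord τ (h1 t), by rw [h3]; simp, hT τ hτ⟩
    rw [annulusMonodromy, dif_pos hτ, curveMonodromy_eq hl, Int.cast_zero, neg_zero, expX_zero,
      mul_one]

theorem tendsto_psiCurveOn (w₀ : PuncturedAnnulus N r)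
    (u : completedGroupAlgebra (PiOne (PuncturedAnnulus N r) w₀)) :
    Filter.Tendsto (psiCurveOn S w₀ u) UpperHalfPlane.atImInfty
      (𝓝 (kzHom 0 (hasOrder_genT S) (psiKZ (annulusIncl N r w₀)
        (completedMap (piOneMap (annulusIncl N r) w₀) u)))) := by
  rw [tendsto_iff]
  intro l
  have hr := pos_of_puncturedAnnulus w₀
  obtain ⟨y, hy⟩ := Ideal.Quotient.mk_surjective (u.1 (l.length + 1))
  set Θ := fun g => kzMonodromy (annulusIncl N r w₀) (piOneMap (annulusIncl N r) w₀ g)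
  have e1 : kzHom 0 (hasOrder_genT S) (psiKZ (annulusIncl N r w₀)
      (completedMap (piOneMap (annulusIncl N r) w₀) u)) l =
      y.coeff.sum fun g a => a * kzHom 0 (hasOrder_genT S) (Θ g) l := by
    have h : HasOrder (l.length + 1) (psiKZ (annulusIncl N r w₀)
        (completedMap (piOneMap (annulusIncl N r) w₀) u) - y.coeff.sum fun g a => a • Θ g) :=
      fun w hw => by
        rw [sub_apply, psiKZ, extendToCompletion_completedMap (kzMonodromy_mul _)
          (kzMonodromy_nil _) _ u hy hw, sub_self]
    have := h.substₐ (hasOrder_kzGen 0 (hasOrder_genT S)) l (Nat.lt_succ_self _)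
    rw [map_sub, sub_apply, sub_eq_zero] at this
    refine this.trans ?_
    rw [Finsupp.sum, map_sum, NCSeries.sum_apply]
    refine Finset.sum_congr rfl fun g _ => ?_
    rw [map_smul, NCSeries.smul_apply]
    rfl
  rw [e1]
  have h2 : Filter.Tendsto (fun τ => y.coeff.sum fun g a => a * annulusMonodromy S w₀ g τ l)
      UpperHalfPlane.atImInfty
      (𝓝 (y.coeff.sum fun g a => a * kzHom 0 (hasOrder_genT S) (Θ g) l)) :=
    tendsto_finsetSum _ fun g _ =>
      (tendsto_iff.1 (tendsto_annulusMonodromy w₀ g) l).const_mul _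
  refine h2.congr' ?_
  filter_upwards [eventually_norm_qPar_lt (N := N) hr] with τ hτ
  rw [psiCurveOn, dif_pos hτ, psiCurve, extendToCompletion_completedMap (curveMonodromy_mul rfl)
    (curveMonodromy_nil rfl) _ u hy (Nat.lt_succ_self _), Finsupp.sum, Finsupp.sum,
    NCSeries.sum_apply]
  refine Finset.sum_congr rfl fun g _ => ?_
  rw [NCSeries.smul_apply, annulusMonodromy, dif_pos hτ]

end Limit

end KZB

end

theorem theorem4 (N : ℕ) [NeZero N] :
    (∀ (S : AddSubgroup (KZB.Tors N)) (c : ℕ),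
      (S = ⊤ ∧ c = N) ∨ (S = KZB.realTors N ∧ c = 1) →
      ∃ φ : KZB.NCSeries (KZB.KZLetter N) →ₐ[ℂ] KZB.NCSeries (KZB.Gen N S),
        Continuous φ ∧
        (∀ f ∈ KZB.NCSeries.freeLie (KZB.KZLetter N), φ f ∈ KZB.pLie S) ∧
        φ (KZB.NCSeries.letter KZB.KZLetter.zero) = KZB.e0Series S (KZB.genT S) 0 ∧
        (∀ k : ZMod N, φ (KZB.NCSeries.letter (KZB.KZLetter.root k)) = KZB.genT S (k, 0)) ∧
        (∃ G H : ℂ × ℂ → KZB.NCSeries (KZB.Gen N S) →ₗ[ℂ] KZB.NCSeries (KZB.Gen N S),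
          KZB.IsLogForm S c G H ∧
          ∀ w : ℂ, w ≠ 0 → w ^ N ≠ 1 →
            H (0, w) = LieAlgebra.ad ℂ (KZB.NCSeries (KZB.Gen N S)) (φ (KZB.kzForm w))) ∧
        (∀ (r : ℝ) (w₀ : KZB.PuncturedAnnulus N r),
          ∀ u ∈ KZB.malcevLie (KZB.PiOne (KZB.PuncturedAnnulus N r) w₀),
            Filter.Tendsto (KZB.psiCurveOn S w₀ u) UpperHalfPlane.atImInfty
              (𝓝 (φ (KZB.psiKZ (KZB.annulusIncl N r w₀)
                (KZB.completedMap (KZB.piOneMap (KZB.annulusIncl N r) w₀) u)))))) ∧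
    KZB.e0Series (KZB.realTors N) (KZB.genT (KZB.realTors N)) 0 =
      KZB.actX (KZB.realTors N) KZB.expSubOneDiv⁻¹ (KZB.genY (KZB.realTors N)) ∧
    (∀ (γ : Matrix.SpecialLinearGroup (Fin 2) ℤ) (j : ℤ),
      ∃ φ : KZB.NCSeries (KZB.KZLetter N) →ₐ[ℂ]
          KZB.NCSeries (KZB.Gen N (⊤ : AddSubgroup (KZB.Tors N))),
        Continuous φ ∧
        (∀ f ∈ KZB.NCSeries.freeLie (KZB.KZLetter N), φ f ∈ KZB.pLie ⊤) ∧
        φ (KZB.NCSeries.letter KZB.KZLetter.zero) =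
          KZB.e0Series ⊤ (fun α => KZB.genT ⊤ (KZB.torsAct α γ⁻¹)) j ∧
        (∀ k : ZMod N, φ (KZB.NCSeries.letter (KZB.KZLetter.root k)) =
          KZB.actX ⊤ (KZB.expSeries (-(j / N : ℂ)))
            (KZB.genT ⊤ (KZB.torsAct (k, (j : ZMod N)) γ⁻¹))) ∧
        ∃ H : ℂ × ℂ → KZB.NCSeries (KZB.Gen N (⊤ : AddSubgroup (KZB.Tors N))) →ₗ[ℂ]
            KZB.NCSeries (KZB.Gen N (⊤ : AddSubgroup (KZB.Tors N))),
          KZB.IsCuspForm ⊤ γ j H ∧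
          ∀ w : ℂ, w ≠ 0 → w ^ N ≠ 1 →
            H (0, w) = LieAlgebra.ad ℂ (KZB.NCSeries (KZB.Gen N (⊤ : AddSubgroup (KZB.Tors N))))
              (φ (KZB.kzForm w))) := by
  refine ⟨fun S c hSc => ?_, KZB.e0Series_realTors, fun γ j => ?_⟩
  · have hc : KZB.IsWidth S c := by
      rcases hSc with ⟨rfl, rfl⟩ | ⟨rfl, rfl⟩
      · exact KZB.isWidth_self _
      · exact KZB.isWidth_realTors
    refine ⟨KZB.kzHom 0 (KZB.hasOrder_genT S), KZB.NCSeries.continuous_substₐ _,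
      fun f hf => KZB.NCSeries.map_mem_freeLie _ (KZB.NCSeries.continuous_substₐ _) (fun x => ?_) hf,
      KZB.NCSeries.substₐ_letter _ _, fun k => ?_, KZB.exists_isLogForm hc,
      fun r w₀ u _ => KZB.tendsto_psiCurveOn w₀ u⟩
    · rw [KZB.NCSeries.substₐ_letter]
      exact KZB.kzGen_mem 0 (KZB.genT_mem S) x
    · refine (KZB.NCSeries.substₐ_letter _ _).trans ?_
      simp [KZB.kzGen, KZB.expSeries_zero, KZB.actX, KZB.NCSeries.one_adSeries]
  · obtain ⟨H, hH⟩ := KZB.exists_isCuspForm (N := N) γ j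
    refine ⟨KZB.kzHom j fun α => KZB.hasOrder_genT ⊤ (KZB.torsAct α γ⁻¹),
      KZB.NCSeries.continuous_substₐ _,
      fun f hf => KZB.NCSeries.map_mem_freeLie _ (KZB.NCSeries.continuous_substₐ _) (fun x => ?_) hf,
      KZB.NCSeries.substₐ_letter _ _, fun k => KZB.NCSeries.substₐ_letter _ _, H, hH⟩
    rw [KZB.NCSeries.substₐ_letter]
    exact KZB.kzGen_mem j (fun α => KZB.genT_mem ⊤ _) x
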